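/- Let $T^*\mathbb C^n=\{(z;\zeta)\in\mathbb C^n\times\mathbb C^n\}$, with the maximum norm $\|\cdot\|$ on $\mathbb C^n$. Let $\Omega\subset T^*\mathbb C^n$ be an open conic set contained in the cone generated by a compact subset of $T^*\mathbb C^n$, and let $S=\{\eta\in\mathbb C:\ 0<|\eta|<r,\ |\arg\eta|<\theta/4\}$ with $0<r,\theta<\tfrac12$. For $d>0$, $\rho\in\,]0,1[$ let $\Omega_\rho$ be the closure of $\bigcup_{(z;\zeta)\in\Omega}\{(z+z';\zeta+\zeta'):\ \|z'\|\le\rho,\ \|\zeta'\|\le\rho\|\zeta\|\}$, let $d_\rho=d(1-\rho)$ and $\Omega_\rho[d_\rho]=\{(z;\zeta)\in\Omega_\rho:\ \|\zeta\|\ge d_\rho\}$. Consider formal series $P(t;z,\zeta,\eta)=\sum_{\nu\ge0}t^\nu P_\nu(z,\zeta,\eta)$ whose coefficients are all holomorphic on a neighbourhood of $\Omega_\rho[d_\rho]\times S$ for some $d>0$, $\rho\in\,]0,1[$; two such series are equal if their coefficients agree on $\Omega_\rho[d_\rho]\times S$ for some $d,\rho$. Then $P\in\widehat{\mathfrak N}_{\rm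 cl}(\Omega;S)$ if, for some such $d,\rho$, there is $A>0$ such that for every compact $Z\subset S$ and every $h>0$ there is $C_{h,Z}>0$ with $$\Bigl|\sum_{\nu=0}^{m-1}P_\nu(z,\zeta,\eta)\Bigr|\le\frac{C_{h,Z}\,m!\,A^m e^{h\|\zeta\|}}{\|\eta\zeta\|^m}\qquad(m\ge1,\ (z;\zeta)\in\Omega_\rho[d_\rho],\ \eta\in Z);$$ and $P\in\widehat{\mathfrak S}_{\rm cl}(\Omega;S)$ if $\partial_\eta P\in\widehat{\mathfrak N}_{\rm cl}(\Omega;S)$ and, for some such $d,\rho$, there is $A>0$ such that for every compact $Z\subset S$ and every $h>0$ there is $C_{h,Z}>0$ with $$|P_\nu(z,\zeta,\eta)|\le\frac{C_{h,Z}\,\nu!\,A^\nu e^{h\|\zeta\|}}{\|\eta\zeta\|^\nu}\qquad(\nu\ge0,\ (z;\zeta)\in\Omega_\rho[d_\rho],\ \eta\in Z).$$ With $e^{t\langle\partial_{\zeta'},\partial_{z'}\rangle}=\sum_\alpha\frac{t^{|\alpha|}}{\alpha!}\partial_{\zeta'}^\alpha\partial_{z'}^\alpha$, set, for $P,Q\in\widehat{\mathfrak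 S}_{\rm cl}(\Omega;S)$, $$Q\circ P(t;z,\zeta,\eta)=e^{t\langle\partial_{\zeta'},\partial_{z'}\rangle}Q(t;z,\zeta',\eta)P(t;z',\zeta,\eta)\Big|_{z'=z,\ \zeta'=\zeta}=e^{t\langle\partial_{\zeta'},\partial_{z'}\rangle}Q(t;z,\zeta+\zeta',\eta)P(t;z+z',\zeta,\eta)\Big|_{z'=0,\ \zeta'=0}.$$ Then these two expressions agree, and: (1) If $P,Q\in\widehat{\mathfrak S}_{\rm cl}(\Omega;S)$, then $Q\circ P\in\widehat{\mathfrak S}_{\rm cl}(\Omega;S)$. If one of $P,Q$ lies in $\widehat{\mathfrak N}_{\rm cl}(\Omega;S)$ and the other in $\widehat{\mathfrak S}_{\rm cl}(\Omega;S)$, then $Q\circ P\in\widehat{\mathfrak N}_{\rm cl}(\Omega;S)$. (2) $R\circ(Q\circ P)=(R\circ Q)\circ P$ for all $P,Q,R\in\widehat{\mathfrak S}_{\rm cl}(\Omega;S)$. (3) Let $z=\Phi(w)$ be a biholomorphic map from an open subset of $\mathbb C^n$ onto an open neighbourhood of the closure of the projection of $\Omega$ to $\mathbb C^n$. Let $J^*_\Phi(z',z)$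 be any matrix of functions, holomorphic near the diagonal, with $\Phi^{-1}(z')-\Phi^{-1}(z)=J^*_\Phi(z',z)(z'-z)$ there, and let $(w;\lambda)$ be the coordinates given by $z=\Phi(w)$, $\zeta={}^{\mathsf t}\bigl[\tfrac{\partial w}{\partial z}(z)\bigr]\lambda$. Put $$\Phi^*P(t;w,\lambda,\eta)=e^{t\langle\partial_{\zeta'},\partial_{z'}\rangle}P\bigl(t;\Phi(w),\zeta'+{}^{\mathsf t}J^*_\Phi(\Phi(w)+z',\Phi(w))\lambda,\eta\bigr)\Big|_{z'=0,\ \zeta'=0}.$$ Then $\Phi^*Q\circ\Phi^*P=\Phi^*(Q\circ P)$ for all $P,Q\in\widehat{\mathfrak S}_{\rm cl}(\Omega;S)$, as formal series with respect to the set $\Omega$ written in the coordinates $(w;\lambda)$. -/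

import Mathlib

namespace ApparentSymbol

open Filter Topology

/-- The space `ℂⁿ`; its norm is the maximum norm `max |zᵢ|`. -/
abbrev E (n : ℕ) : Type := Fin n → ℂ

/-- A formal power series `∑ t^ν P_ν(z, ζ, η)` in `t`, given by its coefficients. -/
abbrev FormalSeries (n : ℕ) : Type := ℕ → E n → E n → ℂ → ℂ

section Derivatives

variable {n : ℕ}

/-- The complex partial derivative `∂f/∂xᵢ` on `ℂⁿ`. -/
noncomputable def pderiv (i : Fin n) (f : E n → ℂ) : E n → ℂ :=
  fun x => lineDeriv ℂ f x (Pi.single i 1)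

/-- The iterated partial derivative `∂^α f = ∂₁^{α₁} ⋯ ∂ₙ^{αₙ} f`. -/
noncomputable def mderiv (α : Fin n → ℕ) (f : E n → ℂ) : E n → ℂ :=
  (List.finRange n).foldr (fun i g => (pderiv i)^[α i] g) f

/-- `α! = α₁! ⋯ αₙ!`. -/
def multiFactorial (α : Fin n → ℕ) : ℕ := ∏ i, (α i).factorial

/-- The operator `e^{t⟨∂_{ζ'}, ∂_{z'}⟩} = ∑_α (t^{|α|} / α!) ∂_{ζ'}^α ∂_{z'}^α` on formal power
series `F = ∑ t^k F_k(z', ζ')`: the coefficient of `t^ν` of the result, at the point `(z', ζ')`. -/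
noncomputable def expOp (F : ℕ → E n → E n → ℂ) (ν : ℕ) (z' ζ' : E n) : ℂ :=
  ∑ p ∈ Finset.HasAntidiagonal.antidiagonal ν, ∑ α ∈ Finset.piAntidiag (Finset.univ : Finset (Fin n)) p.2,
    ((multiFactorial α : ℂ))⁻¹ *
      mderiv α (fun y : E n => mderiv α (fun x : E n => F p.1 x y) z') ζ'

/-- The product
`Q ∘ P = e^{t⟨∂_{ζ'}, ∂_{z'}⟩} Q(t; z, ζ + ζ', η) P(t; z + z', ζ, η)` at `z' = 0`, `ζ' = 0`. -/
noncomputable def circ (Q P : FormalSeries n) : FormalSeries n :=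
  fun ν z ζ η =>
    expOp (fun m z' ζ' =>
      ∑ q ∈ Finset.HasAntidiagonal.antidiagonal m, Q q.1 z (ζ + ζ') η * P q.2 (z + z') ζ η) ν 0 0

/-- The coefficientwise derivative `∂_η P`. -/
noncomputable def etaDeriv (P : FormalSeries n) : FormalSeries n :=
  fun ν z ζ η => deriv (fun η' => P ν z ζ η') η

end Derivatives

section Domains

variable {n : ℕ}

/-- Conic subsets of `T^*ℂⁿ = ℂⁿ × ℂⁿ`: stable under `(z; ζ) ↦ (z; cζ)`, `c > 0`. -/
def IsConic (V : Set (E n × E n)) : Prop :=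
  ∀ z ζ : E n, (z, ζ) ∈ V → ∀ c : ℝ, 0 < c → (z, (c : ℂ) • ζ) ∈ V

/-- `V ⋐ U` in the conic sense: `V` is contained in the cone over a compact subset of `U`. -/
def ConicSubset (V U : Set (E n × E n)) : Prop :=
  ∃ K : Set (E n × E n), IsCompact K ∧ K ⊆ U ∧
    ∀ z ζ : E n, (z, ζ) ∈ V → ∃ c : ℝ, 0 < c ∧ ∃ ζ₀ : E n, (z, ζ₀) ∈ K ∧ ζ = (c : ℂ) • ζ₀

/-- The closed set `Ω_ρ`. -/
def thicken (Ω : Set (E n × E n)) (ρ : ℝ) : Set (E n × E n) :=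
  closure {x | ∃ z ζ z' ζ' : E n, (z, ζ) ∈ Ω ∧ ‖z'‖ ≤ ρ ∧ ‖ζ'‖ ≤ ρ * ‖ζ‖ ∧
    x = (z + z', ζ + ζ')}

/-- The set `Ω_ρ[d_ρ]`, where `V[d] = {(z; ζ) ∈ V : ‖ζ‖ ≥ d}` and `d_ρ = d (1 - ρ)`. -/
def region (Ω : Set (E n × E n)) (d ρ : ℝ) : Set (E n × E n) :=
  {x | x ∈ thicken Ω ρ ∧ d * (1 - ρ) ≤ ‖x.2‖}

/-- The open sector `{η : 0 < |η| < r, |arg η| < θ / 4}`. -/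
def sector (r θ : ℝ) : Set ℂ := {η | 0 < ‖η‖ ∧ ‖η‖ < r ∧ |Complex.arg η| < θ / 4}

/-- `P ∈ Γ(Ω_ρ[d_ρ] × S; 𝒪)⟦t⟧`: each coefficient is holomorphic on a neighbourhood of
`Ω_ρ[d_ρ] × S`. -/
def HolOn (Ω : Set (E n × E n)) (S : Set ℂ) (d ρ : ℝ) (P : FormalSeries n) : Prop :=
  ∀ ν, AnalyticOnNhd ℂ (fun x : E n × E n × ℂ => P ν x.1 x.2.1 x.2.2)
    {x | (x.1, x.2.1) ∈ region Ω d ρ ∧ x.2.2 ∈ S}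

/-- Classical formal null-symbols on `Ω` with an apparent parameter in `S`. -/
def IsNullSymbol (Ω : Set (E n × E n)) (S : Set ℂ) (P : FormalSeries n) : Prop :=
  ∃ d ρ : ℝ, 0 < d ∧ 0 < ρ ∧ ρ < 1 ∧ HolOn Ω S d ρ P ∧
    ∃ A : ℝ, 0 < A ∧ ∀ Z : Set ℂ, IsCompact Z → Z ⊆ S → ∀ h : ℝ, 0 < h →
      ∃ C : ℝ, 0 < C ∧ ∀ m : ℕ, 1 ≤ m → ∀ z ζ : E n, (z, ζ) ∈ region Ω d ρ → ∀ η ∈ Z,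
        ‖∑ ν ∈ Finset.range m, P ν z ζ η‖ ≤
          C * (m.factorial : ℝ) * A ^ m * Real.exp (h * ‖ζ‖) / ‖η • ζ‖ ^ m

/-- Classical formal symbols on `Ω` with an apparent parameter in `S`. -/
def IsSymbol (Ω : Set (E n × E n)) (S : Set ℂ) (P : FormalSeries n) : Prop :=
  (∃ d ρ : ℝ, 0 < d ∧ 0 < ρ ∧ ρ < 1 ∧ HolOn Ω S d ρ P ∧
    ∃ A : ℝ, 0 < A ∧ ∀ Z : Set ℂ, IsCompact Z → Z ⊆ S → ∀ h : ℝ, 0 < h →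
      ∃ C : ℝ, 0 < C ∧ ∀ ν : ℕ, ∀ z ζ : E n, (z, ζ) ∈ region Ω d ρ → ∀ η ∈ Z,
        ‖P ν z ζ η‖ ≤
          C * (ν.factorial : ℝ) * A ^ ν * Real.exp (h * ‖ζ‖) / ‖η • ζ‖ ^ ν) ∧
  IsNullSymbol Ω S (etaDeriv P)

/-- Equality of formal series as elements of `Γ(Ω_ρ[d_ρ] × S; 𝒪)⟦t⟧` for some `d` and `ρ`: all
coefficients of both are holomorphic near `Ω_ρ[d_ρ] × S` and agree there. -/
def SymbolEq (Ω : Set (E n × E n)) (S : Set ℂ) (F G : FormalSeries n) : Prop :=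
  ∃ d ρ : ℝ, 0 < d ∧ 0 < ρ ∧ ρ < 1 ∧ HolOn Ω S d ρ F ∧ HolOn Ω S d ρ G ∧
    ∀ ν : ℕ, ∀ z ζ : E n, (z, ζ) ∈ region Ω d ρ → ∀ η ∈ S, F ν z ζ η = G ν z ζ η

end Domains

section CoordinateChange

variable {n : ℕ}

/-- `z = Φ(w)` is a biholomorphic map between the open sets `Φ.source` and `Φ.target`. -/
def IsBiholomorphic (Φ : OpenPartialHomeomorph (E n) (E n)) : Prop :=
  AnalyticOnNhd ℂ Φ Φ.source ∧ AnalyticOnNhd ℂ Φ.symm Φ.target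

/-- The Jacobian matrix `∂w/∂z (z)` of `Φ⁻¹`. -/
noncomputable def jacobianSymm (Φ : OpenPartialHomeomorph (E n) (E n)) (z : E n) :
    Matrix (Fin n) (Fin n) ℂ :=
  Matrix.of fun i j => fderiv ℂ Φ.symm z (Pi.single j 1) i

/-- `J(z', z)` is a matrix of functions, holomorphic on a neighbourhood of the diagonal, with
`Φ⁻¹(z') - Φ⁻¹(z) = J(z', z) (z' - z)`. -/
def IsJStar (Φ : OpenPartialHomeomorph (E n) (E n))
    (J : E n → E n → Matrix (Fin n) (Fin n) ℂ) : Prop :=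
  ∀ z ∈ Φ.target,
    (∀ i j, AnalyticAt ℂ (fun p : E n × E n => J p.1 p.2 i j) (z, z)) ∧
    ∀ᶠ p : E n × E n in 𝓝 (z, z), Φ.symm p.1 - Φ.symm p.2 = (J p.1 p.2).mulVec (p.1 - p.2)

/-- The set `Ω` written in the coordinates `(w; μ)`, where `z = Φ(w)` and
`ζ = ᵗ[∂w/∂z (z)] μ`. -/
def pullbackSet (Φ : OpenPartialHomeomorph (E n) (E n)) (Ω : Set (E n × E n)) :
    Set (E n × E n) :=
  {x | x.1 ∈ Φ.source ∧
    (Φ x.1, (jacobianSymm Φ (Φ x.1)).transpose.mulVec x.2) ∈ Ω}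

/-- `Φ^*P(t; w, μ, η) = e^{t⟨∂_{ζ'}, ∂_{z'}⟩} P(t; Φ(w), ζ' + ᵗJ(Φ(w) + z', Φ(w)) μ, η)`
at `z' = 0`, `ζ' = 0`. -/
noncomputable def pullback (Φ : OpenPartialHomeomorph (E n) (E n))
    (J : E n → E n → Matrix (Fin n) (Fin n) ℂ) (P : FormalSeries n) : FormalSeries n :=
  fun ν w μ η =>
    expOp (fun k z' ζ' => P k (Φ w) (ζ' + (J (Φ w + z') (Φ w)).transpose.mulVec μ) η) ν 0 0

end CoordinateChange

end ApparentSymbol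

open ApparentSymbol

/-! Everything except growth is checked on germs at one point. Over the ring `Hol x` of germs of
holomorphic functions in (z, ζ, η), the product becomes a star product on power series in t, the
exponential of the bidifferential operator ∑ ∂_{ζᵢ} ⊗ ∂_{zᵢ} (`exists_germ_circ`). All maps involved
are additive and commute with multiplication by t, so an identity between them only has to be tested
on series constant in t (`IsXLinear.ext`).

For (2), on constants both bracketings are the divided powers of one sum of commuting operators on
three factors (`contract_assoc`).

For (1), Cauchy's estimates on polydiscs of radii ε in z' and ε‖ζ‖ in ζ' bound the product by the
bounds of its factors (`IsFormalSymbol.circ`). A series is a null-symbol exactly when the series of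
its partial sums obeys the symbol bounds, and partial sums commute with the product because they are
determined by S = t(P + S); null-symbols thus reduce to the same estimate. The condition on ∂_η
follows from the Leibniz rule.

For (3), let D(Q, P) be Φ^*Q ∘ Φ^*P − Φ^*(Q ∘ P). It vanishes for Q = 1, and functions of (z, η)
factor out of it. For ζᵢ, integration by parts in the exponential operator (z'ₖ acts as t∂_{ζ'ₖ},
and ζ'ₖ as t∂_{z'ₖ}) shows that Φ^* respects right and left products with ζᵢ (`pull_mul_zeta`,
`pull_zeta_star`). Associativity then gives D(ζᵢQ, P) = D(Q, P) ∘ Φ^*ζᵢ + t D(Q, ∂_{zᵢ}P)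
(`defect_zeta`). Expanding Q about the base point gains at each step a factor from the maximal ideal
or a power of t. So every coefficient of D lies in all powers of the maximal ideal and is zero
(`pull_star`). Finally, compactness shows that small thickenings of Ω in the coordinates (w; λ) are
sent into the domain where P and Q are holomorphic (`exists_region_pullback`). -/

namespace ApparentSymbol

open Filter Topology PowerSeries

/-! ### X-linear maps between power series rings -/

section XLinear

variable {M M' M'' : Type*} [CommRing M] [CommRing M'] [CommRing M'']

/-- Additive maps between power series rings commuting with multiplication by the variable. -/
structure IsXLinear (f : M⟦X⟧ → M'⟦X⟧) : Prop where
  map_add : ∀ F G, f (F + G) = f F + f G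
  map_X_mul : ∀ F, f (X * F) = X * f F

namespace IsXLinear

theorem map_zero {f : M⟦X⟧ → M'⟦X⟧} (hf : IsXLinear f) : f 0 = 0 := by
  have := hf.map_add 0 0
  simpa using this

theorem map_neg {f : M⟦X⟧ → M'⟦X⟧} (hf : IsXLinear f) (F : M⟦X⟧) : f (-F) = -f F := by
  have := hf.map_add (-F) F
  rw [neg_add_cancel, hf.map_zero] at this
  exact eq_neg_of_add_eq_zero_left this.symm

theorem map_sub {f : M⟦X⟧ → M'⟦X⟧} (hf : IsXLinear f) (F G : M⟦X⟧) : f (F - G) = f F - f G := by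
  rw [sub_eq_add_neg, hf.map_add, hf.map_neg, sub_eq_add_neg]

theorem map_sum {f : M⟦X⟧ → M'⟦X⟧} (hf : IsXLinear f) {ι : Type*} (s : Finset ι)
    (F : ι → M⟦X⟧) : f (∑ i ∈ s, F i) = ∑ i ∈ s, f (F i) := by
  classical
  induction s using Finset.induction_on with
  | empty => simpa using hf.map_zero
  | insert a s ha ih => rw [Finset.sum_insert ha, hf.map_add, ih, Finset.sum_insert ha]

theorem comp {f : M'⟦X⟧ → M''⟦X⟧} {g : M⟦X⟧ → M'⟦X⟧} (hf : IsXLinear f) (hg : IsXLinear g) :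
    IsXLinear fun F => f (g F) :=
  ⟨fun F G => by rw [hg.map_add, hf.map_add], fun F => by rw [hg.map_X_mul, hf.map_X_mul]⟩

theorem add {f g : M⟦X⟧ → M'⟦X⟧} (hf : IsXLinear f) (hg : IsXLinear g) :
    IsXLinear fun F => f F + g F :=
  ⟨fun F G => by rw [hf.map_add, hg.map_add]; ring, fun F => by
    rw [hf.map_X_mul, hg.map_X_mul]; ring⟩

theorem sub {f g : M⟦X⟧ → M'⟦X⟧} (hf : IsXLinear f) (hg : IsXLinear g) :
    IsXLinear fun F => f F - g F :=
  ⟨fun F G => by rw [hf.map_add, hg.map_add]; ring, fun F => by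
    rw [hf.map_X_mul, hg.map_X_mul]; ring⟩

theorem sum {ι : Type*} {s : Finset ι} {f : ι → M⟦X⟧ → M'⟦X⟧} (hf : ∀ i ∈ s, IsXLinear (f i)) :
    IsXLinear fun F => ∑ i ∈ s, f i F :=
  ⟨fun F G => by
    rw [← Finset.sum_add_distrib]; exact Finset.sum_congr rfl fun i hi => (hf i hi).map_add F G,
   fun F => by
    rw [Finset.mul_sum]; exact Finset.sum_congr rfl fun i hi => (hf i hi).map_X_mul F⟩

theorem mul_left {f : M⟦X⟧ → M'⟦X⟧} (hf : IsXLinear f) (H : M'⟦X⟧) :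
    IsXLinear fun F => H * f F :=
  ⟨fun F G => by rw [hf.map_add]; ring, fun F => by rw [hf.map_X_mul]; ring⟩

theorem mul_right {f : M⟦X⟧ → M'⟦X⟧} (hf : IsXLinear f) (H : M'⟦X⟧) :
    IsXLinear fun F => f F * H :=
  ⟨fun F G => by rw [hf.map_add]; ring, fun F => by rw [hf.map_X_mul]; ring⟩

protected theorem id : IsXLinear fun F : M⟦X⟧ => F := ⟨fun _ _ => rfl, fun _ => rfl⟩

/-- Writing F = X F' + C q, the term X F' contributes the coefficient of index N − 1 of f F', which
is handled by induction; only finitely many constants enter, so no continuity of f is needed. -/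
theorem coeff_eq_zero {f : M⟦X⟧ → M'⟦X⟧} (hf : IsXLinear f) (N : ℕ)
    (h : ∀ k ≤ N, ∀ q : M, coeff k (f (C q)) = 0) (F : M⟦X⟧) : coeff N (f F) = 0 := by
  induction N generalizing F with
  | zero =>
    rw [eq_X_mul_shift_add_const F, hf.map_add, hf.map_X_mul, _root_.map_add, h 0 le_rfl]
    simp
  | succ N ih =>
    rw [eq_X_mul_shift_add_const F, hf.map_add, hf.map_X_mul, _root_.map_add, h _ le_rfl,
      coeff_succ_X_mul, ih (fun k hk => h k (hk.trans N.le_succ)), add_zero]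

theorem ext {f g : M⟦X⟧ → M'⟦X⟧} (hf : IsXLinear f) (hg : IsXLinear g)
    (h : ∀ q : M, f (C q) = g (C q)) (F : M⟦X⟧) : f F = g F := by
  refine sub_eq_zero.1 (PowerSeries.ext fun N => ?_)
  exact (hf.sub hg).coeff_eq_zero N (fun k _ q => by simp [h q]) F

end IsXLinear

variable [Algebra ℂ M] [Algebra ℂ M']

/-- The coefficientwise extension of a linear map to power series. -/
noncomputable def coeffMap (φ : M →ₗ[ℂ] M') (F : M⟦X⟧) : M'⟦X⟧ :=
  PowerSeries.mk fun k => φ (coeff k F)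

theorem coeff_coeffMap (φ : M →ₗ[ℂ] M') (F : M⟦X⟧) (k : ℕ) :
    coeff k (coeffMap φ F) = φ (coeff k F) := coeff_mk _ _

theorem coeffMap_C (φ : M →ₗ[ℂ] M') (q : M) : coeffMap φ (C q) = C (φ q) := by
  ext k
  rw [coeff_coeffMap, coeff_C, coeff_C]
  split_ifs <;> simp

theorem isXLinear_coeffMap (φ : M →ₗ[ℂ] M') : IsXLinear (coeffMap φ) where
  map_add F G := by ext k; simp [coeff_coeffMap]
  map_X_mul F := by
    ext k
    cases k <;> simp [coeff_coeffMap, coeff_succ_X_mul]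

/-- The `X`-linear extension to power series of a map with values in power series, given by the
sequence of its coefficients. -/
noncomputable def seriesExtend (φ : ℕ → M →ₗ[ℂ] M') (F : M⟦X⟧) : M'⟦X⟧ :=
  PowerSeries.mk fun ν => ∑ p ∈ Finset.HasAntidiagonal.antidiagonal ν, φ p.2 (coeff p.1 F)

theorem coeff_seriesExtend (φ : ℕ → M →ₗ[ℂ] M') (F : M⟦X⟧) (ν : ℕ) :
    coeff ν (seriesExtend φ F) =
      ∑ p ∈ Finset.HasAntidiagonal.antidiagonal ν, φ p.2 (coeff p.1 F) := coeff_mk _ _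

theorem isXLinear_seriesExtend (φ : ℕ → M →ₗ[ℂ] M') : IsXLinear (seriesExtend φ) where
  map_add F G := by ext k; simp [coeff_seriesExtend, Finset.sum_add_distrib]
  map_X_mul F := by
    ext k
    cases k with
    | zero => simp [coeff_seriesExtend]
    | succ k =>
      rw [coeff_seriesExtend, coeff_succ_X_mul, coeff_seriesExtend, Finset.Nat.antidiagonal_succ]
      simp [coeff_succ_X_mul]

theorem coeff_seriesExtend_C (φ : ℕ → M →ₗ[ℂ] M') (q : M) (ν : ℕ) :
    coeff ν (seriesExtend φ (C q)) = φ ν q := by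
  rw [coeff_seriesExtend, Finset.sum_eq_single (0, ν)]
  · simp
  · rintro ⟨i, j⟩ hp hne
    rw [coeff_C, if_neg]
    · simp
    · rintro rfl
      rw [Finset.HasAntidiagonal.mem_antidiagonal] at hp
      exact hne (by simp_all)
  · simp [Finset.HasAntidiagonal.mem_antidiagonal]

end XLinear

/-! ### The star product of commuting derivations and its associativity -/

section Star

variable {ι O : Type*} [Fintype ι] [CommRing O] [Algebra ℂ O]

/-- The bidifferential operators `(∑ᵢ aᵢ ⊗ bᵢ)^l / l!`. -/
noncomputable def contract (a b : ι → Derivation ℂ O O) : ℕ → O →ₗ[ℂ] O →ₗ[ℂ] O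
  | 0 => LinearMap.mul ℂ O
  | l + 1 => ((l : ℂ) + 1)⁻¹ •
      ∑ i, (contract a b l).compl₁₂ (a i : O →ₗ[ℂ] O) (b i : O →ₗ[ℂ] O)

variable (a b : ι → Derivation ℂ O O)

@[simp]
theorem contract_zero (q p : O) : contract a b 0 q p = q * p := rfl

theorem contract_succ (l : ℕ) (q p : O) :
    contract a b (l + 1) q p = ((l : ℂ) + 1)⁻¹ • ∑ i, contract a b l (a i q) (b i p) := by
  simp [contract, LinearMap.sum_apply]

theorem succ_smul_contract (l : ℕ) (q p : O) :
    ((l : ℂ) + 1) • contract a b (l + 1) q p = ∑ i, contract a b l (a i q) (b i p) := by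
  rw [contract_succ, smul_inv_smul₀ (Nat.cast_add_one_ne_zero l)]

theorem contract_mul_left {f : O} (hf : ∀ i, a i f = 0) (l : ℕ) (q p : O) :
    contract a b l (f * q) p = f * contract a b l q p := by
  induction l generalizing q p with
  | zero => simp [mul_assoc]
  | succ l ih => simp [contract_succ, hf, ih, Finset.mul_sum]

theorem contract_mul_right {f : O} (hf : ∀ i, b i f = 0) (l : ℕ) (q p : O) :
    contract a b l q (p * f) = contract a b l q p * f := by
  induction l generalizing q p with
  | zero => simp [mul_assoc]
  | succ l ih => simp [contract_succ, hf, mul_comm f, ih, Finset.sum_mul]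

theorem contract_succ_const_left {f : O} (hf : ∀ i, a i f = 0) (l : ℕ) (p : O) :
    contract a b (l + 1) f p = 0 := by
  simp [contract_succ, hf]

theorem contract_succ_const_right {f : O} (hf : ∀ i, b i f = 0) (l : ℕ) (q : O) :
    contract a b (l + 1) q f = 0 := by
  simp [contract_succ, hf]

theorem derivation_contract {D : Derivation ℂ O O} (ha : ∀ i x, D (a i x) = a i (D x))
    (hb : ∀ i x, D (b i x) = b i (D x)) (l : ℕ) (q p : O) :
    D (contract a b l q p) = contract a b l (D q) p + contract a b l q (D p) := by
  induction l generalizing q p with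
  | zero => simp [mul_comm, add_comm]
  | succ l ih => simp [contract_succ, ih, ha, hb, Finset.sum_add_distrib]

/-- The commutator of ∑ aᵢ ⊗ bᵢ with multiplication by x on the right factor is aₖ ⊗ 1. It commutes
with the whole sum, so it meets the divided power of degree l + 1 only once, leaving the divided
power of degree l. -/
theorem contract_mul_coord [DecidableEq ι] (haa : ∀ i j x, a i (a j x) = a j (a i x)) {x : O}
    {k : ι} (hx : ∀ i, b i x = if i = k then 1 else 0) (l : ℕ) (q p : O) :
    contract a b (l + 1) q (x * p) = x * contract a b (l + 1) q p + contract a b l (a k q) p := by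
  induction l generalizing q p with
  | zero =>
    simp [contract_succ, hx, Finset.sum_add_distrib, mul_add, Finset.mul_sum, mul_left_comm]
  | succ l ih =>
    have h0 : ((l : ℂ) + 1 + 1) ≠ 0 := by exact_mod_cast Nat.cast_add_one_ne_zero (R := ℂ) (l + 1)
    have key : ((l : ℂ) + 1 + 1) • contract a b (l + 1 + 1) q (x * p) =
        ((l : ℂ) + 1 + 1) • (x * contract a b (l + 1 + 1) q p + contract a b (l + 1) (a k q) p) := by
      have h1 := succ_smul_contract a b (l + 1) q (x * p)
      have h2 := succ_smul_contract a b (l + 1) q p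
      have h3 := succ_smul_contract a b l (a k q) p
      push_cast at h1 h2
      rw [h1, smul_add, ← mul_smul_comm, h2, add_smul (l + 1 : ℂ), h3]
      have h4 : ∀ i, contract a b (l + 1) (a i q) (if i = k then p else 0) =
          if i = k then contract a b (l + 1) (a k q) p else 0 := by
        intro i
        split_ifs with h
        · rw [h]
        · simp
      simp [hx, ih, Finset.sum_add_distrib, Finset.mul_sum, haa k, add_assoc, h4]
    exact smul_right_injective O h0 key

theorem sum_antidiagonal_succ_smul {M : Type*} [AddCommMonoid M] [Module ℂ M] (l : ℕ)
    (f : ℕ × ℕ → M) :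
    ∑ p ∈ Finset.HasAntidiagonal.antidiagonal (l + 1), ((p.1 : ℂ) + p.2) • f p =
      ∑ p ∈ Finset.HasAntidiagonal.antidiagonal l, ((p.1 : ℂ) + 1) • f (p.1 + 1, p.2) +
      ∑ p ∈ Finset.HasAntidiagonal.antidiagonal l, ((p.2 : ℂ) + 1) • f (p.1, p.2 + 1) := by
  have h : ∀ p : ℕ × ℕ, ((p.1 : ℂ) + p.2) • f p = (p.1 : ℂ) • f p + (p.2 : ℂ) • f p :=
    fun p => add_smul _ _ _
  simp only [h, Finset.sum_add_distrib]
  congr 1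
  · rw [Finset.Nat.antidiagonal_succ]
    simp [Prod.map]
  · rw [Finset.Nat.antidiagonal_succ']
    simp [Prod.map]

/-- Both sides are the l-th divided power of the commuting operators aᵢ⊗bᵢ⊗1 + aᵢ⊗1⊗bᵢ + 1⊗aᵢ⊗bᵢ,
summed over i and followed by multiplication. Multiplying by l + 1 peels off one factor; the
derivation acting on the inner product splits by the Leibniz rule. -/
theorem contract_assoc (haa : ∀ i j x, a i (a j x) = a j (a i x))
    (hbb : ∀ i j x, b i (b j x) = b j (b i x)) (hab : ∀ i j x, a i (b j x) = b j (a i x))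
    (l : ℕ) (r q p : O) :
    ∑ s ∈ Finset.HasAntidiagonal.antidiagonal l, contract a b s.1 r (contract a b s.2 q p) =
      ∑ s ∈ Finset.HasAntidiagonal.antidiagonal l, contract a b s.1 (contract a b s.2 r q) p := by
  induction l generalizing r q p with
  | zero => simp [mul_assoc]
  | succ l ih =>
    have h0 : ((l : ℂ) + 1) ≠ 0 := Nat.cast_add_one_ne_zero l
    refine smul_right_injective O h0 ?_
    -- On the antidiagonal the factor l + 1 is the sum of the two indices, so each of them can be
    -- lowered separately.
    have scale : ∀ f : ℕ × ℕ → O, ((l : ℂ) + 1) •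
        ∑ s ∈ Finset.HasAntidiagonal.antidiagonal (l + 1), f s =
        ∑ s ∈ Finset.HasAntidiagonal.antidiagonal (l + 1), ((s.1 : ℂ) + s.2) • f s := by
      intro f
      rw [Finset.smul_sum]
      refine Finset.sum_congr rfl fun s hs => ?_
      rw [Finset.HasAntidiagonal.mem_antidiagonal] at hs
      rw [show (l : ℂ) + 1 = s.1 + s.2 by exact_mod_cast hs.symm]
    have hl : ∀ (s : ℕ) (i : ι) (x y : O), b i (contract a b s x y) =
        contract a b s (b i x) y + contract a b s x (b i y) := fun s i x y =>
      derivation_contract a b (fun j z => (hab j i z).symm) (fun j z => hbb i j z) s x y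
    have hr : ∀ (s : ℕ) (i : ι) (x y : O), a i (contract a b s x y) =
        contract a b s (a i x) y + contract a b s x (a i y) := fun s i x y =>
      derivation_contract a b (fun j z => haa i j z) (fun j z => hab i j z) s x y
    have e1 : ∀ s : ℕ × ℕ, ((s.2 : ℂ) + 1) • contract a b s.1 r (contract a b (s.2 + 1) q p) =
        ∑ i, contract a b s.1 r (contract a b s.2 (a i q) (b i p)) := by
      intro s
      rw [← map_smul, succ_smul_contract, map_sum]
    have e2 : ∀ s : ℕ × ℕ, ((s.2 : ℂ) + 1) • contract a b s.1 (contract a b (s.2 + 1) r q) p =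
        ∑ i, contract a b s.1 (contract a b s.2 (a i r) (b i q)) p := by
      intro s
      rw [← LinearMap.smul_apply, ← map_smul, succ_smul_contract, map_sum, LinearMap.sum_apply]
    simp only [scale, sum_antidiagonal_succ_smul, succ_smul_contract, hl, hr, e1, e2, map_add,
      LinearMap.add_apply, Finset.sum_add_distrib]
    simp only [Finset.sum_comm (s := Finset.HasAntidiagonal.antidiagonal l), ih]
    abel

/-- The product `∑_l X^l (∑ᵢ aᵢ ⊗ bᵢ)^l / l!` on formal power series. -/
noncomputable def star (Q P : O⟦X⟧) : O⟦X⟧ :=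
  PowerSeries.mk fun ν => ∑ p ∈ Finset.HasAntidiagonal.antidiagonal ν,
    ∑ q ∈ Finset.HasAntidiagonal.antidiagonal p.1, contract a b p.2 (coeff q.1 Q) (coeff q.2 P)

theorem coeff_star (Q P : O⟦X⟧) (ν : ℕ) :
    coeff ν (star a b Q P) = ∑ p ∈ Finset.HasAntidiagonal.antidiagonal ν,
      ∑ q ∈ Finset.HasAntidiagonal.antidiagonal p.1,
        contract a b p.2 (coeff q.1 Q) (coeff q.2 P) := coeff_mk _ _

theorem isXLinear_star_left (P : O⟦X⟧) : IsXLinear fun Q => star a b Q P where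
  map_add F G := by ext k; simp [coeff_star, Finset.sum_add_distrib]
  map_X_mul F := by
    ext k
    cases k with
    | zero => simp [coeff_star]
    | succ k =>
      rw [coeff_star, coeff_succ_X_mul, coeff_star, Finset.Nat.antidiagonal_succ]
      simp [Finset.Nat.antidiagonal_succ, coeff_succ_X_mul]

theorem isXLinear_star_right (Q : O⟦X⟧) : IsXLinear fun P => star a b Q P where
  map_add F G := by ext k; simp [coeff_star, Finset.sum_add_distrib]
  map_X_mul F := by
    ext k
    cases k with
    | zero => simp [coeff_star]
    | succ k =>
      rw [coeff_star, coeff_succ_X_mul, coeff_star, Finset.Nat.antidiagonal_succ]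
      simp [Finset.Nat.antidiagonal_succ', coeff_succ_X_mul]

theorem star_C_right (Q : O⟦X⟧) (p : O) :
    star a b Q (C p) = seriesExtend (fun l => (contract a b l).flip p) Q := by
  ext ν
  rw [coeff_star, coeff_seriesExtend]
  refine Finset.sum_congr rfl fun s _ => ?_
  rw [Finset.sum_eq_single (s.1, 0)]
  · simp
  · rintro ⟨i, j⟩ hp hne
    rw [coeff_C, if_neg]
    · simp
    · rintro rfl
      rw [Finset.HasAntidiagonal.mem_antidiagonal] at hp
      exact hne (by simp_all)
  · simp [Finset.HasAntidiagonal.mem_antidiagonal]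

theorem star_C_left (q : O) (P : O⟦X⟧) :
    star a b (C q) P = seriesExtend (fun l => contract a b l q) P := by
  ext ν
  rw [coeff_star, coeff_seriesExtend]
  refine Finset.sum_congr rfl fun s _ => ?_
  rw [Finset.sum_eq_single (0, s.1)]
  · simp
  · rintro ⟨i, j⟩ hp hne
    rw [coeff_C, if_neg]
    · simp
    · rintro rfl
      rw [Finset.HasAntidiagonal.mem_antidiagonal] at hp
      exact hne (by simp_all)
  · simp [Finset.HasAntidiagonal.mem_antidiagonal]

theorem coeff_star_C_C (q p : O) (ν : ℕ) : coeff ν (star a b (C q) (C p)) = contract a b ν q p := by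
  rw [star_C_left, coeff_seriesExtend_C]

theorem star_assoc (haa : ∀ i j x, a i (a j x) = a j (a i x))
    (hbb : ∀ i j x, b i (b j x) = b j (b i x)) (hab : ∀ i j x, a i (b j x) = b j (a i x))
    (R Q P : O⟦X⟧) : star a b R (star a b Q P) = star a b (star a b R Q) P := by
  -- Three uses of X-linearity reduce R, Q and P to constants, where the coefficients are those of
  -- `contract_assoc`.
  refine ((isXLinear_star_left a b _)).ext
    ((isXLinear_star_left a b P).comp (isXLinear_star_left a b Q)) (fun r => ?_) R
  refine ((isXLinear_star_right a b _).comp (isXLinear_star_left a b P)).ext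
    ((isXLinear_star_left a b P).comp (isXLinear_star_right a b _)) (fun q => ?_) Q
  refine ((isXLinear_star_right a b _).comp (isXLinear_star_right a b _)).ext
    (isXLinear_star_right a b _) (fun p => ?_) P
  ext ν
  rw [star_C_left, star_C_right a b (star a b _ _), coeff_seriesExtend, coeff_seriesExtend]
  simp only [coeff_star_C_C, LinearMap.flip_apply]
  exact ((Finset.Nat.sum_antidiagonal_swap (f := fun s : ℕ × ℕ =>
    contract a b s.1 r (contract a b s.2 q p))).trans (contract_assoc a b haa hbb hab ν r q p)).trans
    (Finset.Nat.sum_antidiagonal_swap (f := fun s : ℕ × ℕ =>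
      contract a b s.1 (contract a b s.2 r q) p)).symm

theorem star_C_mul_left {f : O} (hf : ∀ i, a i f = 0) (Q P : O⟦X⟧) :
    star a b (C f * Q) P = C f * star a b Q P := by
  ext ν
  simp [coeff_star, coeff_C_mul, contract_mul_left a b hf, Finset.mul_sum]

theorem star_mul_C_right {f : O} (hf : ∀ i, b i f = 0) (Q P : O⟦X⟧) :
    star a b Q (P * C f) = star a b Q P * C f := by
  ext ν
  simp [coeff_star, coeff_mul_C, contract_mul_right a b hf, Finset.sum_mul]

theorem star_one_left (P : O⟦X⟧) : star a b 1 P = P := by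
  rw [← map_one C, star_C_left]
  refine (isXLinear_seriesExtend _).ext IsXLinear.id (fun q => ?_) P
  ext ν
  rw [coeff_seriesExtend_C, coeff_C]
  cases ν with
  | zero => simp
  | succ ν => rw [contract_succ_const_left a b (by simp)]; simp

theorem star_one_right (P : O⟦X⟧) : star a b P 1 = P := by
  rw [← map_one C, star_C_right]
  refine (isXLinear_seriesExtend _).ext IsXLinear.id (fun q => ?_) P
  ext ν
  rw [coeff_seriesExtend_C, coeff_C, LinearMap.flip_apply]
  cases ν with
  | zero => simp
  | succ ν => rw [contract_succ_const_right a b (by simp)]; simp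

theorem star_C_left_of_const {f : O} (hf : ∀ i, a i f = 0) (P : O⟦X⟧) :
    star a b (C f) P = C f * P := by
  rw [← mul_one (C f), star_C_mul_left a b hf, star_one_left, mul_one]

theorem star_C_right_of_const {f : O} (hf : ∀ i, b i f = 0) (P : O⟦X⟧) :
    star a b P (C f) = P * C f := by
  rw [← one_mul (C f), star_mul_C_right a b hf, star_one_right, one_mul]

/-- The product with a series which is affine in the directions `a` on the left. -/
theorem star_C_left_of_affine {x : O} (hx : ∀ i j, a i (a j x) = 0) (P : O⟦X⟧) :
    star a b (C x) P = C x * P + X * ∑ j, C (a j x) * coeffMap (b j : O →ₗ[ℂ] O) P := by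
  rw [star_C_left]
  refine (isXLinear_seriesExtend _).ext ((IsXLinear.id.mul_left _).add
    ((IsXLinear.sum fun j _ => (isXLinear_coeffMap _).mul_left _).mul_left _)) (fun p => ?_) P
  ext ν
  rw [coeff_seriesExtend_C]
  simp only [coeffMap_C, ← map_mul, ← map_sum, map_add]
  rcases ν with _ | _ | ν
  · simp
  · simp [contract_succ, coeff_succ_X_mul]
  · rw [contract_succ]
    simp [coeff_succ_X_mul, contract_succ_const_left a b (hx · _)]

theorem star_C_mul_coord [DecidableEq ι] (haa : ∀ i j x, a i (a j x) = a j (a i x)) {x : O}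
    {k : ι} (hx : ∀ i, b i x = if i = k then 1 else 0) (Q P : O⟦X⟧) :
    star a b Q (C x * P) =
      C x * star a b Q P + X * star a b (coeffMap (a k : O →ₗ[ℂ] O) Q) P := by
  refine ((isXLinear_star_right a b _).comp (IsXLinear.id.mul_left _)).ext
    (((isXLinear_star_right a b _).mul_left _).add ((isXLinear_star_right a b _).mul_left _))
    (fun p => ?_) P
  refine (isXLinear_star_left a b _).ext
    (((isXLinear_star_left a b _).mul_left _).add
      (((isXLinear_star_left a b _).comp (isXLinear_coeffMap _)).mul_left _)) (fun q => ?_) Q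
  ext ν
  rw [coeffMap_C, ← map_mul, map_add, coeff_C_mul, coeff_star_C_C, coeff_star_C_C]
  cases ν with
  | zero => simp [mul_left_comm]
  | succ ν => rw [coeff_succ_X_mul, coeff_star_C_C, contract_mul_coord a b haa hx]; rfl

/-- At the lowest order of Q the differential operators cannot contribute yet. This controls the
term D(Q, P) ∘ Φ^*ζᵢ in the induction of `pull_star`. -/
theorem coeff_star_of_coeff_eq_zero (N : ℕ) {Q : O⟦X⟧} (hQ : ∀ k < N, coeff k Q = 0) (P : O⟦X⟧) :
    coeff N (star a b Q P) = coeff N Q * coeff 0 P := by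
  rw [coeff_star, Finset.sum_eq_single (N, 0), Finset.sum_eq_single (N, 0)]
  · simp
  · rintro ⟨i, j⟩ hp hne
    rw [Finset.HasAntidiagonal.mem_antidiagonal] at hp
    rw [hQ i (by by_contra h; exact hne (by simp at hp ⊢; omega))]
    simp
  · simp [Finset.HasAntidiagonal.mem_antidiagonal]
  · rintro ⟨i, j⟩ hp hne
    rw [Finset.HasAntidiagonal.mem_antidiagonal] at hp
    refine Finset.sum_eq_zero fun s hs => ?_
    rw [Finset.HasAntidiagonal.mem_antidiagonal] at hs
    rw [hQ s.1 (by by_contra h; exact hne (by simp at hp hs ⊢; omega))]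
    simp
  · simp [Finset.HasAntidiagonal.mem_antidiagonal]

theorem coeffMap_star {D : Derivation ℂ O O} (ha : ∀ i x, D (a i x) = a i (D x))
    (hb : ∀ i x, D (b i x) = b i (D x)) (Q P : O⟦X⟧) :
    coeffMap (D : O →ₗ[ℂ] O) (star a b Q P) =
      star a b (coeffMap (D : O →ₗ[ℂ] O) Q) P + star a b Q (coeffMap (D : O →ₗ[ℂ] O) P) := by
  ext ν
  simp [coeff_coeffMap, coeff_star, derivation_contract a b ha hb, Finset.sum_add_distrib]

end Star

/-! ### The exponential operator and integration by parts -/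

section ExpSeries

variable {ι B O : Type*} [Fintype ι] [CommRing B] [Algebra ℂ B] [CommRing O] [Algebra ℂ O]

/-- The operator `∑ᵢ aᵢ bᵢ`. -/
noncomputable def sumComp (a b : ι → Derivation ℂ B B) : Module.End ℂ B :=
  ∑ i, (a i : B →ₗ[ℂ] B) * (b i : B →ₗ[ℂ] B)

theorem sumComp_apply (a b : ι → Derivation ℂ B B) (G : B) :
    sumComp a b G = ∑ i, a i (b i G) := by
  simp [sumComp, LinearMap.sum_apply]

/-- The operators `(∑ᵢ aᵢ bᵢ)^l / l!`, followed by a restriction `ρ`. -/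
noncomputable def expCoeff (a b : ι → Derivation ℂ B B) (ρ : B →ₐ[ℂ] O) (l : ℕ) : B →ₗ[ℂ] O :=
  ((l.factorial : ℂ))⁻¹ • ρ.toLinearMap ∘ₗ (sumComp a b ^ l : Module.End ℂ B)

/-- The series `∑_l X^l (∑ᵢ aᵢ bᵢ)^l / l!`, followed by a restriction `ρ`. -/
noncomputable def expSeries (a b : ι → Derivation ℂ B B) (ρ : B →ₐ[ℂ] O) (G : B) : O⟦X⟧ :=
  PowerSeries.mk fun l => expCoeff a b ρ l G

variable (a b : ι → Derivation ℂ B B) (ρ : B →ₐ[ℂ] O)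

theorem expCoeff_apply (l : ℕ) (G : B) :
    expCoeff a b ρ l G = ((l.factorial : ℂ))⁻¹ • ρ ((sumComp a b ^ l) G) := rfl

@[simp]
theorem expCoeff_zero (G : B) : expCoeff a b ρ 0 G = ρ G := by
  simp [expCoeff_apply]

theorem succ_smul_expCoeff (l : ℕ) (G : B) :
    ((l : ℂ) + 1) • expCoeff a b ρ (l + 1) G = expCoeff a b ρ l (sumComp a b G) := by
  have h0 : ((l : ℂ) + 1) ≠ 0 := Nat.cast_add_one_ne_zero l
  rw [expCoeff_apply, expCoeff_apply, pow_succ, Module.End.mul_apply, smul_smul, Nat.factorial_succ]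
  congr 1
  push_cast
  rw [mul_inv, mul_inv_cancel_left₀ h0]

theorem coeff_expSeries (G : B) (l : ℕ) : coeff l (expSeries a b ρ G) = expCoeff a b ρ l G :=
  coeff_mk _ _

theorem expSeries_add (F G : B) :
    expSeries a b ρ (F + G) = expSeries a b ρ F + expSeries a b ρ G := by
  ext l; simp [coeff_expSeries]

theorem expSeries_sum {κ : Type*} (s : Finset κ) (F : κ → B) :
    expSeries a b ρ (∑ k ∈ s, F k) = ∑ k ∈ s, expSeries a b ρ (F k) := by
  ext l; simp [coeff_expSeries]

/-- Here d is the commutator of A = ∑ aᵢbᵢ with multiplication by x. As d commutes with A, moving x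
through A^(l+1)/(l+1)! produces exactly one term d A^l/l!. -/
theorem expCoeff_mul {x : B} {d : B → B}
    (hA : ∀ G, sumComp a b (x * G) = x * sumComp a b G + d G)
    (hd : ∀ G, sumComp a b (d G) = d (sumComp a b G)) (l : ℕ) (G : B) :
    expCoeff a b ρ (l + 1) (x * G) = ρ x * expCoeff a b ρ (l + 1) G + expCoeff a b ρ l (d G) := by
  have h0 : ((l : ℂ) + 1) ≠ 0 := Nat.cast_add_one_ne_zero l
  refine smul_right_injective O h0 ?_
  induction l generalizing G with
  | zero => simp [expCoeff_apply, hA]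
  | succ l ih =>
    have h0' : ((l : ℂ) + 1) ≠ 0 := Nat.cast_add_one_ne_zero l
    have ih' := fun G => smul_right_injective O h0' (ih G h0')
    simp only at ih' ⊢
    rw [succ_smul_expCoeff, hA, map_add, ih', smul_add, ← mul_smul_comm, succ_smul_expCoeff,
      ← hd, ← succ_smul_expCoeff a b ρ l (d G), Nat.cast_succ, add_smul ((l : ℂ) + 1) (1 : ℂ),
      one_smul, add_assoc]

theorem expSeries_mul {x : B} {d : B → B}
    (hA : ∀ G, sumComp a b (x * G) = x * sumComp a b G + d G)
    (hd : ∀ G, sumComp a b (d G) = d (sumComp a b G)) (G : B) :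
    expSeries a b ρ (x * G) = C (ρ x) * expSeries a b ρ G + X * expSeries a b ρ (d G) := by
  ext l
  cases l with
  | zero => rw [map_add, coeff_C_mul]; simp [coeff_expSeries]
  | succ l =>
    rw [map_add, coeff_succ_X_mul, coeff_C_mul, coeff_expSeries, coeff_expSeries, coeff_expSeries]
    exact expCoeff_mul a b ρ hA hd l G

theorem expSeries_mul_const {x : B} (hax : ∀ i, a i x = 0) (hbx : ∀ i, b i x = 0) (G : B) :
    expSeries a b ρ (x * G) = C (ρ x) * expSeries a b ρ G := by
  rw [expSeries_mul a b ρ (d := fun _ => 0)]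
  · have : expSeries a b ρ (0 : B) = 0 := by ext l; rw [coeff_expSeries, map_zero, map_zero]
    rw [this, mul_zero, add_zero]
  · intro G; simp [sumComp_apply, hax, hbx, Finset.mul_sum]
  · simp

/-- Integration by parts: a coordinate that vanishes on restriction acts under the exponential as X
times the derivation paired with it. `expSeries_mul_coord_left` exchanges the two groups of
variables. -/
theorem expSeries_mul_coord_right [DecidableEq ι] (haa : ∀ i j x, a i (a j x) = a j (a i x))
    (hab : ∀ i j x, a i (b j x) = b j (a i x)) {x : B} {k : ι} (hax : ∀ i, a i x = 0)
    (hbx : ∀ i, b i x = if i = k then 1 else 0) (hx : ρ x = 0) (G : B) :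
    expSeries a b ρ (x * G) = X * expSeries a b ρ (a k G) := by
  rw [expSeries_mul a b ρ (d := a k), hx]
  · simp
  · intro G
    have h : ∀ i, a i (G * if i = k then (1 : B) else 0) = if i = k then a k G else 0 := by
      intro i
      split_ifs with h
      · simp [h]
      · simp
    simp only [sumComp_apply, Derivation.leibniz, smul_eq_mul, hbx, map_add, hax,
      Finset.mul_sum, Finset.sum_add_distrib, h]
    simp
  · intro G; simp [sumComp_apply, haa k, hab k]

theorem expSeries_mul_coord_left [DecidableEq ι] (hbb : ∀ i j x, b i (b j x) = b j (b i x))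
    (hab : ∀ i j x, a i (b j x) = b j (a i x)) {x : B} {k : ι} (hbx : ∀ i, b i x = 0)
    (hax : ∀ i, a i x = if i = k then 1 else 0) (hx : ρ x = 0) (G : B) :
    expSeries a b ρ (x * G) = X * expSeries a b ρ (b k G) := by
  rw [expSeries_mul a b ρ (d := b k), hx]
  · simp
  · intro G; simp [sumComp_apply, hax, hbx, Finset.mul_sum, Finset.sum_add_distrib]
  · intro G; simp [sumComp_apply, hbb k, hab]

theorem expSeries_derivation {D : Derivation ℂ B B} {D' : Derivation ℂ O O}
    (ha : ∀ i x, D (a i x) = a i (D x)) (hb : ∀ i x, D (b i x) = b i (D x))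
    (hρ : ∀ G, ρ (D G) = D' (ρ G)) (G : B) :
    expSeries a b ρ (D G) = coeffMap (D' : O →ₗ[ℂ] O) (expSeries a b ρ G) := by
  have hA : ∀ G, sumComp a b (D G) = D (sumComp a b G) := by
    intro G; simp [sumComp_apply, ha, hb]
  have hAl : ∀ l G, (sumComp a b ^ l) (D G) = D ((sumComp a b ^ l) G) := by
    intro l
    induction l with
    | zero => simp
    | succ l ih => intro G; rw [pow_succ, Module.End.mul_apply, hA, ih, Module.End.mul_apply]
  ext l
  simp [coeff_expSeries, coeff_coeffMap, expCoeff_apply, hAl, hρ]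

/-- On a product σ(q)τ(p) with separated variables, aᵢ sees only σ(q) and bᵢ only τ(p), so the
operator ∑ aᵢbᵢ acts as a bidifferential operator on (q, p). -/
theorem expCoeff_mul_eq_contract {a' b' : ι → Derivation ℂ O O} {σ τ : O →ₐ[ℂ] B}
    (hbσ : ∀ i q, b i (σ q) = 0) (haτ : ∀ i p, a i (τ p) = 0)
    (haσ : ∀ i q, a i (σ q) = σ (a' i q)) (hbτ : ∀ i p, b i (τ p) = τ (b' i p))
    (hσ : ∀ q, ρ (σ q) = q) (hτ : ∀ p, ρ (τ p) = p) (l : ℕ) (q p : O) :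
    expCoeff a b ρ l (σ q * τ p) = contract a' b' l q p := by
  induction l generalizing q p with
  | zero => simp [hσ, hτ]
  | succ l ih =>
    have h0 : ((l : ℂ) + 1) ≠ 0 := Nat.cast_add_one_ne_zero l
    refine smul_right_injective O h0 ?_
    simp only
    rw [succ_smul_expCoeff, succ_smul_contract, sumComp_apply, map_sum]
    refine Finset.sum_congr rfl fun i _ => ?_
    rw [← ih]
    simp [haτ, hbσ, haσ, hbτ, mul_comm]

end ExpSeries

/-! ### The sum over multi-indices as a divided power -/

section Multinomial

variable {n : ℕ} {B : Type*} [CommRing B] [Algebra ℂ B]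

/-- The operator `D₁^{α₁} ⋯ Dₙ^{αₙ}`. -/
noncomputable def multiPow {B : Type*} (D : Fin n → B → B) (α : Fin n → ℕ) (f : B) : B :=
  (List.finRange n).foldr (fun i g => (D i)^[α i] g) f

theorem prod_map_pow_apply (D : Fin n → Module.End ℂ B) (α : Fin n → ℕ) (L : List (Fin n)) (G : B) :
    (L.map fun i => D i ^ α i).prod G = L.foldr (fun i g => (D i)^[α i] g) G := by
  induction L with
  | nil => simp
  | cons i L ih =>
    rw [List.map_cons, List.prod_cons, Module.End.mul_apply, ih, List.foldr_cons,
      Module.End.pow_apply]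

theorem noncommProd_univ_fin {R : Type*} [Monoid R] (f : Fin n → R) (h : _) :
    (Finset.univ : Finset (Fin n)).noncommProd f h = ((List.finRange n).map f).prod := by
  simp only [Finset.noncommProd, Fin.univ_def, Multiset.map_coe, Multiset.noncommProd_coe]

/-- The multinomial theorem for the commuting operators aᵢbᵢ; it turns the sum over α in `expOp`
into a power of a single operator. -/
theorem inv_factorial_smul_sumComp_pow (a b : Fin n → Derivation ℂ B B)
    (haa : ∀ i j x, a i (a j x) = a j (a i x))
    (hbb : ∀ i j x, b i (b j x) = b j (b i x)) (hab : ∀ i j x, a i (b j x) = b j (a i x))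
    (l : ℕ) (G : B) :
    ((l.factorial : ℂ))⁻¹ • (sumComp a b ^ l) G =
      ∑ α ∈ Finset.piAntidiag (Finset.univ : Finset (Fin n)) l,
        ((multiFactorial α : ℂ))⁻¹ • multiPow (fun i => a i) α (multiPow (fun i => b i) α G) := by
  set a' : Fin n → Module.End ℂ B := fun i => (a i : B →ₗ[ℂ] B) with ha'
  set b' : Fin n → Module.End ℂ B := fun i => (b i : B →ₗ[ℂ] B) with hb'
  have caa : ∀ i j, Commute (a' i) (a' j) := fun i j => LinearMap.ext fun x => haa i j x
  have cbb : ∀ i j, Commute (b' i) (b' j) := fun i j => LinearMap.ext fun x => hbb i j x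
  have cab : ∀ i j, Commute (a' i) (b' j) := fun i j => LinearMap.ext fun x => hab i j x
  have cc : ∀ i j, Commute (a' i * b' i) (a' j * b' j) := fun i j =>
    ((caa i j).mul_right (cab i j)).mul_left ((cab j i).symm.mul_right (cbb i j))
  have key := Finset.sum_pow_eq_sum_piAntidiag_of_commute (Finset.univ : Finset (Fin n))
    (fun i => a' i * b' i) (fun i _ j _ _ => cc i j) l
  have e : sumComp a b = ∑ i, a' i * b' i := rfl
  rw [e, key, LinearMap.sum_apply, Finset.smul_sum]
  refine Finset.sum_congr rfl fun α hα => ?_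
  have hsum : ∑ i, α i = l := (Finset.mem_piAntidiag.1 hα).1
  -- Commutation moves all the powers of the aᵢ to the left of all the powers of the bᵢ.
  have hsplit : ∀ (h : _), (Finset.univ : Finset (Fin n)).noncommProd
      (fun i => (a' i * b' i) ^ α i) h =
      ((List.finRange n).map fun i => a' i ^ α i).prod *
        ((List.finRange n).map fun i => b' i ^ α i).prod := by
    intro h
    have e1 : (Finset.univ : Finset (Fin n)).noncommProd
      (fun i => (a' i * b' i) ^ α i) h = (Finset.univ : Finset (Fin n)).noncommProd
      ((fun i => a' i ^ α i) * fun i => b' i ^ α i)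
        (fun i _ j _ _ => by
          simp only [Function.onFun, Pi.mul_apply, ← (cab _ _).mul_pow]
          exact (cc i j).pow_pow _ _) :=
      Finset.noncommProd_congr rfl (fun i _ => (cab i i).mul_pow _) _
    rw [e1, Finset.noncommProd_mul_distrib _ _ (fun i _ j _ _ => (caa i j).pow_pow _ _)
      (fun i _ j _ _ => (cbb i j).pow_pow _ _) (fun i _ j _ _ => ((cab j i).symm.pow_pow _ _))]
    exact congrArg₂ (· * ·) (noncommProd_univ_fin _ _) (noncommProd_univ_fin _ _)
  rw [Module.End.mul_apply, hsplit, Module.End.mul_apply, prod_map_pow_apply, prod_map_pow_apply]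
  have hm := Nat.multinomial_spec (Finset.univ : Finset (Fin n)) α
  rw [hsum] at hm
  have hm' : (multiFactorial α : ℂ) * (Nat.multinomial Finset.univ α : ℂ) = l.factorial := by
    exact_mod_cast hm
  have h1 : (multiFactorial α : ℂ) ≠ 0 := by
    rw [multiFactorial]; exact_mod_cast Finset.prod_ne_zero_iff.2 fun i _ => Nat.factorial_ne_zero _
  have h2 : (Nat.multinomial Finset.univ α : ℂ) ≠ 0 := by
    intro h; rw [h, mul_zero] at hm'; exact Nat.cast_ne_zero.2 (Nat.factorial_ne_zero l) hm'.symm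
  rw [Module.End.natCast_apply, ← Nat.cast_smul_eq_nsmul ℂ, smul_smul]
  congr 1
  rw [← hm', mul_inv, inv_mul_cancel_right₀ h2]

end Multinomial

/-! ### Rings of germs of holomorphic functions -/

section Germs

variable {V W U : Type*} [NormedAddCommGroup V] [NormedSpace ℂ V]
  [NormedAddCommGroup W] [NormedSpace ℂ W] [NormedAddCommGroup U] [NormedSpace ℂ U]

/-- The algebra of functions which are analytic at a given point. -/
def analyticAtSubalgebra (p : V) : Subalgebra ℂ (V → ℂ) where
  carrier := {f | AnalyticAt ℂ f p}
  mul_mem' hf hg := AnalyticAt.mul hf hg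
  add_mem' hf hg := AnalyticAt.add hf hg
  algebraMap_mem' _ := analyticAt_const

/-- The ideal of functions vanishing near a given point. -/
def vanishingIdeal (p : V) : Ideal (analyticAtSubalgebra p) where
  carrier := {f | (f : V → ℂ) =ᶠ[𝓝 p] 0}
  add_mem' {f g} hf hg := by
    filter_upwards [hf, hg] with x h1 h2
    simp [h1, h2]
  zero_mem' := EventuallyEq.rfl
  smul_mem' c f hf := by
    filter_upwards [hf] with x h1
    simp [h1]

/-- The algebra of germs of holomorphic functions at a given point. -/
def Hol (p : V) : Type _ := analyticAtSubalgebra p ⧸ vanishingIdeal p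

namespace Hol

noncomputable instance (p : V) : CommRing (Hol p) :=
  inferInstanceAs (CommRing (analyticAtSubalgebra p ⧸ vanishingIdeal p))

noncomputable instance (p : V) : Algebra ℂ (Hol p) :=
  inferInstanceAs (Algebra ℂ (analyticAtSubalgebra p ⧸ vanishingIdeal p))

variable {p : V} {q : W}

/-- The germ of an analytic function. -/
noncomputable def mk (f : V → ℂ) (hf : AnalyticAt ℂ f p) : Hol p :=
  Ideal.Quotient.mk (vanishingIdeal p) ⟨f, hf⟩

theorem mk_eq_mk {f g : V → ℂ} {hf : AnalyticAt ℂ f p} {hg : AnalyticAt ℂ g p} :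
    mk f hf = mk g hg ↔ f =ᶠ[𝓝 p] g := by
  refine (Ideal.Quotient.eq (I := vanishingIdeal p) (x := ⟨f, hf⟩) (y := ⟨g, hg⟩)).trans ?_
  exact ⟨fun h => h.mono fun x hx => sub_eq_zero.1 hx, fun h => h.mono fun x hx => sub_eq_zero.2 hx⟩

theorem exists_rep (x : Hol p) : ∃ (f : V → ℂ) (hf : AnalyticAt ℂ f p), x = mk f hf := by
  obtain ⟨⟨f, hf⟩, rfl⟩ := Ideal.Quotient.mk_surjective x
  exact ⟨f, hf, rfl⟩

theorem mk_add {f g : V → ℂ} (hf : AnalyticAt ℂ f p) (hg : AnalyticAt ℂ g p) :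
    mk f hf + mk g hg = mk (fun x => f x + g x) (hf.add hg) := rfl

theorem mk_sub {f g : V → ℂ} (hf : AnalyticAt ℂ f p) (hg : AnalyticAt ℂ g p) :
    mk f hf - mk g hg = mk (fun x => f x - g x) (hf.sub hg) := rfl

theorem mk_mul {f g : V → ℂ} (hf : AnalyticAt ℂ f p) (hg : AnalyticAt ℂ g p) :
    mk f hf * mk g hg = mk (fun x => f x * g x) (hf.mul hg) := rfl

theorem algebraMap_eq (c : ℂ) : algebraMap ℂ (Hol p) c = mk (fun _ => c) analyticAt_const := rfl

theorem mk_sum {ι : Type*} (s : Finset ι) {f : ι → V → ℂ} (hf : ∀ i, AnalyticAt ℂ (f i) p) :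
    ∑ i ∈ s, mk (f i) (hf i) =
      mk (fun x => ∑ i ∈ s, f i x) (Finset.analyticAt_fun_sum s fun i _ => hf i) := by
  classical
  induction s using Finset.induction_on with
  | empty => simp only [Finset.sum_empty]; rfl
  | insert a s ha ih =>
    rw [Finset.sum_insert ha, ih, mk_add, mk_eq_mk]
    exact Eventually.of_forall fun x => by simp [Finset.sum_insert ha]

/-- The value of a germ. -/
noncomputable def eval (p : V) : Hol p →ₐ[ℂ] ℂ :=
  Ideal.Quotient.liftₐ (vanishingIdeal p)
    ((Pi.evalAlgHom ℂ (fun _ : V => ℂ) p).comp (analyticAtSubalgebra p).val)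
    fun _ ha => ha.self_of_nhds

@[simp]
theorem eval_mk {f : V → ℂ} (hf : AnalyticAt ℂ f p) : eval p (mk f hf) = f p := rfl

/-- Composition of germs with an analytic map. -/
noncomputable def comap (φ : V → W) (hφ : AnalyticAt ℂ φ p) (h : φ p = q) : Hol q →ₐ[ℂ] Hol p :=
  Ideal.Quotient.liftₐ (vanishingIdeal q)
    ((Ideal.Quotient.mkₐ ℂ (vanishingIdeal p)).comp
      { toFun := fun f => ⟨fun x => (f : W → ℂ) (φ x), AnalyticAt.comp_of_eq f.2 hφ h⟩
        map_one' := rfl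
        map_mul' := fun _ _ => rfl
        map_zero' := rfl
        map_add' := fun _ _ => rfl
        commutes' := fun _ => rfl })
    fun _ hf => Ideal.Quotient.eq_zero_iff_mem.2
      ((h ▸ hφ.continuousAt.tendsto : Tendsto φ (𝓝 p) (𝓝 q)).eventually hf)

theorem comap_mk (φ : V → W) (hφ : AnalyticAt ℂ φ p) (h : φ p = q) {f : W → ℂ}
    (hf : AnalyticAt ℂ f q) :
    comap φ hφ h (mk f hf) = mk (fun x => f (φ x)) (hf.comp_of_eq hφ h) := rfl

theorem eval_comap (φ : V → W) (hφ : AnalyticAt ℂ φ p) (h : φ p = q) (x : Hol q) :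
    eval p (comap φ hφ h x) = eval q x := by
  obtain ⟨f, hf, rfl⟩ := exists_rep x
  rw [comap_mk, eval_mk, eval_mk, h]

theorem comap_comap {r : U} (φ : V → W) (hφ : AnalyticAt ℂ φ p) (h : φ p = q)
    (ψ : W → U) (hψ : AnalyticAt ℂ ψ q) (h' : ψ q = r) (x : Hol r) :
    comap φ hφ h (comap ψ hψ h' x) =
      comap (fun y => ψ (φ y)) (hψ.comp_of_eq hφ h) (by rw [h, h']) x := by
  obtain ⟨f, hf, rfl⟩ := exists_rep x
  rfl

theorem comap_congr (φ ψ : V → W) (hφ : AnalyticAt ℂ φ p) (h : φ p = q) (hψ : AnalyticAt ℂ ψ p)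
    (h' : ψ p = q) (hφψ : φ =ᶠ[𝓝 p] ψ) (x : Hol q) : comap φ hφ h x = comap ψ hψ h' x := by
  obtain ⟨f, hf, rfl⟩ := exists_rep x
  rw [comap_mk, comap_mk, mk_eq_mk]
  exact hφψ.mono fun y hy => by simp only [hy]

theorem comap_id (φ : V → V) (hφ : AnalyticAt ℂ φ p) (h : φ p = p) (hφ' : ∀ᶠ y in 𝓝 p, φ y = y)
    (x : Hol p) : comap φ hφ h x = x := by
  obtain ⟨f, hf, rfl⟩ := exists_rep x
  rw [comap_mk, mk_eq_mk]
  exact hφ'.mono fun y hy => by simp only [hy]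

theorem analyticAt_fderiv_apply {f : V → ℂ} (hf : AnalyticAt ℂ f p) (v : V) :
    AnalyticAt ℂ (fun x => fderiv ℂ f x v) p :=
  (ContinuousLinearMap.apply ℂ ℂ v).analyticAt _ |>.comp hf.fderiv

/-- The directional derivative of germs as a linear map. -/
noncomputable def derivLin (p v : V) : Hol p →ₗ[ℂ] Hol p where
  toFun := Quotient.lift (fun f : analyticAtSubalgebra p =>
      mk (p := p) (fun x => fderiv ℂ (f : V → ℂ) x v) (analyticAt_fderiv_apply f.2 v)) (by
    intro f g hfg
    have h : (f : V → ℂ) =ᶠ[𝓝 p] g := by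
      have := (Submodule.quotientRel_def _).1 hfg
      exact Eventually.mono this fun x hx => sub_eq_zero.1 hx
    exact mk_eq_mk.2 ((h.fderiv (𝕜 := ℂ)).mono fun x hx => congrArg (fun L : V →L[ℂ] ℂ => L v) hx))
  map_add' x y := by
    obtain ⟨f, hf, rfl⟩ := exists_rep x
    obtain ⟨g, hg, rfl⟩ := exists_rep y
    refine (mk_eq_mk (hf := analyticAt_fderiv_apply (hf.add hg) v)
      (hg := (analyticAt_fderiv_apply hf v).add (analyticAt_fderiv_apply hg v))).2 ?_
    filter_upwards [hf.eventually_analyticAt, hg.eventually_analyticAt] with x h1 h2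
    simp [fderiv_add h1.differentiableAt h2.differentiableAt]
  map_smul' c x := by
    obtain ⟨f, hf, rfl⟩ := exists_rep x
    refine (mk_eq_mk (hf := analyticAt_fderiv_apply (hf.const_smul (c := c)) v)
      (hg := (analyticAt_fderiv_apply hf v).const_smul (c := c))).2 ?_
    filter_upwards [hf.eventually_analyticAt] with x h1
    simp [fderiv_const_smul h1.differentiableAt]

/-- The directional derivative of germs. -/
noncomputable def deriv (p v : V) : Derivation ℂ (Hol p) (Hol p) :=
  Derivation.mk' (derivLin p v) fun x y => by
    obtain ⟨f, hf, rfl⟩ := exists_rep x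
    obtain ⟨g, hg, rfl⟩ := exists_rep y
    refine (mk_eq_mk (hf := analyticAt_fderiv_apply (hf.mul hg) v)
      (hg := (hf.mul (analyticAt_fderiv_apply hg v)).add
        (hg.mul (analyticAt_fderiv_apply hf v)))).2 ?_
    filter_upwards [hf.eventually_analyticAt, hg.eventually_analyticAt] with x h1 h2
    simp [fderiv_mul h1.differentiableAt h2.differentiableAt]

theorem deriv_mk (v : V) {f : V → ℂ} (hf : AnalyticAt ℂ f p) :
    deriv p v (mk f hf) = mk (fun x => fderiv ℂ f x v) (analyticAt_fderiv_apply hf v) := rfl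

theorem fderiv_fderiv_apply {f : V → ℂ} {x : V} (hf : AnalyticAt ℂ f x) (v w : V) :
    fderiv ℂ (fun y => fderiv ℂ f y w) x v = fderiv ℂ (fderiv ℂ f) x v w := by
  have h := hf.fderiv.differentiableAt.hasFDerivAt
  have h' := (ContinuousLinearMap.apply ℂ ℂ w).hasFDerivAt.comp x h
  exact congrArg (fun L : V →L[ℂ] ℂ => L v) h'.fderiv

theorem deriv_comm (v w : V) (x : Hol p) : deriv p v (deriv p w x) = deriv p w (deriv p v x) := by
  obtain ⟨f, hf, rfl⟩ := exists_rep x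
  rw [deriv_mk, deriv_mk, deriv_mk, deriv_mk, mk_eq_mk]
  filter_upwards [hf.eventually_analyticAt] with x hx
  rw [fderiv_fderiv_apply hx, fderiv_fderiv_apply hx]
  exact (hx.contDiffAt.isSymmSndFDerivAt (n := ⊤) (by simp)).eq v w

theorem deriv_comap_eq_zero {φ : V → W} (hφ : AnalyticAt ℂ φ p) (h : φ p = q) {v : V}
    (hv : ∀ x (s : ℂ), φ (x + s • v) = φ x) (x : Hol q) : deriv p v (comap φ hφ h x) = 0 := by
  obtain ⟨f, hf, rfl⟩ := exists_rep x
  rw [comap_mk, deriv_mk, ← map_zero (algebraMap ℂ (Hol p)), algebraMap_eq, mk_eq_mk]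
  filter_upwards [(hf.comp_of_eq hφ h).eventually_analyticAt] with x hx
  have h1 := hx.differentiableAt.lineDeriv_eq_fderiv (v := v)
  have h2 : lineDeriv ℂ (f ∘ φ) x v = 0 := by simp [lineDeriv, hv]
  exact h1.symm.trans h2

/-- Differentiation of a composition with an affine map. -/
theorem deriv_comap_of_affine {φ : V → W} (hφ : AnalyticAt ℂ φ p) (h : φ p = q) {v : V} {w : W}
    (hv : ∀ x (s : ℂ), φ (x + s • v) = φ x + s • w) (x : Hol q) :
    deriv p v (comap φ hφ h x) = comap φ hφ h (deriv q w x) := by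
  obtain ⟨f, hf, rfl⟩ := exists_rep x
  rw [comap_mk, deriv_mk, deriv_mk, comap_mk, mk_eq_mk]
  have ht : Tendsto φ (𝓝 p) (𝓝 q) := h ▸ hφ.continuousAt.tendsto
  filter_upwards [(hf.comp_of_eq hφ h).eventually_analyticAt,
    ht.eventually hf.eventually_analyticAt] with x hx hx'
  have h1 := hx.differentiableAt.lineDeriv_eq_fderiv (v := v)
  have h2 := hx'.differentiableAt.lineDeriv_eq_fderiv (v := w)
  have h3 : lineDeriv ℂ (f ∘ φ) x v = lineDeriv ℂ f (φ x) w := by simp [lineDeriv, hv]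
  exact h1.symm.trans (h3.trans h2)

section Coordinates

variable {κ : Type*} [Fintype κ] {e : κ → W} {c : κ → W →L[ℂ] ℂ}

/-- The chain rule in coordinates. -/
theorem deriv_comap [CompleteSpace W] (hc : ∀ x, ∑ k, c k x • e k = x) {φ : V → W} (hφ : AnalyticAt ℂ φ p)
    (h : φ p = q) (v : V) (x : Hol q) :
    deriv p v (comap φ hφ h x) =
      ∑ k, deriv p v (comap φ hφ h (mk (c k) ((c k).analyticAt q))) *
        comap φ hφ h (deriv q (e k) x) := by
  obtain ⟨f, hf, rfl⟩ := exists_rep x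
  simp only [comap_mk, deriv_mk, mk_mul]
  refine Eq.trans ?_ (mk_sum Finset.univ
    (f := fun k x => fderiv ℂ (fun y => c k (φ y)) x v * fderiv ℂ f (φ x) (e k))
    (fun k => (analyticAt_fderiv_apply (((c k).analyticAt q).comp_of_eq hφ h) v).mul
      ((analyticAt_fderiv_apply hf (e k)).comp_of_eq hφ h))).symm
  rw [mk_eq_mk]
  have ht : Tendsto φ (𝓝 p) (𝓝 q) := h ▸ hφ.continuousAt.tendsto
  filter_upwards [hφ.eventually_analyticAt, ht.eventually hf.eventually_analyticAt] with x hx hx'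
  have h1 : fderiv ℂ (fun y => f (φ y)) x v = fderiv ℂ f (φ x) (fderiv ℂ φ x v) := by
    have := (hx'.differentiableAt.hasFDerivAt.comp x hx.differentiableAt.hasFDerivAt).fderiv
    exact congrArg (fun L : V →L[ℂ] ℂ => L v) this
  have h2 : ∀ k, fderiv ℂ (fun y => c k (φ y)) x v = c k (fderiv ℂ φ x v) := fun k => by
    have := ((c k).hasFDerivAt.comp x hx.differentiableAt.hasFDerivAt).fderiv
    exact congrArg (fun L : V →L[ℂ] ℂ => L v) this
  rw [h1]
  conv_lhs => rw [← hc (fderiv ℂ φ x v)]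
  simp [h2]

/-- A Hadamard quotient: g is the sum of the power series of f at q shifted down by one degree. -/
theorem exists_sub_eq_apply [CompleteSpace W] {f : W → ℂ} (hf : AnalyticAt ℂ f q) :
    ∃ g : W → W →L[ℂ] ℂ, AnalyticAt ℂ g q ∧ ∀ᶠ y in 𝓝 q, f y = f q + g y (y - q) := by
  obtain ⟨P, r, hP⟩ := hf
  have hrad : 0 < P.shift.radius := by
    rw [FormalMultilinearSeries.radius_shift]; exact hP.r_pos.trans_le hP.r_le
  have hg := (P.shift.hasFPowerSeriesOnBall hrad).comp_sub q
  rw [zero_add] at hg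
  refine ⟨fun y => P.shift.sum (y - q), hg.analyticAt, ?_⟩
  have hu := hg.unshift (z := f q)
  have hPs : P.shift.unshift (f q) = P := by
    have h0 := hP.coeff_zero (fun _ => 0)
    ext k v
    cases k with
    | zero =>
      have hv : v = fun _ => 0 := Subsingleton.elim _ _
      rw [hv, h0]; rfl
    | succ k =>
      simp [FormalMultilinearSeries.unshift, FormalMultilinearSeries.shift]
  rw [hPs] at hu
  filter_upwards [hP.hasFPowerSeriesAt.eventually_hasSum_sub,
    hu.hasFPowerSeriesAt.eventually_hasSum_sub] with y h1 h2 using h1.unique h2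

/-- Every germ is the sum of its value and of a combination of the coordinates. -/
theorem exists_eq_add_sum [CompleteSpace W] (hc : ∀ x, ∑ k, c k x • e k = x) (x : Hol q) :
    ∃ y : κ → Hol q, x = algebraMap ℂ _ (eval q x) +
      ∑ k, (mk (c k) ((c k).analyticAt q) - algebraMap ℂ _ (c k q)) * y k := by
  obtain ⟨f, hf, rfl⟩ := exists_rep x
  obtain ⟨g, hg, hfg⟩ := exists_sub_eq_apply hf
  have hgk : ∀ k, AnalyticAt ℂ (fun y => g y (e k)) q := fun k =>
    (ContinuousLinearMap.apply ℂ ℂ (e k)).analyticAt _ |>.comp hg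
  refine ⟨fun k => mk (fun y => g y (e k)) (hgk k), ?_⟩
  simp only [algebraMap_eq, mk_sub, mk_mul, eval_mk]
  refine Eq.trans ?_ (congrArg (_ + ·) (mk_sum Finset.univ
    (f := fun k x => (c k x - c k q) * g x (e k))
    (fun k => (((c k).analyticAt q).sub analyticAt_const).mul (hgk k))).symm)
  rw [mk_add, mk_eq_mk]
  filter_upwards [hfg] with y hy
  rw [hy]
  conv_lhs => rw [← hc (y - q)]
  simp

end Coordinates

/-- A germ lying in all powers of the maximal ideal vanishes. -/
theorem eq_zero_of_forall_mem_pow (x : Hol p)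
    (hx : ∀ M, x ∈ RingHom.ker (eval p) ^ M) : x = 0 := by
  -- Instead of Krull's theorem, membership in the M-th power is read as vanishing to order M, which
  -- suffices for a convergent power series.
  have hO : ∀ (M : ℕ) (y : Hol p), y ∈ RingHom.ker (eval p) ^ M →
      ∃ (f : V → ℂ) (hf : AnalyticAt ℂ f p), y = mk f hf ∧ f =O[𝓝 p] fun z => ‖z - p‖ ^ M := by
    intro M
    induction M with
    | zero =>
      intro y _
      obtain ⟨f, hf, rfl⟩ := exists_rep y
      refine ⟨f, hf, rfl, ?_⟩
      simpa using hf.continuousAt.norm.isBoundedUnder_le.isBigO_one ℝ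
    | succ M ih =>
      intro y hy
      rw [pow_succ] at hy
      refine Submodule.mul_induction_on hy (fun u hu w hw => ?_) fun u w hu hw => ?_
      · obtain ⟨f, hf, rfl, hfO⟩ := ih u hu
        obtain ⟨g, hg, rfl⟩ := exists_rep w
        refine ⟨_, hf.mul hg, rfl, ?_⟩
        have hg0 : g p = 0 := hw
        have := hg.differentiableAt.isBigO_sub
        rw [hg0] at this
        simp only [pow_succ]
        exact hfO.mul (by simpa using this.norm_right)
      · obtain ⟨f, hf, rfl, hfO⟩ := hu
        obtain ⟨g, hg, rfl, hgO⟩ := hw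
        exact ⟨_, hf.add hg, rfl, hfO.add hgO⟩
  obtain ⟨f, hf, rfl⟩ := exists_rep x
  obtain ⟨P, hP⟩ := id hf
  -- Once the homogeneous parts below degree k vanish, the part of degree k is O(‖y‖^(k+1)), hence
  -- zero.
  have hP0 : ∀ k y, P k (fun _ => y) = 0 := by
    intro k
    induction k using Nat.strong_induction_on with
    | _ k ih =>
      obtain ⟨g, hg, hfg, hgO⟩ := hO (k + 1) _ (hx (k + 1))
      have hfO : f =O[𝓝 p] fun z => ‖z - p‖ ^ (k + 1) := hgO.congr' (mk_eq_mk.1 hfg).symm .rfl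
      have h1 := hP.isBigO_sub_partialSum_pow (k + 1)
      have h2 : (fun y => f (p + y)) =O[𝓝 0] fun y => ‖y‖ ^ (k + 1) := by
        have ht : Tendsto (fun y => p + y) (𝓝 0) (𝓝 p) := by
          simpa using (continuous_const_add p).tendsto (0 : V)
        simpa [Function.comp_def] using hfO.comp_tendsto ht
      have h3 := h2.sub h1
      have h4 : (fun y => P k fun _ => y) =O[𝓝 0] fun y => ‖y‖ ^ (k + 1) := by
        refine h3.congr (fun y => ?_) fun _ => rfl
        rw [sub_sub_cancel, FormalMultilinearSeries.partialSum, Finset.sum_range_succ,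
          Finset.sum_eq_zero fun j hj => ih j (Finset.mem_range.1 hj) y, zero_add]
      exact h4.continuousMultilinearMap_apply_eq_zero
  have h0 : mk f hf = mk (fun _ => 0) (analyticAt_const (v := (0 : ℂ)) (x := p)) := by
    rw [mk_eq_mk]
    filter_upwards [hP.eventually_hasSum_sub] with y hy
    simp only [hP0] at hy
    exact hy.unique hasSum_zero
  rw [h0, ← algebraMap_eq, map_zero]

end Hol

end Germs

/-! ### Partial derivatives of functions and derivations of germs -/

section Bridge

variable {n : ℕ} {V : Type*} [NormedAddCommGroup V] [NormedSpace ℂ V]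

/-- The directional derivative of a function. -/
noncomputable def dirDeriv (v : V) (f : V → ℂ) : V → ℂ := fun x => fderiv ℂ f x v

theorem analyticOnNhd_dirDeriv {U : Set V} {f : V → ℂ} (hf : AnalyticOnNhd ℂ f U) (v : V) :
    AnalyticOnNhd ℂ (dirDeriv v f) U := fun x hx => Hol.analyticAt_fderiv_apply (hf x hx) v

/-- The map j parametrises an affine slice of a larger space. It turns partial derivatives in one
group of variables into directional derivatives in all the variables, on which the germs depend. -/
theorem pderiv_eq_dirDeriv {U : Set V} (hU : IsOpen U) {f : V → ℂ} (hf : AnalyticOnNhd ℂ f U)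
    {i : Fin n} {j : E n → V} {v : V} (hj : ∀ y (s : ℂ), j (y + s • Pi.single i 1) = j y + s • v)
    {g : E n → ℂ} (hg : ∀ y, j y ∈ U → g y = f (j y)) (y : E n) (hy : j y ∈ U) :
    pderiv i g y = dirDeriv v f (j y) := by
  have h1 := (hf _ hy).differentiableAt.lineDeriv_eq_fderiv (v := v)
  refine Eq.trans ?_ h1
  refine EventuallyEq.deriv_eq ?_
  have hc : ContinuousAt (fun s : ℂ => j y + s • v) 0 := by fun_prop
  have : ∀ᶠ s in 𝓝 (0 : ℂ), j y + s • v ∈ U :=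
    hc.eventually (by simpa using hU.mem_nhds hy)
  filter_upwards [this] with s hs
  rw [← hj] at hs ⊢
  exact hg _ hs

theorem analyticOnNhd_iterate_dirDeriv {U : Set V} {f : V → ℂ} (hf : AnalyticOnNhd ℂ f U) (v : V)
    (k : ℕ) : AnalyticOnNhd ℂ ((dirDeriv v)^[k] f) U := by
  induction k with
  | zero => exact hf
  | succ k ih => rw [Function.iterate_succ_apply']; exact analyticOnNhd_dirDeriv ih v

theorem iterate_pderiv_eq_dirDeriv {U : Set V} (hU : IsOpen U) {f : V → ℂ}
    (hf : AnalyticOnNhd ℂ f U) {i : Fin n} {j : E n → V} {v : V}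
    (hj : ∀ y (s : ℂ), j (y + s • Pi.single i 1) = j y + s • v)
    {g : E n → ℂ} (hg : ∀ y, j y ∈ U → g y = f (j y)) (k : ℕ) (y : E n) (hy : j y ∈ U) :
    (pderiv i)^[k] g y = (dirDeriv v)^[k] f (j y) := by
  induction k generalizing y with
  | zero => exact hg y hy
  | succ k ih =>
    rw [Function.iterate_succ_apply', Function.iterate_succ_apply']
    exact pderiv_eq_dirDeriv hU (analyticOnNhd_iterate_dirDeriv hf v k) hj ih y hy

/-- Equality is carried on the whole open set, together with analyticity, because the next
derivative needs a neighbourhood. -/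
theorem foldr_pderiv_eq {U : Set V} (hU : IsOpen U) {f : V → ℂ}
    (hf : AnalyticOnNhd ℂ f U) {j : E n → V} {v : Fin n → V}
    (hj : ∀ i y (s : ℂ), j (y + s • Pi.single i 1) = j y + s • v i)
    {g : E n → ℂ} (hg : ∀ y, j y ∈ U → g y = f (j y)) (α : Fin n → ℕ) (L : List (Fin n)) :
    AnalyticOnNhd ℂ (L.foldr (fun i g => (dirDeriv (v i))^[α i] g) f) U ∧
    ∀ y, j y ∈ U → L.foldr (fun i g => (pderiv i)^[α i] g) g y =
      L.foldr (fun i g => (dirDeriv (v i))^[α i] g) f (j y) := by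
  induction L with
  | nil => exact ⟨hf, hg⟩
  | cons i L ih =>
    exact ⟨analyticOnNhd_iterate_dirDeriv ih.1 _ _,
      iterate_pderiv_eq_dirDeriv hU ih.1 (hj i) ih.2 (α i)⟩

/-- The operator `D₁^{α₁} ⋯ Dₙ^{αₙ}` for directional derivatives of functions. -/
noncomputable def multiDeriv (v : Fin n → V) (α : Fin n → ℕ) (f : V → ℂ) : V → ℂ :=
  (List.finRange n).foldr (fun i g => (dirDeriv (v i))^[α i] g) f

theorem analyticOnNhd_multiDeriv {U : Set V} {f : V → ℂ}
    (hf : AnalyticOnNhd ℂ f U) (v : Fin n → V) (α : Fin n → ℕ) :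
    AnalyticOnNhd ℂ (multiDeriv v α f) U := by
  unfold multiDeriv
  induction List.finRange n with
  | nil => exact hf
  | cons i L ih => exact analyticOnNhd_iterate_dirDeriv ih _ _

theorem mderiv_eq_multiDeriv {U : Set V} (hU : IsOpen U) {f : V → ℂ}
    (hf : AnalyticOnNhd ℂ f U) {j : E n → V} {v : Fin n → V}
    (hj : ∀ i y (s : ℂ), j (y + s • Pi.single i 1) = j y + s • v i)
    {g : E n → ℂ} (hg : ∀ y, j y ∈ U → g y = f (j y)) (α : Fin n → ℕ) (y : E n) (hy : j y ∈ U) :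
    mderiv α g y = multiDeriv v α f (j y) :=
  (foldr_pderiv_eq hU hf hj hg α _).2 y hy

theorem Hol.mk_iterate_dirDeriv {p : V} {U : Set V} (hp : p ∈ U) {f : V → ℂ}
    (hf : AnalyticOnNhd ℂ f U) (v : V) (k : ℕ) :
    Hol.mk ((dirDeriv v)^[k] f) (analyticOnNhd_iterate_dirDeriv hf v k p hp) =
      (Hol.deriv p v)^[k] (Hol.mk f (hf p hp)) := by
  induction k with
  | zero => rfl
  | succ k ih =>
    simp only [Function.iterate_succ_apply']
    rw [← ih]
    rfl

theorem Hol.mk_multiDeriv {p : V} {U : Set V} (hp : p ∈ U) {f : V → ℂ}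
    (hf : AnalyticOnNhd ℂ f U) (v : Fin n → V) (α : Fin n → ℕ) :
    Hol.mk (multiDeriv v α f) (analyticOnNhd_multiDeriv hf v α p hp) =
      multiPow (fun i => Hol.deriv p (v i)) α (Hol.mk f (hf p hp)) := by
  suffices h : ∀ L : List (Fin n), ∃ h : AnalyticOnNhd ℂ
      (L.foldr (fun i g => (dirDeriv (v i))^[α i] g) f) U,
      Hol.mk _ (h p hp) = L.foldr (fun i g => (Hol.deriv p (v i))^[α i] g) (Hol.mk f (hf p hp)) from
    (h _).2
  intro L
  induction L with
  | nil => exact ⟨hf, rfl⟩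
  | cons i L ih =>
    obtain ⟨h, e⟩ := ih
    exact ⟨analyticOnNhd_iterate_dirDeriv h _ _, by
      refine (Hol.mk_iterate_dirDeriv hp h _ _).trans ?_
      rw [e]
      rfl⟩

/-- The operator `∑ᵢ ∂_{aᵢ} ∂_{bᵢ}` on functions. -/
noncomputable def sumDirDeriv (a b : Fin n → V) (f : V → ℂ) : V → ℂ :=
  fun x => ∑ i, dirDeriv (a i) (dirDeriv (b i) f) x

theorem analyticOnNhd_sumDirDeriv {U : Set V} {f : V → ℂ} (hf : AnalyticOnNhd ℂ f U)
    (a b : Fin n → V) : AnalyticOnNhd ℂ (sumDirDeriv a b f) U := fun x hx =>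
  Finset.analyticAt_fun_sum _ fun i _ =>
    analyticOnNhd_dirDeriv (analyticOnNhd_dirDeriv hf (b i)) (a i) x hx

theorem analyticOnNhd_iterate_sumDirDeriv {U : Set V} {f : V → ℂ} (hf : AnalyticOnNhd ℂ f U)
    (a b : Fin n → V) (l : ℕ) : AnalyticOnNhd ℂ ((sumDirDeriv a b)^[l] f) U := by
  induction l with
  | zero => exact hf
  | succ k ih => rw [Function.iterate_succ_apply']; exact analyticOnNhd_sumDirDeriv ih a b

theorem Hol.mk_iterate_sumDirDeriv {p : V} {U : Set V} (hp : p ∈ U) {f : V → ℂ}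
    (hf : AnalyticOnNhd ℂ f U) (a b : Fin n → V) (l : ℕ) :
    Hol.mk ((sumDirDeriv a b)^[l] f) (analyticOnNhd_iterate_sumDirDeriv hf a b l p hp) =
      (sumComp (fun i => Hol.deriv p (a i)) (fun i => Hol.deriv p (b i)) ^ l)
        (Hol.mk f (hf p hp)) := by
  induction l with
  | zero => rfl
  | succ k ih =>
    rw [pow_succ', Module.End.mul_apply, ← ih, sumComp_apply]
    simp only [Function.iterate_succ_apply']
    refine Eq.trans ?_ (Hol.mk_sum Finset.univ (f := fun i => dirDeriv (a i) (dirDeriv (b i)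
      ((sumDirDeriv a b)^[k] f))) fun i => analyticOnNhd_dirDeriv (analyticOnNhd_dirDeriv
      (analyticOnNhd_iterate_sumDirDeriv hf a b k) (b i)) (a i) p hp).symm
    rfl

end Bridge

/-! ### The germ of the operator `expOp` -/

section ExpOp

variable {n : ℕ} {Y : Type*} [NormedAddCommGroup Y] [NormedSpace ℂ Y]

/-- The directions of the variables `z'`. -/
def dirZ (Y : Type*) [NormedAddCommGroup Y] (i : Fin n) : Y × E n × E n := (0, Pi.single i 1, 0)

/-- The directions of the variables `ζ'`. -/
def dirZeta (Y : Type*) [NormedAddCommGroup Y] (i : Fin n) : Y × E n × E n := (0, 0, Pi.single i 1)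

theorem analyticAt_of_contDiff {V W : Type*} [NormedAddCommGroup V] [NormedSpace ℂ V]
    [NormedAddCommGroup W] [NormedSpace ℂ W] {f : V → W} {x : V}
    (hf : ContDiff ℂ (⊤ : WithTop ℕ∞) f) : AnalyticAt ℂ f x := hf.contDiffAt.analyticAt

theorem analyticAt_zero_section (y : Y) :
    AnalyticAt ℂ (fun x : Y => (x, (0 : E n), (0 : E n))) y := by fun_prop

/-- The operators `⟨∂_{ζ'}, ∂_{z'}⟩^l / l!` at `z' = 0`, `ζ' = 0`, on germs. -/
noncomputable def expGermCoeff (n : ℕ) (y : Y) (l : ℕ) :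
    Hol (y, (0 : E n), (0 : E n)) →ₗ[ℂ] Hol y :=
  expCoeff (fun i => Hol.deriv _ (dirZeta Y i)) (fun i => Hol.deriv _ (dirZ Y i))
    (Hol.comap (fun x => (x, 0, 0)) (analyticAt_zero_section y) rfl) l

theorem sum_mderiv_eq {U : Set (Y × E n × E n)} (hU : IsOpen U) {F : Y × E n × E n → ℂ}
    (hF : AnalyticOnNhd ℂ F U) (l : ℕ) (y : Y) (z ζ : E n) (hy : (y, z, ζ) ∈ U) :
    ∑ α ∈ Finset.piAntidiag (Finset.univ : Finset (Fin n)) l, ((multiFactorial α : ℂ))⁻¹ *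
      mderiv α (fun t : E n => mderiv α (fun x : E n => F (y, x, t)) z) ζ =
    ((l.factorial : ℂ))⁻¹ * (sumDirDeriv (dirZeta Y) (dirZ Y))^[l] F (y, z, ζ) := by
  have h1 : ∀ α : Fin n → ℕ, mderiv α (fun t : E n => mderiv α (fun x : E n => F (y, x, t)) z) ζ =
      multiDeriv (dirZeta Y) α (multiDeriv (dirZ Y) α F) (y, z, ζ) := by
    intro α
    refine mderiv_eq_multiDeriv (j := fun t => (y, z, t)) hU (analyticOnNhd_multiDeriv hF _ α) ?_
      ?_ α ζ hy
    · intro i t s; simp [dirZeta]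
    · intro t ht
      refine mderiv_eq_multiDeriv (j := fun x => (y, x, t)) hU hF ?_ (fun _ _ => rfl) α z ht
      intro i t s; simp [dirZ]
  -- The multinomial identity holds between germs at (y, z, ζ); evaluating the germs gives the
  -- numerical identity.
  have h2 := congrArg (Hol.eval (y, z, ζ)) (inv_factorial_smul_sumComp_pow
    (fun i => Hol.deriv (y, z, ζ) (dirZeta Y i)) (fun i => Hol.deriv (y, z, ζ) (dirZ Y i))
    (fun i j x => Hol.deriv_comm _ _ x) (fun i j x => Hol.deriv_comm _ _ x)
    (fun i j x => Hol.deriv_comm _ _ x) l (Hol.mk F (hF _ hy)))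
  rw [← Hol.mk_iterate_sumDirDeriv hy hF, map_smul, map_sum] at h2
  refine Eq.trans ?_ h2.symm
  refine Finset.sum_congr rfl fun α _ => ?_
  rw [h1, map_smul, ← Hol.mk_multiDeriv hy hF, ← Hol.mk_multiDeriv hy (analyticOnNhd_multiDeriv hF _ α)]
  rfl

theorem exists_mk_sum_mderiv {y : Y} {F : Y × E n × E n → ℂ} (hF : AnalyticAt ℂ F (y, 0, 0))
    (l : ℕ) : ∃ h : AnalyticAt ℂ (fun x : Y =>
      ∑ α ∈ Finset.piAntidiag (Finset.univ : Finset (Fin n)) l, ((multiFactorial α : ℂ))⁻¹ *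
        mderiv α (fun t : E n => mderiv α (fun w : E n => F (x, w, t)) 0) 0) y,
      Hol.mk _ h = expGermCoeff n y l (Hol.mk F hF) := by
  set U := {p | AnalyticAt ℂ F p} with hUdef
  have hU : IsOpen U := isOpen_analyticAt ℂ F
  have hFU : AnalyticOnNhd ℂ F U := fun p hp => hp
  have hA := (analyticOnNhd_iterate_sumDirDeriv hFU (dirZeta Y) (dirZ Y) l _ hF).comp_of_eq
    (analyticAt_zero_section (n := n) y) rfl
  have hA' := (analyticAt_const (𝕜 := ℂ) (v := ((l.factorial : ℂ))⁻¹)).mul hA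
  have hev : (fun x : Y => ((l.factorial : ℂ))⁻¹ *
      (sumDirDeriv (dirZeta Y) (dirZ Y))^[l] F (x, 0, 0)) =ᶠ[𝓝 y] (fun x : Y =>
      ∑ α ∈ Finset.piAntidiag (Finset.univ : Finset (Fin n)) l, ((multiFactorial α : ℂ))⁻¹ *
        mderiv α (fun t : E n => mderiv α (fun w : E n => F (x, w, t)) 0) 0) := by
    have ht : Tendsto (fun x : Y => (x, (0 : E n), (0 : E n))) (𝓝 y) (𝓝 (y, 0, 0)) :=
      (analyticAt_zero_section y).continuousAt
    filter_upwards [ht.eventually (hU.mem_nhds hF)] with x hx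
    exact (sum_mderiv_eq hU hFU l x 0 0 hx).symm
  refine ⟨hA'.congr hev, ?_⟩
  rw [← (Hol.mk_eq_mk (hf := hA')).2 hev, expGermCoeff, expCoeff_apply,
    ← Hol.mk_iterate_sumDirDeriv (show _ ∈ U from hF) hFU]
  rfl

/-- The germ of the exponential operator applied to a series of analytic functions. -/
theorem exists_mk_expOp {y : Y} {F : ℕ → Y × E n × E n → ℂ}
    (hF : ∀ k, AnalyticAt ℂ (F k) (y, 0, 0)) (ν : ℕ) :
    ∃ h : AnalyticAt ℂ (fun x : Y => expOp (fun k z' ζ' => F k (x, z', ζ')) ν 0 0) y,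
      Hol.mk _ h = ∑ p ∈ Finset.HasAntidiagonal.antidiagonal ν,
        expGermCoeff n y p.2 (Hol.mk (F p.1) (hF p.1)) := by
  choose h e using fun p : ℕ × ℕ => exists_mk_sum_mderiv (hF p.1) p.2
  refine ⟨Finset.analyticAt_fun_sum _ fun p _ => h p, ?_⟩
  simp only [← e]
  exact (Hol.mk_sum _ h).symm

end ExpOp

/-! ### The product of formal series on germs -/

section CircGerm

variable {n : ℕ}

/-- The space of the variables `(z, ζ, η)`. -/
abbrev Phase (n : ℕ) : Type := E n × E n × ℂ

/-- The coefficients of a formal series are analytic at a point. -/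
def AnalyticSeriesAt (P : FormalSeries n) (x : Phase n) : Prop :=
  ∀ ν, AnalyticAt ℂ (fun y : Phase n => P ν y.1 y.2.1 y.2.2) x

/-- The germ of a formal series. -/
noncomputable def germ {P : FormalSeries n} {x : Phase n} (h : AnalyticSeriesAt P x) : (Hol x)⟦X⟧ :=
  PowerSeries.mk fun ν => Hol.mk _ (h ν)

theorem coeff_germ {P : FormalSeries n} {x : Phase n} (h : AnalyticSeriesAt P x) (ν : ℕ) :
    coeff ν (germ h) = Hol.mk _ (h ν) := coeff_mk _ _

theorem eval_coeff_germ {P : FormalSeries n} {x : Phase n} (h : AnalyticSeriesAt P x) (ν : ℕ) :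
    Hol.eval x (coeff ν (germ h)) = P ν x.1 x.2.1 x.2.2 := by rw [coeff_germ]; rfl

/-- The derivations `∂_{zᵢ}`. -/
noncomputable def derivZ (x : Phase n) (i : Fin n) : Derivation ℂ (Hol x) (Hol x) :=
  Hol.deriv x (Pi.single i 1, 0, 0)

/-- The derivations `∂_{ζᵢ}`. -/
noncomputable def derivZeta (x : Phase n) (i : Fin n) : Derivation ℂ (Hol x) (Hol x) :=
  Hol.deriv x (0, Pi.single i 1, 0)

/-- The product of germs of formal series. -/
noncomputable abbrev germStar {x : Phase n} (Q P : (Hol x)⟦X⟧) : (Hol x)⟦X⟧ :=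
  star (derivZeta x) (derivZ x) Q P

/-- The dictionary between `circ` and the star product: algebraic identities proved for `star`
become pointwise identities for formal series. -/
theorem exists_germ_circ {P Q : FormalSeries n} {x : Phase n} (hP : AnalyticSeriesAt P x)
    (hQ : AnalyticSeriesAt Q x) :
    ∃ h : AnalyticSeriesAt (circ Q P) x, germ h = germStar (germ hQ) (germ hP) := by
  -- The map φ shifts ζ by ζ' and ψ shifts z by z', so the factor Q does not see z' and the factor P
  -- does not see ζ': the variables are separated.
  set φ : Phase n × E n × E n → Phase n := fun y => (y.1.1, y.1.2.1 + y.2.2, y.1.2.2) with hφdef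
  set ψ : Phase n × E n × E n → Phase n := fun y => (y.1.1 + y.2.1, y.1.2.1, y.1.2.2) with hψdef
  have hφ : AnalyticAt ℂ φ (x, 0, 0) := analyticAt_of_contDiff (by fun_prop)
  have hψ : AnalyticAt ℂ ψ (x, 0, 0) := analyticAt_of_contDiff (by fun_prop)
  have hφx : φ (x, 0, 0) = x := by simp [hφdef]
  have hψx : ψ (x, 0, 0) = x := by simp [hψdef]
  set σ := Hol.comap φ hφ hφx
  set τ := Hol.comap ψ hψ hψx
  set F : ℕ → Phase n × E n × E n → ℂ := fun m y =>
    ∑ q ∈ Finset.HasAntidiagonal.antidiagonal m,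
      Q q.1 y.1.1 (y.1.2.1 + y.2.2) y.1.2.2 * P q.2 (y.1.1 + y.2.1) y.1.2.1 y.1.2.2
  have hFq : ∀ q : ℕ × ℕ, AnalyticAt ℂ (fun y : Phase n × E n × E n =>
      Q q.1 y.1.1 (y.1.2.1 + y.2.2) y.1.2.2 * P q.2 (y.1.1 + y.2.1) y.1.2.1 y.1.2.2) (x, 0, 0) :=
    fun q => ((hQ q.1).comp_of_eq hφ hφx).mul ((hP q.2).comp_of_eq hψ hψx)
  have hF : ∀ m, AnalyticAt ℂ (F m) (x, 0, 0) := fun m =>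
    Finset.analyticAt_fun_sum _ fun q _ => hFq q
  have hFm : ∀ m, Hol.mk (F m) (hF m) = ∑ q ∈ Finset.HasAntidiagonal.antidiagonal m,
      σ (Hol.mk _ (hQ q.1)) * τ (Hol.mk _ (hP q.2)) := fun m => (Hol.mk_sum _ hFq).symm
  choose h e using exists_mk_expOp hF
  have h' : AnalyticSeriesAt (circ Q P) x := h
  refine ⟨h', PowerSeries.ext fun ν => ?_⟩
  rw [coeff_germ, coeff_star]
  refine (e ν).trans (Finset.sum_congr rfl fun p _ => ?_)
  rw [hFm, map_sum]
  refine Finset.sum_congr rfl fun q _ => ?_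
  rw [coeff_germ, coeff_germ]
  refine expCoeff_mul_eq_contract (a' := derivZeta x) (b' := derivZ x) _ _ _ ?_ ?_ ?_ ?_ ?_ ?_ _ _ _
  · intro i q
    exact Hol.deriv_comap_eq_zero hφ hφx (fun y s => by simp [hφdef, dirZ]) q
  · intro i q
    exact Hol.deriv_comap_eq_zero hψ hψx (fun y s => by simp [hψdef, dirZeta]) q
  · intro i q
    exact Hol.deriv_comap_of_affine hφ hφx (fun y s => by simp [hφdef, dirZeta, add_assoc]) q
  · intro i q
    exact Hol.deriv_comap_of_affine hψ hψx (fun y s => by simp [hψdef, dirZ, add_assoc]) q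
  · intro q
    rw [Hol.comap_comap]
    exact Hol.comap_id _ _ _ (Eventually.of_forall fun y => by simp [hφdef]) q
  · intro q
    rw [Hol.comap_comap]
    exact Hol.comap_id _ _ _ (Eventually.of_forall fun y => by simp [hψdef]) q

theorem derivZ_comm (x : Phase n) (i j : Fin n) (f : Hol x) :
    derivZ x i (derivZ x j f) = derivZ x j (derivZ x i f) := Hol.deriv_comm _ _ f

theorem derivZeta_comm (x : Phase n) (i j : Fin n) (f : Hol x) :
    derivZeta x i (derivZeta x j f) = derivZeta x j (derivZeta x i f) := Hol.deriv_comm _ _ f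

theorem derivZeta_derivZ (x : Phase n) (i j : Fin n) (f : Hol x) :
    derivZeta x i (derivZ x j f) = derivZ x j (derivZeta x i f) := Hol.deriv_comm _ _ f

theorem germStar_assoc {x : Phase n} (R Q P : (Hol x)⟦X⟧) :
    germStar R (germStar Q P) = germStar (germStar R Q) P :=
  star_assoc _ _ (derivZeta_comm x) (derivZ_comm x) (derivZeta_derivZ x) R Q P

/-- Associativity of the product, at every point where the factors are analytic. -/
theorem circ_assoc {P Q R : FormalSeries n} {x : Phase n} (hP : AnalyticSeriesAt P x)
    (hQ : AnalyticSeriesAt Q x) (hR : AnalyticSeriesAt R x) :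
    AnalyticSeriesAt (circ R (circ Q P)) x ∧ AnalyticSeriesAt (circ (circ R Q) P) x ∧
    ∀ ν, circ R (circ Q P) ν x.1 x.2.1 x.2.2 = circ (circ R Q) P ν x.1 x.2.1 x.2.2 := by
  obtain ⟨h1, e1⟩ := exists_germ_circ hP hQ
  obtain ⟨h2, e2⟩ := exists_germ_circ h1 hR
  obtain ⟨h3, e3⟩ := exists_germ_circ hQ hR
  obtain ⟨h4, e4⟩ := exists_germ_circ hP h3
  refine ⟨h2, h4, fun ν => ?_⟩
  rw [← eval_coeff_germ h2, ← eval_coeff_germ h4, e2, e4, e1, e3, germStar_assoc]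

end CircGerm

/-! ### The change of coordinates as pure algebra -/

section Model

/-- The algebra behind a change of coordinates: germs in `w` (`A`), in `(z, ζ)` (`Z`), in `(w, μ)`
(`O`) and in `(w, μ, z', ζ')` (`B`), with the maps and derivations between them. -/
structure PullbackModel (ι A Z O B : Type*) [Fintype ι] [DecidableEq ι] [CommRing A] [Algebra ℂ A]
    [CommRing Z] [Algebra ℂ Z] [CommRing O] [Algebra ℂ O] [CommRing B] [Algebra ℂ B] where
  incl : O →ₐ[ℂ] B
  restr : B →ₐ[ℂ] O
  proj : A →ₐ[ℂ] O
  shift : A →ₐ[ℂ] B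
  subst : Z →ₐ[ℂ] B
  Dz : ι → Derivation ℂ B B
  Dζ : ι → Derivation ℂ B B
  Dw : ι → Derivation ℂ B B
  Dμ : ι → Derivation ℂ B B
  dw : ι → Derivation ℂ O O
  dμ : ι → Derivation ℂ O O
  dz : ι → Derivation ℂ Z Z
  dζ : ι → Derivation ℂ Z Z
  -- Meaning of the data: `zc`, `ζc` are z', ζ'; `jac k j` is the entry (k, j) of J(Φ(w) + z',
  -- Φ(w)); `wc` and `mu` are the coordinates w and μ; `grad k i` is ∂wₖ/∂zᵢ as a function of w;
  -- `shift a` is a evaluated at Φ⁻¹(Φ(w) + z').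
  zc : ι → B
  ζc : ι → B
  jac : ι → ι → B
  mu : ι → O
  wc : ι → A
  grad : ι → ι → A
  zeta : ι → Z
  Dz_Dz : ∀ i j x, Dz i (Dz j x) = Dz j (Dz i x)
  Dζ_Dζ : ∀ i j x, Dζ i (Dζ j x) = Dζ j (Dζ i x)
  Dζ_Dz : ∀ i j x, Dζ i (Dz j x) = Dz j (Dζ i x)
  Dw_Dz : ∀ i j x, Dw i (Dz j x) = Dz j (Dw i x)
  Dw_Dζ : ∀ i j x, Dw i (Dζ j x) = Dζ j (Dw i x)
  Dμ_Dz : ∀ i j x, Dμ i (Dz j x) = Dz j (Dμ i x)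
  Dμ_Dζ : ∀ i j x, Dμ i (Dζ j x) = Dζ j (Dμ i x)
  Dμ_Dμ : ∀ i j x, Dμ i (Dμ j x) = Dμ j (Dμ i x)
  dw_dw : ∀ i j x, dw i (dw j x) = dw j (dw i x)
  dμ_dμ : ∀ i j x, dμ i (dμ j x) = dμ j (dμ i x)
  dμ_dw : ∀ i j x, dμ i (dw j x) = dw j (dμ i x)
  dz_dz : ∀ i j x, dz i (dz j x) = dz j (dz i x)
  dζ_dζ : ∀ i j x, dζ i (dζ j x) = dζ j (dζ i x)
  dζ_dz : ∀ i j x, dζ i (dz j x) = dz j (dζ i x)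
  restr_incl : ∀ f, restr (incl f) = f
  restr_shift : ∀ a, restr (shift a) = proj a
  restr_zc : ∀ i, restr (zc i) = 0
  restr_ζc : ∀ i, restr (ζc i) = 0
  Dz_zc : ∀ k i, Dz i (zc k) = if i = k then 1 else 0
  Dζ_zc : ∀ k i, Dζ i (zc k) = 0
  Dw_zc : ∀ k i, Dw i (zc k) = 0
  Dζ_ζc : ∀ k i, Dζ i (ζc k) = if i = k then 1 else 0
  Dz_ζc : ∀ k i, Dz i (ζc k) = 0
  Dz_incl : ∀ i f, Dz i (incl f) = 0
  Dζ_incl : ∀ i f, Dζ i (incl f) = 0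
  Dw_incl : ∀ i f, Dw i (incl f) = incl (dw i f)
  restr_Dw : ∀ i x, restr (Dw i x) = dw i (restr x)
  restr_Dμ : ∀ i x, restr (Dμ i x) = dμ i (restr x)
  Dζ_jac : ∀ i k j, Dζ i (jac k j) = 0
  Dμ_jac : ∀ i k j, Dμ i (jac k j) = 0
  Dζ_shift : ∀ i a, Dζ i (shift a) = 0
  dμ_proj : ∀ i a, dμ i (proj a) = 0
  dμ_mu : ∀ k i, dμ i (mu k) = if i = k then 1 else 0
  dw_mu : ∀ k i, dw i (mu k) = 0
  dw_wc : ∀ k i, dw i (proj (wc k)) = if i = k then 1 else 0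
  dζ_zeta : ∀ k i, dζ i (zeta k) = if i = k then 1 else 0
  dz_zeta : ∀ k i, dz i (zeta k) = 0
  Dζ_subst : ∀ j f, Dζ j (subst f) = subst (dζ j f)
  Dμ_subst : ∀ k f, Dμ k (subst f) = ∑ j, jac k j * subst (dζ j f)
  Dz_subst : ∀ i f, Dz i (subst f) = ∑ j, Dz i (∑ k, jac k j * incl (mu k)) * subst (dζ j f)
  -- The field ∑ₖ (∂wₖ/∂zᵢ) ∂_{wₖ} is ∂/∂zᵢ; it reaches f through Φ(w) and through the dependence of
  -- J on w.
  grad_Dw_subst : ∀ i f, ∑ k, incl (proj (grad k i)) * Dw k (subst f) = subst (dz i f) +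
    ∑ j, (∑ k, incl (proj (grad k i)) * Dw k (∑ m, jac m j * incl (mu m))) * subst (dζ j f)
  -- The defining identity of J at the pair (Φ(w) + z', Φ(w)); it is the source of all cancellations
  -- below.
  sum_zc_jac : ∀ k, ∑ j, zc j * jac k j = shift (wc k) - incl (proj (wc k))
  Dz_shift_wc : ∀ i k, Dz i (shift (wc k)) = shift (grad k i)
  grad_Dw_shift_wc : ∀ i m, ∑ k, incl (proj (grad k i)) * Dw k (shift (wc m)) = shift (grad m i)
  subst_zeta : ∀ i, subst (zeta i) = ζc i + ∑ k, jac k i * incl (mu k)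

namespace PullbackModel

variable {ι A Z O B : Type*} [Fintype ι] [DecidableEq ι] [CommRing A] [Algebra ℂ A]
    [CommRing Z] [Algebra ℂ Z] [CommRing O] [Algebra ℂ O] [CommRing B] [Algebra ℂ B]
    (S : PullbackModel ι A Z O B)

/-- The exponential operator from `B` to power series over `O`. -/
noncomputable def exp (G : B) : O⟦X⟧ := expSeries S.Dζ S.Dz S.restr G

/-- The pull-back of series. -/
noncomputable def pull (P : Z⟦X⟧) : O⟦X⟧ :=
  seriesExtend (fun l => expCoeff S.Dζ S.Dz S.restr l ∘ₗ S.subst.toLinearMap) P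

/-- The pull-back `∑ₖ μₖ ∂wₖ/∂zᵢ` of the coordinate `ζᵢ`. -/
noncomputable def lin (i : ι) : O := ∑ k, S.mu k * S.proj (S.grad k i)

theorem isXLinear_pull : IsXLinear S.pull :=
  isXLinear_seriesExtend (fun l => expCoeff S.Dζ S.Dz S.restr l ∘ₗ S.subst.toLinearMap)

theorem pull_C (f : Z) : S.pull (C f) = S.exp (S.subst f) := by
  ext l
  rw [pull, coeff_seriesExtend_C, exp, coeff_expSeries]
  rfl

theorem exp_incl_mul (f : O) (G : B) : S.exp (S.incl f * G) = C f * S.exp G := by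
  have := expSeries_mul_const S.Dζ S.Dz S.restr (x := S.incl f) (S.Dζ_incl · f) (S.Dz_incl · f) G
  rwa [S.restr_incl] at this

theorem exp_zc_mul (k : ι) (G : B) : S.exp (S.zc k * G) = X * S.exp (S.Dζ k G) :=
  expSeries_mul_coord_right _ _ _ S.Dζ_Dζ S.Dζ_Dz (S.Dζ_zc k) (S.Dz_zc k) (S.restr_zc k) G

theorem exp_ζc_mul (k : ι) (G : B) : S.exp (S.ζc k * G) = X * S.exp (S.Dz k G) :=
  expSeries_mul_coord_left _ _ _ S.Dz_Dz S.Dζ_Dz (S.Dz_ζc k) (S.Dζ_ζc k) (S.restr_ζc k) G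

theorem exp_add (F G : B) : S.exp (F + G) = S.exp F + S.exp G := expSeries_add _ _ _ F G

theorem exp_sum {κ : Type*} (s : Finset κ) (F : κ → B) :
    S.exp (∑ k ∈ s, F k) = ∑ k ∈ s, S.exp (F k) := expSeries_sum _ _ _ s F

theorem exp_incl (f : O) : S.exp (S.incl f) = C f := by
  ext l
  rw [exp, coeff_expSeries, coeff_C]
  cases l with
  | zero => simp [S.restr_incl]
  | succ l =>
    have h : sumComp S.Dζ S.Dz (S.incl f) = 0 := by simp [sumComp_apply, S.Dz_incl]
    rw [expCoeff_apply, pow_succ, Module.End.mul_apply, h]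
    simp

theorem exp_Dw (k : ι) (G : B) : S.exp (S.Dw k G) = coeffMap (S.dw k : O →ₗ[ℂ] O) (S.exp G) :=
  expSeries_derivation _ _ _ (fun i x => S.Dw_Dζ k i x) (fun i x => S.Dw_Dz k i x) (S.restr_Dw k) G

theorem exp_Dμ (k : ι) (G : B) : S.exp (S.Dμ k G) = coeffMap (S.dμ k : O →ₗ[ℂ] O) (S.exp G) :=
  expSeries_derivation _ _ _ (fun i x => S.Dμ_Dζ k i x) (fun i x => S.Dμ_Dz k i x) (S.restr_Dμ k) G

/-- The product on power series over `O`. -/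
noncomputable abbrev starO (Q P : O⟦X⟧) : O⟦X⟧ := star S.dμ S.dw Q P

/-- The product on power series over `Z`. -/
noncomputable abbrev starZ (Q P : Z⟦X⟧) : Z⟦X⟧ := star S.dζ S.dz Q P

theorem starO_assoc (R Q P : O⟦X⟧) : S.starO R (S.starO Q P) = S.starO (S.starO R Q) P :=
  star_assoc _ _ S.dμ_dμ S.dw_dw S.dμ_dw R Q P

theorem starZ_assoc (R Q P : Z⟦X⟧) : S.starZ R (S.starZ Q P) = S.starZ (S.starZ R Q) P :=
  star_assoc _ _ S.dζ_dζ S.dz_dz S.dζ_dz R Q P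

/-- The amplitudes whose dependence on `μ` comes from the shift of `ζ'`. -/
def IsAdapted (G : B) : Prop := ∀ k, S.Dμ k G = ∑ j, S.jac k j * S.Dζ j G

theorem isAdapted_Dμ {G : B} (hG : S.IsAdapted G) (k : ι) : S.IsAdapted (S.Dμ k G) := by
  intro m
  rw [S.Dμ_Dμ, hG m]
  simp [S.Dμ_jac, S.Dμ_Dζ]

theorem isAdapted_subst (f : Z) : S.IsAdapted (S.subst f) := by
  intro k
  simp [S.Dμ_subst, S.Dζ_subst]

/-- Under the exponential z'ⱼ becomes t∂_{ζ'ⱼ}, and ∑ⱼ Jₖⱼ∂_{ζ'ⱼ} acts on an adapted amplitude as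
∂_{μₖ}. -/
theorem exp_sum_zc_jac_mul {G : B} (hG : S.IsAdapted G) (b : A) (k : ι) :
    S.exp ((∑ j, S.zc j * S.jac k j) * (S.shift b * G)) = X * S.exp (S.shift b * S.Dμ k G) := by
  rw [Finset.sum_mul, exp_sum, hG, Finset.mul_sum, exp_sum, Finset.mul_sum]
  refine Finset.sum_congr rfl fun j _ => ?_
  rw [mul_assoc, exp_zc_mul]
  simp only [Derivation.leibniz, S.Dζ_jac, S.Dζ_shift, smul_eq_mul, mul_zero, add_zero]
  congr 2
  ring

/-- Both expressions obey the same recursion when b is multiplied by wₖ − c, since `shift` moves wₖ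
by ∑ⱼ z'ⱼJₖⱼ. Their difference therefore gains a factor wₖ − c or a factor X. -/
theorem star_exp_coord_mul {G : B} (hG : S.IsAdapted G) (b : A) (k : ι) (c : ℂ) :
    S.starO (S.exp G) (C (S.proj ((S.wc k - algebraMap ℂ A c) * b))) -
      S.exp (S.shift ((S.wc k - algebraMap ℂ A c) * b) * G) =
    C (S.proj (S.wc k - algebraMap ℂ A c)) *
      (S.starO (S.exp G) (C (S.proj b)) - S.exp (S.shift b * G)) +
    X * (S.starO (S.exp (S.Dμ k G)) (C (S.proj b)) - S.exp (S.shift b * S.Dμ k G)) := by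
  have h1 : S.starO (S.exp G) (C (S.proj ((S.wc k - algebraMap ℂ A c) * b))) =
      C (S.proj (S.wc k - algebraMap ℂ A c)) * S.starO (S.exp G) (C (S.proj b)) +
      X * S.starO (S.exp (S.Dμ k G)) (C (S.proj b)) := by
    rw [exp_Dμ, map_mul, map_mul]
    refine star_C_mul_coord _ _ S.dμ_dμ (fun i => ?_) _ _
    simp [S.dw_wc]
  have h2 : S.exp (S.shift ((S.wc k - algebraMap ℂ A c) * b) * G) =
      C (S.proj (S.wc k - algebraMap ℂ A c)) * S.exp (S.shift b * G) +
      X * S.exp (S.shift b * S.Dμ k G) := by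
    rw [← S.exp_sum_zc_jac_mul hG, ← S.exp_incl_mul, ← S.exp_add, S.sum_zc_jac]
    congr 1
    simp only [map_mul, map_sub, AlgHom.commutes]
    ring
  rw [h1, h2]
  ring

variable {𝔪 : Ideal O}

theorem starO_add_right (Q P P' : O⟦X⟧) : S.starO Q (P + P') = S.starO Q P + S.starO Q P' :=
  (isXLinear_star_right _ _ Q).map_add P P'

theorem starO_sum_right {κ : Type*} (s : Finset κ) (Q : O⟦X⟧) (P : κ → O⟦X⟧) :
    S.starO Q (∑ k ∈ s, P k) = ∑ k ∈ s, S.starO Q (P k) :=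
  (isXLinear_star_right _ _ Q).map_sum s P

theorem star_exp_const (G : B) (c : ℂ) :
    S.starO (S.exp G) (C (S.proj (algebraMap ℂ A c))) = S.exp (S.shift (algebraMap ℂ A c) * G) := by
  rw [AlgHom.commutes, AlgHom.commutes, ← AlgHom.commutes S.incl, exp_incl_mul]
  exact (star_C_right_of_const _ _ (by simp) _).trans (mul_comm _ _)

/-- The product with a germ depending on `w` only. -/
theorem star_exp (hkrull : ∀ x : O, (∀ M, x ∈ 𝔪 ^ M) → x = 0) {w₀ : ι → ℂ}
    (hw₀ : ∀ k, S.proj (S.wc k - algebraMap ℂ A (w₀ k)) ∈ 𝔪)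
    (hA : ∀ b : A, ∃ (c : ℂ) (b' : ι → A),
      b = algebraMap ℂ A c + ∑ k, (S.wc k - algebraMap ℂ A (w₀ k)) * b' k)
    {G : B} (hG : S.IsAdapted G) (b : A) :
    S.starO (S.exp G) (C (S.proj b)) = S.exp (S.shift b * G) := by
  -- Outer induction on the degree in X, for all adapted amplitudes; inner induction on the power of
  -- 𝔪, for all b. Expanding b at w₀ feeds both.
  have main : ∀ N (G : B), S.IsAdapted G → ∀ b : A,
      coeff N (S.starO (S.exp G) (C (S.proj b)) - S.exp (S.shift b * G)) = 0 := by
    intro N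
    induction N using Nat.strong_induction_on with
    | _ N ih =>
      intro G hG b
      refine hkrull _ fun M => ?_
      induction M generalizing b with
      | zero => simp
      | succ M ihM =>
        obtain ⟨c, b', hb⟩ := hA b
        have hsplit : S.starO (S.exp G) (C (S.proj b)) - S.exp (S.shift b * G) =
            ∑ k, (S.starO (S.exp G) (C (S.proj ((S.wc k - algebraMap ℂ A (w₀ k)) * b' k))) -
              S.exp (S.shift ((S.wc k - algebraMap ℂ A (w₀ k)) * b' k) * G)) := by
          conv_lhs => rw [hb]
          simp only [map_add S.proj, map_add S.shift, map_add C, add_mul, S.exp_add,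
            starO_add_right, star_exp_const, map_sum S.proj, map_sum S.shift, map_sum C,
            Finset.sum_mul, S.exp_sum, starO_sum_right, Finset.sum_sub_distrib]
          ring
        rw [hsplit, map_sum]
        refine Ideal.sum_mem _ fun k _ => ?_
        rw [S.star_exp_coord_mul hG, map_add, coeff_C_mul]
        refine Ideal.add_mem _ ?_ ?_
        · rw [pow_succ']
          exact Ideal.mul_mem_mul (hw₀ k) (ihM _)
        · cases N with
          | zero => simp
          | succ N =>
            rw [coeff_succ_X_mul, ih N N.lt_succ_self _ (S.isAdapted_Dμ hG k)]
            exact Ideal.zero_mem _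
  exact sub_eq_zero.1 (PowerSeries.ext fun N => main N G hG b)

/-- The summand ζ'ᵢ acts as t∂_{z'ᵢ}, and what it produces can be written back with coordinates z'ⱼ.
Together with the summand ᵗJμ this gives the z'ᵢ-derivative of ∑ⱼ z'ⱼ(ᵗJμ)ⱼ = ⟨μ, Φ⁻¹(Φ(w) + z') −
w⟩, in which the choice of J has disappeared from the prefactor. -/
theorem exp_subst_zeta_mul (i : ι) (f : Z) :
    S.exp (S.subst (S.zeta i * f)) =
      ∑ k, C (S.mu k) * S.exp (S.shift (S.grad k i) * S.subst f) := by
  have h1 : S.exp (S.ζc i * S.subst f) =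
      S.exp ((∑ j, S.zc j * S.Dz i (∑ k, S.jac k j * S.incl (S.mu k))) * S.subst f) := by
    rw [exp_ζc_mul, S.Dz_subst, exp_sum, Finset.mul_sum, Finset.sum_mul, exp_sum]
    refine Finset.sum_congr rfl fun j _ => ?_
    rw [mul_assoc, exp_zc_mul, Derivation.leibniz, S.Dζ_Dz]
    simp [S.Dζ_jac, S.Dζ_incl, S.Dζ_subst]
  have h2 : ∑ j, S.zc j * S.Dz i (∑ k, S.jac k j * S.incl (S.mu k)) +
      ∑ k, S.jac k i * S.incl (S.mu k) =
      S.Dz i (∑ j, S.zc j * ∑ k, S.jac k j * S.incl (S.mu k)) := by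
    rw [map_sum, ]
    simp only [Derivation.leibniz (S.Dz i) (S.zc _), S.Dz_zc, smul_eq_mul, Finset.sum_add_distrib]
    simp
  have h3 : ∑ j, S.zc j * ∑ k, S.jac k j * S.incl (S.mu k) =
      ∑ k, S.incl (S.mu k) * (S.shift (S.wc k) - S.incl (S.proj (S.wc k))) := by
    simp only [← S.sum_zc_jac, Finset.mul_sum]
    rw [Finset.sum_comm]
    exact Finset.sum_congr rfl fun k _ => Finset.sum_congr rfl fun j _ => by ring
  rw [map_mul, S.subst_zeta, add_mul, exp_add, h1, ← exp_add, ← add_mul, h2, h3, map_sum,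
    Finset.sum_mul, exp_sum]
  refine Finset.sum_congr rfl fun k _ => ?_
  rw [← exp_incl_mul]
  simp [S.Dz_incl, S.Dz_shift_wc, mul_assoc]

theorem starO_mul_mu (Q : O⟦X⟧) (k : ι) (a : O) :
    S.starO Q (C (S.mu k * a)) = C (S.mu k) * S.starO Q (C a) := by
  rw [mul_comm (S.mu k), map_mul, mul_comm (C (S.mu k))]
  exact star_mul_C_right _ _ (S.dw_mu k) _ _

/-- Multiplicativity of the pull-back when the right factor is ζᵢ: since ζᵢ does not depend on z, Q
∘ ζᵢ is the ordinary product. -/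
theorem pull_mul_zeta (hkrull : ∀ x : O, (∀ M, x ∈ 𝔪 ^ M) → x = 0) {w₀ : ι → ℂ}
    (hw₀ : ∀ k, S.proj (S.wc k - algebraMap ℂ A (w₀ k)) ∈ 𝔪)
    (hA : ∀ b : A, ∃ (c : ℂ) (b' : ι → A),
      b = algebraMap ℂ A c + ∑ k, (S.wc k - algebraMap ℂ A (w₀ k)) * b' k)
    (i : ι) (Q : Z⟦X⟧) : S.pull (Q * C (S.zeta i)) = S.starO (S.pull Q) (C (S.lin i)) := by
  refine (S.isXLinear_pull.comp (IsXLinear.id.mul_right _)).ext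
    ((isXLinear_star_left _ _ _).comp S.isXLinear_pull) (fun f => ?_) Q
  rw [mul_comm, ← map_mul, pull_C, exp_subst_zeta_mul, pull_C, lin, map_sum]
  refine Eq.trans ?_ (S.starO_sum_right _ _ _).symm
  refine Finset.sum_congr rfl fun k _ => ?_
  rw [starO_mul_mu, S.star_exp hkrull hw₀ hA (S.isAdapted_subst f)]

theorem starO_lin_left (i : ι) (P : O⟦X⟧) : S.starO (C (S.lin i)) P =
    C (S.lin i) * P + X * ∑ k, C (S.proj (S.grad k i)) * coeffMap (S.dw k : O →ₗ[ℂ] O) P := by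
  have h : ∀ j, S.dμ j (S.lin i) = S.proj (S.grad j i) := by
    intro j
    simp [lin, S.dμ_proj, S.dμ_mu]
  have := star_C_left_of_affine S.dμ S.dw (x := S.lin i) (fun k j => by rw [h, S.dμ_proj]) P
  simpa only [h] using this

theorem starZ_zeta_left (i : ι) (P : Z⟦X⟧) : S.starZ (C (S.zeta i)) P =
    C (S.zeta i) * P + X * coeffMap (S.dz i : Z →ₗ[ℂ] Z) P := by
  have h2 : ∀ k j, S.dζ k (S.dζ j (S.zeta i)) = 0 := fun k j => by
    rw [S.dζ_zeta]; split_ifs <;> simp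
  have := star_C_left_of_affine S.dζ S.dz (x := S.zeta i) h2 P
  rw [starZ, this]
  congr 2
  simp only [S.dζ_zeta]
  rw [Finset.sum_eq_single i]
  · simp
  · intro j _ hj; simp [hj]
  · simp

/-- Multiplicativity when the left factor is ζᵢ. Here ζᵢ ∘ P = ζᵢP + t∂_{zᵢ}P, and ∂_{zᵢ} is
compared with the w-derivatives of the pulled-back amplitude by the chain rule. -/
theorem pull_zeta_star (i : ι) (P : Z⟦X⟧) :
    S.pull (S.starZ (C (S.zeta i)) P) = S.starO (C (S.lin i)) (S.pull P) := by
  refine (S.isXLinear_pull.comp (isXLinear_star_right _ _ _)).ext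
    ((isXLinear_star_right _ _ _).comp S.isXLinear_pull) (fun f => ?_) P
  change S.pull (S.starZ _ _) = S.starO _ _
  rw [starZ_zeta_left, starO_lin_left, S.isXLinear_pull.map_add, S.isXLinear_pull.map_X_mul,
    ← map_mul, coeffMap_C, pull_C, pull_C, pull_C, exp_subst_zeta_mul]
  simp only [← exp_Dw, ← exp_incl_mul, ← exp_sum]
  rw [S.grad_Dw_subst, exp_add, mul_add]
  -- The chain-rule terms coming from the w-dependence of J account exactly for the difference
  -- between ∂wₖ/∂zᵢ at Φ(w) + z' and at Φ(w).
  have h1 : X * S.exp (∑ j, (∑ k, S.incl (S.proj (S.grad k i)) *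
      S.Dw k (∑ m, S.jac m j * S.incl (S.mu m))) * S.subst (S.dζ j f)) =
      S.exp ((∑ k, S.incl (S.mu k) * (S.shift (S.grad k i) - S.incl (S.proj (S.grad k i)))) *
        S.subst f) := by
    have h2 : ∑ k, S.incl (S.mu k) * (S.shift (S.grad k i) - S.incl (S.proj (S.grad k i))) =
        ∑ j, S.zc j * (∑ k, S.incl (S.proj (S.grad k i)) *
          S.Dw k (∑ m, S.jac m j * S.incl (S.mu m))) := by
      -- The identity `sum_zc_jac` differentiated along ∂/∂zᵢ = ∑ₖ (∂wₖ/∂zᵢ)∂_{wₖ}, with z' held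
      -- fixed.
      have h3 : ∀ m, S.shift (S.grad m i) - S.incl (S.proj (S.grad m i)) =
          ∑ j, S.zc j * ∑ k, S.incl (S.proj (S.grad k i)) * S.Dw k (S.jac m j) := by
        intro m
        have h4 : ∑ k, S.incl (S.proj (S.grad k i)) * S.Dw k (S.incl (S.proj (S.wc m))) =
            S.incl (S.proj (S.grad m i)) := by
          rw [Finset.sum_eq_single m]
          · simp [S.Dw_incl, S.dw_wc]
          · intro k _ hk; simp [S.Dw_incl, S.dw_wc, hk]
          · simp
        rw [← S.grad_Dw_shift_wc, ← h4, ← Finset.sum_sub_distrib]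
        simp only [← mul_sub, ← map_sub (S.Dw _), ← S.sum_zc_jac, map_sum, Derivation.leibniz,
          S.Dw_zc, smul_eq_mul, mul_zero, add_zero, Finset.mul_sum]
        rw [Finset.sum_comm]
        exact Finset.sum_congr rfl fun k _ => Finset.sum_congr rfl fun j _ => by ring
      simp only [h3, map_sum, Derivation.leibniz, S.Dw_incl, S.dw_mu, map_zero, smul_eq_mul,
        mul_zero, zero_add, Finset.mul_sum]
      rw [Finset.sum_comm]
      refine Finset.sum_congr rfl fun j _ => ?_
      rw [Finset.sum_comm]
      exact Finset.sum_congr rfl fun k _ => Finset.sum_congr rfl fun m _ => by ring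
    rw [h2, Finset.sum_mul, exp_sum, exp_sum, Finset.mul_sum]
    refine Finset.sum_congr rfl fun j _ => ?_
    rw [mul_assoc, exp_zc_mul]
    have h5 : S.Dζ j (∑ k, S.incl (S.proj (S.grad k i)) *
        S.Dw k (∑ m, S.jac m j * S.incl (S.mu m))) = 0 := by
      simp [S.Dζ_incl, S.Dζ_jac, ← S.Dw_Dζ, S.Dw_incl]
    rw [Derivation.leibniz, h5, S.Dζ_subst]
    simp
  rw [h1, add_comm (X * _), ← add_assoc, ← exp_add]
  congr 2
  rw [lin, map_sum, ← add_mul]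
  simp only [Finset.sum_mul, ← Finset.sum_add_distrib, map_mul]
  exact Finset.sum_congr rfl fun k _ => by ring

theorem pull_one : S.pull 1 = 1 := by
  rw [← map_one C, pull_C, map_one, ← map_one S.incl, exp_incl, map_one]

theorem pull_C_mul {u : Z} {v : O} (huv : S.subst u = S.incl v) (P : Z⟦X⟧) :
    S.pull (C u * P) = C v * S.pull P := by
  refine (S.isXLinear_pull.comp (IsXLinear.id.mul_left _)).ext
    (S.isXLinear_pull.mul_left _) (fun f => ?_) P
  rw [← map_mul, pull_C, pull_C, map_mul, huv, exp_incl_mul]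

/-- The defect of multiplicativity of the pull-back. -/
noncomputable def defect (Q P : Z⟦X⟧) : O⟦X⟧ :=
  S.starO (S.pull Q) (S.pull P) - S.pull (S.starZ Q P)

theorem isXLinear_defect_left (P : Z⟦X⟧) : IsXLinear fun Q => S.defect Q P :=
  ((isXLinear_star_left _ _ (S.pull P)).comp S.isXLinear_pull).sub
    (S.isXLinear_pull.comp (isXLinear_star_left _ _ P))

theorem isXLinear_defect_right (Q : Z⟦X⟧) : IsXLinear fun P => S.defect Q P :=
  ((isXLinear_star_right _ _ (S.pull Q)).comp S.isXLinear_pull).sub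
    (S.isXLinear_pull.comp (isXLinear_star_right _ _ Q))

theorem defect_C_mul {u : Z} {v : O} (huv : S.subst u = S.incl v) (hu : ∀ i, S.dζ i u = 0)
    (hv : ∀ i, S.dμ i v = 0) (Q P : Z⟦X⟧) : S.defect (C u * Q) P = C v * S.defect Q P := by
  have h1 := star_C_mul_left S.dζ S.dz hu Q P
  have h2 := star_C_mul_left S.dμ S.dw hv (S.pull Q) (S.pull P)
  rw [defect, pull_C_mul S huv, starZ, starO, h1, h2, pull_C_mul S huv, defect, mul_sub]

theorem defect_one (P : Z⟦X⟧) : S.defect 1 P = 0 := by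
  rw [defect, pull_one, starO, starZ, star_one_left, star_one_left, sub_self]

theorem defect_algebraMap (c : ℂ) (P : Z⟦X⟧) : S.defect (C (algebraMap ℂ Z c)) P = 0 := by
  rw [← mul_one (C _), S.defect_C_mul (v := algebraMap ℂ O c) (by simp) (by simp) (by simp),
    defect_one, mul_zero]

theorem starZ_zeta_right (i : ι) (c : ℂ) (P : Z⟦X⟧) :
    S.starZ P (C (S.zeta i - algebraMap ℂ Z c)) = P * C (S.zeta i - algebraMap ℂ Z c) :=
  star_C_right_of_const _ _ (fun k => by simp [S.dz_zeta]) P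

theorem starO_right_sub_algebraMap (P : O⟦X⟧) (x : O) (c : ℂ) :
    S.starO P (C (x - algebraMap ℂ O c)) = S.starO P (C x) - P * C (algebraMap ℂ O c) := by
  rw [map_sub]
  refine ((isXLinear_star_right _ _ P).map_sub _ _).trans (congrArg _ ?_)
  exact star_C_right_of_const _ _ (by simp) P

/-- Since ζᵢ − c can be put as a right factor of Q, associativity carries it over to P; exchanging
it with P costs the commutator t∂_{zᵢ}P. -/
theorem defect_zeta (hkrull : ∀ x : O, (∀ M, x ∈ 𝔪 ^ M) → x = 0) {w₀ : ι → ℂ}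
    (hw₀ : ∀ k, S.proj (S.wc k - algebraMap ℂ A (w₀ k)) ∈ 𝔪)
    (hA : ∀ b : A, ∃ (c : ℂ) (b' : ι → A),
      b = algebraMap ℂ A c + ∑ k, (S.wc k - algebraMap ℂ A (w₀ k)) * b' k)
    (i : ι) (c : ℂ) (Q P : Z⟦X⟧) :
    S.defect (C (S.zeta i - algebraMap ℂ Z c) * Q) P =
      S.starO (S.defect Q P) (C (S.lin i - algebraMap ℂ O c)) +
        X * S.defect Q (coeffMap (S.dz i : Z →ₗ[ℂ] Z) P) := by
  have hsub : S.subst (algebraMap ℂ Z c) = S.incl (algebraMap ℂ O c) := by simp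
  have hR : ∀ Q, S.pull (S.starZ Q (C (S.zeta i - algebraMap ℂ Z c))) =
      S.starO (S.pull Q) (C (S.lin i - algebraMap ℂ O c)) := by
    intro Q
    rw [starZ_zeta_right, starO_right_sub_algebraMap, ← S.pull_mul_zeta hkrull hw₀ hA, map_sub,
      mul_sub, S.isXLinear_pull.map_sub, mul_comm Q (C (algebraMap ℂ Z c)), S.pull_C_mul hsub,
      mul_comm (S.pull Q)]
  have hL : ∀ P, S.pull (S.starZ (C (S.zeta i - algebraMap ℂ Z c)) P) =
      S.starO (C (S.lin i - algebraMap ℂ O c)) (S.pull P) := by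
    intro P
    have e1 : S.starZ (C (S.zeta i - algebraMap ℂ Z c)) P =
        S.starZ (C (S.zeta i)) P - C (algebraMap ℂ Z c) * P := by
      rw [map_sub]
      refine ((isXLinear_star_left _ _ P).map_sub _ _).trans (congrArg _ ?_)
      exact star_C_left_of_const _ _ (by simp) P
    have e2 : S.starO (C (S.lin i - algebraMap ℂ O c)) (S.pull P) =
        S.starO (C (S.lin i)) (S.pull P) - C (algebraMap ℂ O c) * S.pull P := by
      rw [map_sub]
      refine ((isXLinear_star_left _ _ _).map_sub _ _).trans (congrArg _ ?_)
      exact star_C_left_of_const _ _ (by simp) _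
    rw [e1, e2, S.isXLinear_pull.map_sub, S.pull_C_mul hsub, pull_zeta_star]
  have hZL : S.starZ (C (S.zeta i - algebraMap ℂ Z c)) P =
      S.starZ P (C (S.zeta i - algebraMap ℂ Z c)) + X * coeffMap (S.dz i : Z →ₗ[ℂ] Z) P := by
    have e1 : S.starZ (C (S.zeta i - algebraMap ℂ Z c)) P =
        S.starZ (C (S.zeta i)) P - C (algebraMap ℂ Z c) * P := by
      rw [map_sub]
      refine ((isXLinear_star_left _ _ P).map_sub _ _).trans (congrArg _ ?_)
      exact star_C_left_of_const _ _ (by simp) P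
    rw [e1, starZ_zeta_left, starZ_zeta_right, map_sub]
    ring
  rw [mul_comm, ← starZ_zeta_right]
  -- Both terms of the defect are reassociated; `hR` and `hL` let the pull-back pass through the
  -- products with ζᵢ − c on either side.
  have step : S.defect (S.starZ Q (C (S.zeta i - algebraMap ℂ Z c))) P =
      S.defect Q (S.starZ (C (S.zeta i - algebraMap ℂ Z c)) P) := by
    rw [defect, defect, hR, hL, starO_assoc, starZ_assoc]
  rw [step, hZL, (S.isXLinear_defect_right Q).map_add, (S.isXLinear_defect_right Q).map_X_mul]
  congr 1
  rw [defect, hR, starO_assoc, starZ_assoc, hR]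
  exact ((isXLinear_star_left _ _ _).map_sub _ _).symm

/-- Multiplicativity of the pull-back. -/
theorem pull_star (hkrull : ∀ x : O, (∀ M, x ∈ 𝔪 ^ M) → x = 0) {w₀ : ι → ℂ}
    (hw₀ : ∀ k, S.proj (S.wc k - algebraMap ℂ A (w₀ k)) ∈ 𝔪)
    (hA : ∀ b : A, ∃ (c : ℂ) (b' : ι → A),
      b = algebraMap ℂ A c + ∑ k, (S.wc k - algebraMap ℂ A (w₀ k)) * b' k)
    {κ : Type*} [Fintype κ] {u : κ → Z} {v : κ → O} {ζ₀ : ι → ℂ}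
    (hu : ∀ i s, S.dζ i (u s) = 0) (hv : ∀ i s, S.dμ i (v s) = 0)
    (huv : ∀ s, S.subst (u s) = S.incl (v s)) (hvm : ∀ s, v s ∈ 𝔪)
    (hlin : ∀ i, S.lin i - algebraMap ℂ O (ζ₀ i) ∈ 𝔪)
    (hZ : ∀ f : Z, ∃ (c : ℂ) (f₁ : κ → Z) (f₂ : ι → Z), f = algebraMap ℂ Z c +
      ∑ s, u s * f₁ s + ∑ i, (S.zeta i - algebraMap ℂ Z (ζ₀ i)) * f₂ i)
    (Q P : Z⟦X⟧) : S.starO (S.pull Q) (S.pull P) = S.pull (S.starZ Q P) := by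
  -- Induction on the degree in X, then on the power of 𝔪, for all Q and P at once. The part of Q
  -- divisible by X is already settled; its constant term is expanded at the base point.
  have main : ∀ N (Q P : Z⟦X⟧), coeff N (S.defect Q P) = 0 := by
    intro N
    induction N using Nat.strong_induction_on with
    | _ N ih =>
      intro Q P
      refine hkrull _ fun M => ?_
      induction M generalizing Q P with
      | zero => simp
      | succ M ihM =>
        have hX : ∀ Q P, coeff N (X * S.defect Q P) = 0 := by
          intro Q P
          cases N with
          | zero => simp
          | succ N => rw [coeff_succ_X_mul]; exact ih N N.lt_succ_self Q P
        have hadd := (S.isXLinear_defect_left P).map_add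
        obtain ⟨c, f₁, f₂, hf⟩ := hZ (constantCoeff Q)
        rw [eq_X_mul_shift_add_const Q, hadd, (S.isXLinear_defect_left P).map_X_mul, map_add, hX,
          zero_add, hf, map_add, map_add, hadd, hadd, defect_algebraMap, zero_add, map_sum, map_sum,
          (S.isXLinear_defect_left P).map_sum, (S.isXLinear_defect_left P).map_sum, map_add,
          map_sum, map_sum]
        refine Ideal.add_mem _ (Ideal.sum_mem _ fun s _ => ?_) (Ideal.sum_mem _ fun i _ => ?_)
        · rw [map_mul, S.defect_C_mul (huv s) (hu · s) (hv · s), coeff_C_mul, pow_succ']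
          exact Ideal.mul_mem_mul (hvm s) (ihM _ _)
        -- By the outer induction the coefficients of the defect below N vanish, so the star product
        -- with `lin i` − ζ₀ᵢ is, in degree N, an ordinary product with an element of 𝔪.
        · rw [map_mul, S.defect_zeta hkrull hw₀ hA, map_add, hX, add_zero,
            coeff_star_of_coeff_eq_zero _ _ N (fun k hk => ih k hk _ _), coeff_zero_C, pow_succ]
          exact Ideal.mul_mem_mul (ihM _ _) (hlin i)
  exact sub_eq_zero.1 (PowerSeries.ext fun N => main N Q P)

end PullbackModel

end Model

theorem Hol.deriv_mk_of_affine {V : Type*} [NormedAddCommGroup V] [NormedSpace ℂ V] {p v : V}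
    {f : V → ℂ} (hf : AnalyticAt ℂ f p) {c : ℂ} (hv : ∀ x (s : ℂ), f (x + s • v) = f x + s * c) :
    Hol.deriv p v (Hol.mk f hf) = algebraMap ℂ _ c := by
  rw [Hol.deriv_mk, Hol.algebraMap_eq, Hol.mk_eq_mk]
  filter_upwards [hf.eventually_analyticAt] with x hx
  rw [← hx.differentiableAt.lineDeriv_eq_fderiv]
  have h : HasDerivAt (fun s : ℂ => f (x + s • v)) c 0 := by
    simp only [hv]
    simpa using ((hasDerivAt_id (0 : ℂ)).mul_const c).const_add (f x)
  exact h.deriv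

theorem Hol.mk_congr {V : Type*} [NormedAddCommGroup V] [NormedSpace ℂ V] {p : V}
    {f g : V → ℂ} {hf : AnalyticAt ℂ f p} {hg : AnalyticAt ℂ g p} (h : ∀ x, f x = g x) :
    Hol.mk f hf = Hol.mk g hg := Hol.mk_eq_mk.2 (Eventually.of_forall h)

/-! ### Coordinates on the phase space -/

section Coordinates

variable {n : ℕ}

theorem sum_proj_smul_single (x : E n) :
    ∑ k, (ContinuousLinearMap.proj (R := ℂ) (φ := fun _ : Fin n => ℂ) k) x •
      (Pi.single k 1 : E n) = x := by
  ext j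
  simp [Finset.sum_apply, Pi.single_apply]

/-- The coordinate vectors of the phase space. -/
def phaseBasis (n : ℕ) : Fin n ⊕ Fin n ⊕ Unit → Phase n
  | .inl i => (Pi.single i 1, 0, 0)
  | .inr (.inl i) => (0, Pi.single i 1, 0)
  | .inr (.inr _) => (0, 0, 1)

/-- The coordinate functions of the phase space. -/
noncomputable def phaseCoord (n : ℕ) : Fin n ⊕ Fin n ⊕ Unit → (Phase n →L[ℂ] ℂ)
  | .inl i => (ContinuousLinearMap.proj (R := ℂ) (φ := fun _ : Fin n => ℂ) i).comp
      (ContinuousLinearMap.fst ℂ (E n) (E n × ℂ))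
  | .inr (.inl i) => (ContinuousLinearMap.proj (R := ℂ) (φ := fun _ : Fin n => ℂ) i).comp
      ((ContinuousLinearMap.fst ℂ (E n) ℂ).comp (ContinuousLinearMap.snd ℂ (E n) (E n × ℂ)))
  | .inr (.inr _) => (ContinuousLinearMap.snd ℂ (E n) ℂ).comp
      (ContinuousLinearMap.snd ℂ (E n) (E n × ℂ))

theorem sum_phaseCoord_smul (x : Phase n) : ∑ k, phaseCoord n k x • phaseBasis n k = x := by
  obtain ⟨z, ζ, η⟩ := x
  rw [Fintype.sum_sum_type, Fintype.sum_sum_type]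
  refine Prod.ext ?_ (Prod.ext ?_ ?_)
  · simpa [phaseCoord, phaseBasis, Prod.fst_sum, Prod.snd_sum] using sum_proj_smul_single z
  · simpa [phaseCoord, phaseBasis, Prod.fst_sum, Prod.snd_sum] using sum_proj_smul_single ζ
  · simp [phaseCoord, phaseBasis, Prod.snd_sum]

end Coordinates

/-! ### The pull-back on germs -/

section PullbackGerm

variable {n : ℕ} {Φ : OpenPartialHomeomorph (E n) (E n)} {J : E n → E n → Matrix (Fin n) (Fin n) ℂ}

/-- The point with coordinates `(z, ζ, η)` corresponding to `(w, μ, η)`. -/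
noncomputable def imagePoint (Φ : OpenPartialHomeomorph (E n) (E n))
    (J : E n → E n → Matrix (Fin n) (Fin n) ℂ) (q : Phase n) : Phase n :=
  (Φ q.1, (J (Φ q.1) (Φ q.1)).transpose.mulVec q.2.1, q.2.2)

/-- The map `(w, μ, η, z', ζ') ↦ Φ(w) + z'`. -/
noncomputable def shiftMap (Φ : OpenPartialHomeomorph (E n) (E n)) (y : Phase n × E n × E n) : E n :=
  Φ y.1.1 + y.2.1

/-- The map `(w, μ, η, z', ζ') ↦ (Φ(w) + z', Φ(w))`. -/
noncomputable def pairMap (Φ : OpenPartialHomeomorph (E n) (E n)) (y : Phase n × E n × E n) :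
    E n × E n :=
  (Φ y.1.1 + y.2.1, Φ y.1.1)

/-- The map `(w, μ, η, z', ζ') ↦ (Φ(w), ζ' + ᵗJ(Φ(w) + z', Φ(w)) μ, η)`. -/
noncomputable def substMap (Φ : OpenPartialHomeomorph (E n) (E n))
    (J : E n → E n → Matrix (Fin n) (Fin n) ℂ) (y : Phase n × E n × E n) : Phase n :=
  (Φ y.1.1, y.2.2 + (J (Φ y.1.1 + y.2.1) (Φ y.1.1)).transpose.mulVec y.1.2.1, y.1.2.2)

variable {q : Phase n}

theorem analyticAt_base (hΦ : IsBiholomorphic Φ) (hq : q.1 ∈ Φ.source) :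
    AnalyticAt ℂ (fun y : Phase n × E n × E n => Φ y.1.1) (q, 0, 0) :=
  (hΦ.1 _ hq).comp_of_eq (f := fun y : Phase n × E n × E n => y.1.1)
    (analyticAt_of_contDiff (by fun_prop)) rfl

theorem analyticAt_shiftMap (hΦ : IsBiholomorphic Φ) (hq : q.1 ∈ Φ.source) :
    AnalyticAt ℂ (shiftMap Φ) (q, 0, 0) :=
  (analyticAt_base hΦ hq).add (analyticAt_of_contDiff (f := fun y : Phase n × E n × E n => y.2.1)
    (by fun_prop))

theorem shiftMap_base : shiftMap Φ (q, 0, 0) = Φ q.1 := add_zero _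

theorem analyticAt_pairMap (hΦ : IsBiholomorphic Φ) (hq : q.1 ∈ Φ.source) :
    AnalyticAt ℂ (pairMap Φ) (q, 0, 0) :=
  (analyticAt_shiftMap hΦ hq).prod (analyticAt_base hΦ hq)

theorem pairMap_base : pairMap Φ (q, 0, 0) = (Φ q.1, Φ q.1) := Prod.ext (add_zero _) rfl

theorem analyticAt_jac (hΦ : IsBiholomorphic Φ) (hJ : IsJStar Φ J) (hq : q.1 ∈ Φ.source)
    (k j : Fin n) : AnalyticAt ℂ (fun y => J (pairMap Φ y).1 (pairMap Φ y).2 k j) (q, 0, 0) :=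
  ((hJ _ (Φ.map_source hq)).1 k j).comp_of_eq (analyticAt_pairMap hΦ hq) pairMap_base

theorem substMap_base : substMap Φ J (q, 0, 0) = imagePoint Φ J q := by
  simp [substMap, imagePoint]

theorem transpose_mulVec_apply (M : Matrix (Fin n) (Fin n) ℂ) (x : E n) (j : Fin n) :
    M.transpose.mulVec x j = ∑ k, M k j * x k := rfl

theorem analyticAt_muCoord (k : Fin n) : AnalyticAt ℂ (fun x : Phase n => x.2.1 k) q :=
  analyticAt_of_contDiff (by fun_prop)

theorem analyticAt_substMap (hΦ : IsBiholomorphic Φ) (hJ : IsJStar Φ J) (hq : q.1 ∈ Φ.source) :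
    AnalyticAt ℂ (substMap Φ J) (q, 0, 0) := by
  refine (analyticAt_base hΦ hq).prod (AnalyticAt.prod ?_ ?_)
  · refine (analyticAt_of_contDiff (f := fun y : Phase n × E n × E n => y.2.2)
      (by fun_prop)).add (AnalyticAt.pi fun j => ?_)
    simp only [transpose_mulVec_apply]
    exact Finset.analyticAt_fun_sum _ fun k _ => (analyticAt_jac hΦ hJ hq k j).mul
      (analyticAt_of_contDiff (by fun_prop))
  · exact analyticAt_of_contDiff (f := fun y : Phase n × E n × E n => y.1.2.2) (by fun_prop)

theorem analyticAt_symm_shiftMap (hΦ : IsBiholomorphic Φ) (hq : q.1 ∈ Φ.source) :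
    AnalyticAt ℂ (fun y => Φ.symm (shiftMap Φ y)) (q, 0, 0) :=
  (hΦ.2 _ (Φ.map_source hq)).comp_of_eq (analyticAt_shiftMap hΦ hq) shiftMap_base

theorem symm_shiftMap_base (hq : q.1 ∈ Φ.source) : Φ.symm (shiftMap Φ (q, 0, 0)) = q.1 := by
  rw [shiftMap_base, Φ.left_inv hq]

theorem analyticAt_coord (w : E n) (k : Fin n) : AnalyticAt ℂ (fun x : E n => x k) w :=
  analyticAt_of_contDiff (by fun_prop)

theorem analyticAt_symm_coord (hΦ : IsBiholomorphic Φ) {w : E n} (hw : w ∈ Φ.source) (k : Fin n) :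
    AnalyticAt ℂ (fun z => Φ.symm z k) (Φ w) :=
  (analyticAt_coord _ k).comp_of_eq (hΦ.2 _ (Φ.map_source hw)) rfl

/-- The germ of `∂wₖ/∂zᵢ` as a function of `w`. -/
noncomputable def gradGerm (hΦ : IsBiholomorphic Φ) {w : E n} (hw : w ∈ Φ.source) (k i : Fin n) :
    Hol w :=
  Hol.comap Φ (hΦ.1 _ hw) rfl
    (Hol.deriv (Φ w) (Pi.single i 1) (Hol.mk _ (analyticAt_symm_coord hΦ hw k)))

/-- The Jacobian matrices of Φ⁻¹ and Φ are inverse to each other: the chain rule applied to zⱼ = zⱼ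
∘ Φ ∘ Φ⁻¹, then composed with Φ. -/
theorem sum_gradGerm_mul (hΦ : IsBiholomorphic Φ) {w : E n} (hw : w ∈ Φ.source) (i j : Fin n) :
    ∑ k, gradGerm hΦ hw k i * Hol.deriv w (Pi.single k 1)
      (Hol.comap Φ (hΦ.1 _ hw) rfl (Hol.mk (fun z : E n => z j) (analyticAt_coord _ j))) =
      if i = j then 1 else 0 := by
  have hs : Φ.symm (Φ w) = w := Φ.left_inv hw
  have hsa := hΦ.2 _ (Φ.map_source hw)
  set zj : Hol (Φ w) := Hol.mk (fun z : E n => z j) (analyticAt_coord _ j) with hzj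
  have h1 : Hol.comap Φ.symm hsa hs (Hol.comap Φ (hΦ.1 _ hw) rfl zj) = zj := by
    rw [Hol.comap_comap]
    refine Hol.comap_id _ _ _ ?_ _
    filter_upwards [Φ.open_target.mem_nhds (Φ.map_source hw)] with z hz using Φ.right_inv hz
  have h2 := Hol.deriv_comap sum_proj_smul_single hsa hs (Pi.single i 1)
    (Hol.comap Φ (hΦ.1 _ hw) rfl zj)
  rw [h1] at h2
  have h3 := congrArg (Hol.comap Φ (hΦ.1 _ hw) rfl) h2
  have h4 : Hol.deriv (Φ w) (Pi.single i 1) zj = algebraMap ℂ _ (if i = j then 1 else 0) :=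
    Hol.deriv_mk_of_affine _ fun x s => by
      simp [Pi.single_apply, eq_comm]
  rw [h4, AlgHom.commutes, map_sum] at h3
  rw [show (if i = j then (1 : Hol w) else 0) = algebraMap ℂ _ (if i = j then 1 else 0) by
    split_ifs <;> simp, h3]
  refine Finset.sum_congr rfl fun k _ => ?_
  rw [map_mul, Hol.comap_comap]
  refine congrArg₂ _ rfl (Hol.comap_id _ _ _ ?_ _).symm
  filter_upwards [Φ.open_source.mem_nhds hw] with x hx using Φ.left_inv hx

variable (q) in
/-- The derivations in the variables `w`, `μ`, `z'`, `ζ'`. -/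
noncomputable abbrev bigDeriv (v : Phase n × E n × E n) :
    Derivation ℂ (Hol (q, (0 : E n), (0 : E n))) (Hol (q, (0 : E n), (0 : E n))) :=
  Hol.deriv (q, 0, 0) v

variable (q) in
/-- Functions of `(w, μ, η)` as functions of all variables. -/
noncomputable abbrev inclHom : Hol q →ₐ[ℂ] Hol (q, (0 : E n), (0 : E n)) :=
  Hol.comap Prod.fst analyticAt_fst rfl

variable (q) in
/-- Functions of `w` as functions of `(w, μ, η)`. -/
noncomputable abbrev projHom : Hol q.1 →ₐ[ℂ] Hol q :=
  Hol.comap Prod.fst analyticAt_fst rfl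

variable (q) in
/-- Restriction to `z' = 0`, `ζ' = 0`. -/
noncomputable abbrev restrHom : Hol (q, (0 : E n), (0 : E n)) →ₐ[ℂ] Hol q :=
  Hol.comap (fun x => (x, 0, 0)) (analyticAt_zero_section q) rfl

/-- Composition with `Φ(w) + z'`. -/
noncomputable abbrev targetShiftHom (hΦ : IsBiholomorphic Φ) (hq : q.1 ∈ Φ.source) :
    Hol (Φ q.1) →ₐ[ℂ] Hol (q, (0 : E n), (0 : E n)) :=
  Hol.comap (shiftMap Φ) (analyticAt_shiftMap hΦ hq) shiftMap_base

/-- Composition with `Φ⁻¹(Φ(w) + z')`. -/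
noncomputable abbrev shiftHom (hΦ : IsBiholomorphic Φ) (hq : q.1 ∈ Φ.source) :
    Hol q.1 →ₐ[ℂ] Hol (q, (0 : E n), (0 : E n)) :=
  Hol.comap (fun y => Φ.symm (shiftMap Φ y)) (analyticAt_symm_shiftMap hΦ hq)
    (symm_shiftMap_base hq)

/-- Composition with `(Φ(w), ζ' + ᵗJ(Φ(w) + z', Φ(w)) μ, η)`. -/
noncomputable abbrev substHom (hΦ : IsBiholomorphic Φ) (hJ : IsJStar Φ J) (hq : q.1 ∈ Φ.source) :
    Hol (imagePoint Φ J q) →ₐ[ℂ] Hol (q, (0 : E n), (0 : E n)) :=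
  Hol.comap (substMap Φ J) (analyticAt_substMap hΦ hJ hq) substMap_base

/-- The germ of the matrix `J(Φ(w) + z', Φ(w))`. -/
noncomputable def jacGerm (hΦ : IsBiholomorphic Φ) (hJ : IsJStar Φ J) (hq : q.1 ∈ Φ.source)
    (k j : Fin n) : Hol (q, (0 : E n), (0 : E n)) :=
  Hol.comap (pairMap Φ) (analyticAt_pairMap hΦ hq) pairMap_base
    (Hol.mk _ ((hJ _ (Φ.map_source hq)).1 k j))

variable (q) in
/-- The germ of the coordinate `μₖ`. -/
noncomputable def muGerm (k : Fin n) : Hol q := Hol.mk _ (analyticAt_muCoord k)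

variable (q) in
/-- The germ of the coordinate `z'ₖ`. -/
noncomputable def zGerm (k : Fin n) : Hol (q, (0 : E n), (0 : E n)) :=
  Hol.mk (fun y => y.2.1 k) (analyticAt_of_contDiff (by fun_prop))

variable (q) in
/-- The germ of the coordinate `ζ'ₖ`. -/
noncomputable def zetaGerm (k : Fin n) : Hol (q, (0 : E n), (0 : E n)) :=
  Hol.mk (fun y => y.2.2 k) (analyticAt_of_contDiff (by fun_prop))

theorem shiftHom_comap (hΦ : IsBiholomorphic Φ) (hq : q.1 ∈ Φ.source) (x : Hol (Φ q.1)) :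
    shiftHom hΦ hq (Hol.comap Φ (hΦ.1 _ hq) rfl x) = targetShiftHom hΦ hq x := by
  rw [Hol.comap_comap]
  refine Hol.comap_congr _ _ _ _ _ _ ?_ x
  have ht : Tendsto (shiftMap Φ) (𝓝 (q, 0, 0)) (𝓝 (Φ q.1)) := by
    have := (analyticAt_shiftMap hΦ hq).continuousAt.tendsto
    rwa [shiftMap_base] at this
  filter_upwards [ht.eventually (Φ.open_target.mem_nhds (Φ.map_source hq))] with y hy
    using Φ.right_inv hy

theorem sum_zGerm_mul_jacGerm (hΦ : IsBiholomorphic Φ) (hJ : IsJStar Φ J) (hq : q.1 ∈ Φ.source)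
    (k : Fin n) : ∑ j, zGerm q j * jacGerm hΦ hJ hq k j =
      shiftHom hΦ hq (Hol.mk (fun w : E n => w k) (analyticAt_coord _ k)) -
        inclHom q (projHom q (Hol.mk (fun w : E n => w k) (analyticAt_coord _ k))) := by
  have h1 : ∀ j, zGerm q j * jacGerm hΦ hJ hq k j = Hol.mk (fun y : Phase n × E n × E n =>
      y.2.1 j * J (pairMap Φ y).1 (pairMap Φ y).2 k j)
      (AnalyticAt.mul (analyticAt_of_contDiff (by fun_prop)) (analyticAt_jac hΦ hJ hq k j)) :=
    fun j => rfl
  have h2 : ∀ j, AnalyticAt ℂ (fun y : Phase n × E n × E n =>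
      y.2.1 j * J (pairMap Φ y).1 (pairMap Φ y).2 k j) (q, 0, 0) := fun j =>
    AnalyticAt.mul (analyticAt_of_contDiff (by fun_prop)) (analyticAt_jac hΦ hJ hq k j)
  simp only [h1]
  refine (Hol.mk_sum Finset.univ h2).trans ?_
  rw [Hol.comap_mk, Hol.comap_mk, Hol.comap_mk, Hol.mk_sub, Hol.mk_eq_mk]
  have ht : Tendsto (pairMap Φ) (𝓝 (q, 0, 0)) (𝓝 (Φ q.1, Φ q.1)) := by
    have := (analyticAt_pairMap hΦ hq).continuousAt.tendsto
    rwa [pairMap_base] at this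
  have ht' : Tendsto (fun y : Phase n × E n × E n => y.1.1) (𝓝 (q, 0, 0)) (𝓝 q.1) :=
    Continuous.tendsto (by fun_prop) (q, (0 : E n), (0 : E n))
  filter_upwards [ht.eventually (hJ _ (Φ.map_source hq)).2,
    ht'.eventually (Φ.open_source.mem_nhds hq)] with y hy hy'
  have h3 := congrFun hy k
  simp only [pairMap, add_sub_cancel_left, Pi.sub_apply, Φ.left_inv hy'] at h3
  simp only [shiftMap, h3, Matrix.mulVec, dotProduct, pairMap]
  exact Finset.sum_congr rfl fun j _ => mul_comm _ _

/-- The chain rule for `substMap`; a direction that does not move η leaves only the z and ζ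
components. -/
theorem deriv_substHom (hΦ : IsBiholomorphic Φ) (hJ : IsJStar Φ J) (hq : q.1 ∈ Φ.source)
    (v : Phase n × E n × E n) (hv : v.1.2.2 = 0) (f : Hol (imagePoint Φ J q)) :
    bigDeriv q v (substHom hΦ hJ hq f) =
      ∑ j, bigDeriv q v (inclHom q (projHom q (Hol.comap Φ (hΦ.1 _ hq) rfl
        (Hol.mk (fun z : E n => z j) (analyticAt_coord _ j))))) *
          substHom hΦ hJ hq (derivZ _ j f) +
      ∑ j, bigDeriv q v (zetaGerm q j + ∑ k, jacGerm hΦ hJ hq k j * inclHom q (muGerm q k)) *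
        substHom hΦ hJ hq (derivZeta _ j f) := by
  have h0 := Hol.deriv_comap sum_phaseCoord_smul (analyticAt_substMap hΦ hJ hq) substMap_base v f
  rw [Fintype.sum_sum_type, Fintype.sum_sum_type] at h0
  have h3 : Hol.deriv (q, 0, 0) v (Hol.comap (substMap Φ J) (analyticAt_substMap hΦ hJ hq)
      substMap_base (Hol.mk (phaseCoord n (.inr (.inr ())))
        ((phaseCoord n (.inr (.inr ()))).analyticAt _))) = 0 := by
    refine Eq.trans ?_ (map_zero (algebraMap ℂ (Hol (q, (0 : E n), (0 : E n)))))
    exact Hol.deriv_mk_of_affine _ fun x s => by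
      change (x + s • v).1.2.2 = x.1.2.2 + s * 0
      simp [hv]
  have h2 : ∀ j, Hol.comap (substMap Φ J) (analyticAt_substMap hΦ hJ hq)
      substMap_base (Hol.mk (phaseCoord n (.inr (.inl j)))
        ((phaseCoord n (.inr (.inl j))).analyticAt _)) =
      zetaGerm q j + ∑ k, jacGerm hΦ hJ hq k j * inclHom q (muGerm q k) := by
    intro j
    have h4 : ∀ k, AnalyticAt ℂ (fun y : Phase n × E n × E n =>
        J (pairMap Φ y).1 (pairMap Φ y).2 k j * y.1.2.1 k) (q, 0, 0) := fun k =>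
      (analyticAt_jac hΦ hJ hq k j).mul (analyticAt_of_contDiff (by fun_prop))
    refine Eq.trans ?_ (congrArg (zetaGerm q j + ·) (Hol.mk_sum Finset.univ h4).symm)
    exact Hol.mk_congr fun y => rfl
  simp only [h2, Finset.univ_unique, Finset.sum_singleton, PUnit.default_eq_unit, h3, zero_mul,
    add_zero] at h0
  exact h0

variable (q) in
theorem bigDeriv_incl (v : Phase n) (f : Hol q) :
    bigDeriv q (v, 0, 0) (inclHom q f) = inclHom q (Hol.deriv q v f) :=
  Hol.deriv_comap_of_affine _ _ (fun y s => by simp) f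

variable (q) in
theorem bigDeriv_zetaGerm (v : Phase n × E n × E n) (hv : v.2.2 = 0) (k : Fin n) :
    bigDeriv q v (zetaGerm q k) = 0 := by
  rw [zetaGerm, Hol.deriv_mk_of_affine (c := 0), map_zero]
  intro x s; simp [hv]

variable (q) in
theorem bigDeriv_zGerm (v : Phase n × E n × E n) (hv : v.2.1 = 0) (k : Fin n) :
    bigDeriv q v (zGerm q k) = 0 := by
  rw [zGerm, Hol.deriv_mk_of_affine (c := 0), map_zero]
  intro x s; simp [hv]

theorem bigDeriv_targetShiftHom (hΦ : IsBiholomorphic Φ) (hq : q.1 ∈ Φ.source) (i : Fin n)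
    (h : Hol (Φ q.1)) : bigDeriv q (dirZ _ i) (targetShiftHom hΦ hq h) =
      targetShiftHom hΦ hq (Hol.deriv _ (Pi.single i 1) h) :=
  Hol.deriv_comap_of_affine _ _ (fun y s => by simp [shiftMap, dirZ, add_assoc]) h

theorem sum_grad_mul_bigDeriv (hΦ : IsBiholomorphic Φ) (hq : q.1 ∈ Φ.source) (i j : Fin n) :
    ∑ k, inclHom q (projHom q (gradGerm hΦ hq k i)) * bigDeriv q ((Pi.single k 1, 0, 0), 0, 0)
      (inclHom q (projHom q (Hol.comap Φ (hΦ.1 _ hq) rfl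
        (Hol.mk (fun z : E n => z j) (analyticAt_coord _ j))))) = if i = j then 1 else 0 := by
  have h := congrArg (fun x => inclHom q (projHom q x)) (sum_gradGerm_mul hΦ hq i j)
  simp only [map_sum, map_mul] at h
  refine Eq.trans (Finset.sum_congr rfl fun k _ => ?_) (h.trans (by split_ifs <;> simp))
  rw [bigDeriv_incl]
  congr 2
  exact Hol.deriv_comap_of_affine _ _ (fun y s => by simp) _

/-- The change of coordinates on germs. -/
noncomputable def pullbackModel (hΦ : IsBiholomorphic Φ) (hJ : IsJStar Φ J)
    (hq : q.1 ∈ Φ.source) : PullbackModel (Fin n) (Hol q.1) (Hol (imagePoint Φ J q)) (Hol q)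
      (Hol (q, (0 : E n), (0 : E n))) where
  incl := inclHom q
  restr := restrHom q
  proj := projHom q
  shift := shiftHom hΦ hq
  subst := substHom hΦ hJ hq
  Dz i := bigDeriv q (dirZ _ i)
  Dζ i := bigDeriv q (dirZeta _ i)
  Dw i := bigDeriv q ((Pi.single i 1, 0, 0), 0, 0)
  Dμ i := bigDeriv q ((0, Pi.single i 1, 0), 0, 0)
  dw := derivZ q
  dμ := derivZeta q
  dz := derivZ _
  dζ := derivZeta _
  zc := zGerm q
  ζc := zetaGerm q
  jac := jacGerm hΦ hJ hq
  mu := muGerm q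
  wc k := Hol.mk (fun w : E n => w k) (analyticAt_coord _ k)
  grad := gradGerm hΦ hq
  zeta k := Hol.mk _ (analyticAt_muCoord k)
  Dz_Dz _ _ := Hol.deriv_comm _ _
  Dζ_Dζ _ _ := Hol.deriv_comm _ _
  Dζ_Dz _ _ := Hol.deriv_comm _ _
  Dw_Dz _ _ := Hol.deriv_comm _ _
  Dw_Dζ _ _ := Hol.deriv_comm _ _
  Dμ_Dz _ _ := Hol.deriv_comm _ _
  Dμ_Dζ _ _ := Hol.deriv_comm _ _
  Dμ_Dμ _ _ := Hol.deriv_comm _ _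
  dw_dw _ _ := Hol.deriv_comm _ _
  dμ_dμ _ _ := Hol.deriv_comm _ _
  dμ_dw _ _ := Hol.deriv_comm _ _
  dz_dz _ _ := Hol.deriv_comm _ _
  dζ_dζ _ _ := Hol.deriv_comm _ _
  dζ_dz _ _ := Hol.deriv_comm _ _
  restr_incl f := by
    rw [Hol.comap_comap]
    exact Hol.comap_id _ _ _ (Eventually.of_forall fun y => rfl) f
  restr_shift a := by
    rw [Hol.comap_comap]
    refine Hol.comap_congr _ _ _ _ _ _ ?_ a
    have ht : Tendsto (fun x : Phase n => x.1) (𝓝 q) (𝓝 q.1) := continuous_fst.tendsto q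
    filter_upwards [ht.eventually (Φ.open_source.mem_nhds hq)] with x hx
    simp only [shiftMap, add_zero, Φ.left_inv hx]
  restr_zc i := Hol.mk_congr fun y => rfl
  restr_ζc i := Hol.mk_congr fun y => rfl
  Dz_zc k i := by
    rw [zGerm, Hol.deriv_mk_of_affine (c := if i = k then 1 else 0)]
    · split_ifs <;> simp
    · intro x s; simp [dirZ, Pi.single_apply, eq_comm]
  Dζ_zc k i := by
    rw [zGerm, Hol.deriv_mk_of_affine (c := 0), map_zero]
    intro x s; simp [dirZeta]
  Dw_zc k i := by
    rw [zGerm, Hol.deriv_mk_of_affine (c := 0), map_zero]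
    intro x s; simp
  Dζ_ζc k i := by
    rw [zetaGerm, Hol.deriv_mk_of_affine (c := if i = k then 1 else 0)]
    · split_ifs <;> simp
    · intro x s; simp [dirZeta, Pi.single_apply, eq_comm]
  Dz_ζc k i := by
    rw [zetaGerm, Hol.deriv_mk_of_affine (c := 0), map_zero]
    intro x s; simp [dirZ]
  Dz_incl i f := Hol.deriv_comap_eq_zero _ _ (fun y s => by simp [dirZ]) f
  Dζ_incl i f := Hol.deriv_comap_eq_zero _ _ (fun y s => by simp [dirZeta]) f
  Dw_incl i f := Hol.deriv_comap_of_affine _ _ (fun y s => by simp) f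
  restr_Dw i x := (Hol.deriv_comap_of_affine (analyticAt_zero_section q) rfl
    (fun y s => by simp) x).symm
  restr_Dμ i x := (Hol.deriv_comap_of_affine (analyticAt_zero_section q) rfl
    (fun y s => by simp) x).symm
  Dζ_jac i k j := Hol.deriv_comap_eq_zero _ _ (fun y s => by simp [pairMap, dirZeta]) _
  Dμ_jac i k j := Hol.deriv_comap_eq_zero _ _ (fun y s => by simp [pairMap]) _
  Dζ_shift i a := Hol.deriv_comap_eq_zero _ _ (fun y s => by simp [shiftMap, dirZeta]) _
  dμ_proj i a := Hol.deriv_comap_eq_zero _ _ (fun y s => by simp) _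
  dμ_mu k i := by
    rw [muGerm, derivZeta, Hol.deriv_mk_of_affine (c := if i = k then 1 else 0)]
    · split_ifs <;> simp
    · intro x s; simp [Pi.single_apply, eq_comm]
  dw_mu k i := by
    rw [muGerm, derivZ, Hol.deriv_mk_of_affine (c := 0), map_zero]
    intro x s; simp
  dw_wc k i := by
    rw [Hol.comap_mk, derivZ, Hol.deriv_mk_of_affine (c := if i = k then 1 else 0)]
    · split_ifs <;> simp
    · intro x s; simp [Pi.single_apply, eq_comm]
  dζ_zeta k i := by
    rw [derivZeta, Hol.deriv_mk_of_affine (c := if i = k then 1 else 0)]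
    · split_ifs <;> simp
    · intro x s; simp [Pi.single_apply, eq_comm]
  dz_zeta k i := by
    rw [derivZ, Hol.deriv_mk_of_affine (c := 0), map_zero]
    intro x s; simp
  Dζ_subst j f := Hol.deriv_comap_of_affine _ _ (fun y s => by
    simp [substMap, dirZeta, add_right_comm]) f
  Dμ_subst k f := by
    rw [deriv_substHom hΦ hJ hq _ rfl, Finset.sum_eq_zero, zero_add]
    · refine Finset.sum_congr rfl fun j _ => congrArg (· * _) ?_
      rw [map_add, bigDeriv_zetaGerm _ _ rfl, zero_add, map_sum, Finset.sum_eq_single k]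
      · rw [Derivation.leibniz, bigDeriv_incl, muGerm, Hol.deriv_mk_of_affine (c := 1)]
        · rw [jacGerm, Hol.deriv_comap_eq_zero _ _ (fun y s => by simp [pairMap])]
          simp
        · intro x s; simp
      · intro m _ hm
        rw [Derivation.leibniz, bigDeriv_incl, muGerm, Hol.deriv_mk_of_affine (c := 0)]
        · rw [jacGerm, Hol.deriv_comap_eq_zero _ _ (fun y s => by simp [pairMap])]
          simp
        · intro x s; simp [hm]
      · simp
    · intro j _
      rw [bigDeriv_incl, Hol.deriv_comap_eq_zero _ _ (fun y s => by simp), map_zero, zero_mul]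
  Dz_subst i f := by
    rw [deriv_substHom hΦ hJ hq _ rfl, Finset.sum_eq_zero, zero_add]
    · refine Finset.sum_congr rfl fun j _ => congrArg (· * _) ?_
      rw [map_add, bigDeriv_zetaGerm _ _ rfl, zero_add]
    · intro j _
      rw [Hol.deriv_comap_eq_zero _ _ (fun y s => by simp [dirZ]), zero_mul]
  grad_Dw_subst i f := by
    have hd : ∀ k : Fin n, _ := fun k =>
      deriv_substHom hΦ hJ hq ((Pi.single k 1, 0, 0), 0, 0) rfl f
    simp only [hd, mul_add, Finset.sum_add_distrib]
    congr 1
    · simp only [Finset.mul_sum]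
      rw [Finset.sum_comm]
      simp only [← mul_assoc, ← Finset.sum_mul, sum_grad_mul_bigDeriv]
      simp
    · simp only [Finset.mul_sum]
      rw [Finset.sum_comm]
      refine Finset.sum_congr rfl fun j _ => ?_
      rw [Finset.sum_mul]
      refine Finset.sum_congr rfl fun k _ => ?_
      rw [map_add, bigDeriv_zetaGerm _ _ rfl, zero_add, mul_assoc]
  sum_zc_jac := sum_zGerm_mul_jacGerm hΦ hJ hq
  Dz_shift_wc i k := by
    rw [gradGerm, shiftHom_comap]
    exact bigDeriv_targetShiftHom hΦ hq i (Hol.mk _ (analyticAt_symm_coord hΦ hq k))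
  grad_Dw_shift_wc i m := by
    rw [gradGerm, shiftHom_comap]
    have h1 : ∀ v : Phase n, bigDeriv q (v, 0, 0) (shiftHom hΦ hq
        (Hol.mk (fun w : E n => w m) (analyticAt_coord _ m))) =
        ∑ j, bigDeriv q (v, 0, 0) (inclHom q (projHom q (Hol.comap Φ (hΦ.1 _ hq) rfl
          (Hol.mk (fun z : E n => z j) (analyticAt_coord _ j))))) *
          targetShiftHom hΦ hq (Hol.deriv (Φ q.1) (Pi.single j 1)
            (Hol.mk _ (analyticAt_symm_coord hΦ hq m))) := by
      intro v
      refine (Hol.deriv_comap sum_proj_smul_single (analyticAt_shiftMap hΦ hq) shiftMap_base (v, 0, 0)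
        (Hol.mk _ (analyticAt_symm_coord hΦ hq m))).trans ?_
      refine Finset.sum_congr rfl fun j _ => congrArg (· * _) ?_
      have h2 : Hol.comap (shiftMap Φ) (analyticAt_shiftMap hΦ hq) shiftMap_base
          (Hol.mk _ ((ContinuousLinearMap.proj (R := ℂ) (φ := fun _ : Fin n => ℂ) j).analyticAt _)) =
          inclHom q (projHom q (Hol.comap Φ (hΦ.1 _ hq) rfl
          (Hol.mk (fun z : E n => z j) (analyticAt_coord _ j)))) + zGerm q j :=
        Hol.mk_congr fun y => rfl
      rw [h2, map_add, bigDeriv_zGerm _ _ rfl, add_zero]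
    simp only [h1, Finset.mul_sum]
    rw [Finset.sum_comm]
    simp only [← mul_assoc, ← Finset.sum_mul, sum_grad_mul_bigDeriv]
    simp
  subst_zeta i := by
    have h4 : ∀ k, AnalyticAt ℂ (fun y : Phase n × E n × E n =>
        J (pairMap Φ y).1 (pairMap Φ y).2 k i * y.1.2.1 k) (q, 0, 0) := fun k =>
      (analyticAt_jac hΦ hJ hq k i).mul (analyticAt_of_contDiff (by fun_prop))
    refine Eq.trans ?_ (congrArg (zetaGerm q i + ·) (Hol.mk_sum Finset.univ h4).symm)
    exact Hol.mk_congr fun y => rfl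

end PullbackGerm

/-- Differentiating `sum_zc_jac` in z'ᵢ and restricting to z' = 0 identifies J on the diagonal with
the Jacobian of Φ⁻¹, whatever the choice of J. -/
theorem PullbackModel.proj_grad {ι A Z O B : Type*} [Fintype ι] [DecidableEq ι] [CommRing A]
    [Algebra ℂ A] [CommRing Z] [Algebra ℂ Z] [CommRing O] [Algebra ℂ O] [CommRing B] [Algebra ℂ B]
    (S : PullbackModel ι A Z O B) (k i : ι) : S.proj (S.grad k i) = S.restr (S.jac k i) := by
  have h := congrArg (fun x => S.restr (S.Dz i x)) (S.sum_zc_jac k)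
  simp only [map_sub, S.Dz_shift_wc, S.Dz_incl, S.restr_shift, map_sum, Derivation.leibniz,
    S.Dz_zc, smul_eq_mul, map_add, map_mul, S.restr_zc, zero_mul, zero_add, sub_zero] at h
  rw [← h, Finset.sum_eq_single i]
  · simp
  · intro j _ hj; simp [hj.symm]
  · simp

section PullbackGerm

variable {n : ℕ} {Φ : OpenPartialHomeomorph (E n) (E n)} {J : E n → E n → Matrix (Fin n) (Fin n) ℂ}
  {q : Phase n}

theorem exists_germ_pullback (hΦ : IsBiholomorphic Φ) (hJ : IsJStar Φ J) (hq : q.1 ∈ Φ.source)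
    {P : FormalSeries n} (hP : AnalyticSeriesAt P (imagePoint Φ J q)) :
    ∃ h : AnalyticSeriesAt (pullback Φ J P) q,
      germ h = (pullbackModel hΦ hJ hq).pull (germ hP) := by
  have hF : ∀ k, AnalyticAt ℂ (fun y : Phase n × E n × E n => P k (Φ y.1.1)
      (y.2.2 + (J (Φ y.1.1 + y.2.1) (Φ y.1.1)).transpose.mulVec y.1.2.1) y.1.2.2) (q, 0, 0) :=
    fun k => (hP k).comp_of_eq (analyticAt_substMap hΦ hJ hq) substMap_base
  choose h e using exists_mk_expOp hF
  have h' : AnalyticSeriesAt (pullback Φ J P) q := h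
  refine ⟨h', PowerSeries.ext fun ν => ?_⟩
  rw [coeff_germ, PullbackModel.pull, coeff_seriesExtend]
  refine (e ν).trans (Finset.sum_congr rfl fun p _ => ?_)
  rw [coeff_germ]
  rfl

theorem analyticAt_phaseCoord (x : Phase n) (k : Fin n ⊕ Fin n ⊕ Unit) :
    AnalyticAt ℂ (phaseCoord n k) x := (phaseCoord n k).analyticAt x

theorem eval_lin (hΦ : IsBiholomorphic Φ) (hJ : IsJStar Φ J) (hq : q.1 ∈ Φ.source) (i : Fin n) :
    Hol.eval q ((pullbackModel hΦ hJ hq).lin i) = (imagePoint Φ J q).2.1 i := by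
  rw [PullbackModel.lin, map_sum]
  refine Finset.sum_congr rfl fun k _ => ?_
  rw [map_mul, PullbackModel.proj_grad, mul_comm]
  refine congrArg₂ _ ?_ rfl
  refine (Hol.eval_comap _ (analyticAt_zero_section q) rfl (jacGerm hΦ hJ hq k i)).trans ?_
  rw [jacGerm, Hol.eval_comap, Hol.eval_mk]
  rfl

theorem pull_germStar (hΦ : IsBiholomorphic Φ) (hJ : IsJStar Φ J) (hq : q.1 ∈ Φ.source)
    (Q P : (Hol (imagePoint Φ J q))⟦X⟧) :
    germStar ((pullbackModel hΦ hJ hq).pull Q) ((pullbackModel hΦ hJ hq).pull P) =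
      (pullbackModel hΦ hJ hq).pull (germStar Q P) := by
  let S := pullbackModel hΦ hJ hq
  let p := imagePoint Φ J q
  -- The germs u are the centred coordinates z and η, which do not involve ζ, and v are their
  -- pull-backs; with the centred ζᵢ they generate the maximal ideal at p.
  let u : Fin n ⊕ Unit → Hol p := fun s => match s with
    | .inl j => Hol.mk _ (analyticAt_phaseCoord p (.inl j)) - algebraMap ℂ _ (phaseCoord n (.inl j) p)
    | .inr _ => Hol.mk _ (analyticAt_phaseCoord p (.inr (.inr ()))) -
        algebraMap ℂ _ (phaseCoord n (.inr (.inr ())) p)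
  let v : Fin n ⊕ Unit → Hol q := fun s => match s with
    | .inl j => projHom q (Hol.comap Φ (hΦ.1 _ hq) rfl
        (Hol.mk (fun z : E n => z j) (analyticAt_coord _ j))) -
          algebraMap ℂ _ (phaseCoord n (.inl j) p)
    | .inr _ => Hol.mk _ (analyticAt_phaseCoord q (.inr (.inr ()))) -
        algebraMap ℂ _ (phaseCoord n (.inr (.inr ())) p)
  refine PullbackModel.pull_star S (𝔪 := RingHom.ker (Hol.eval q)) Hol.eq_zero_of_forall_mem_pow (w₀ := q.1)
    (ζ₀ := p.2.1) (u := u) (v := v) ?_ ?_ ?_ ?_ ?_ ?_ ?_ ?_ Q P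
  · intro k
    rw [RingHom.mem_ker, map_sub, map_sub, AlgHom.commutes, AlgHom.commutes]
    exact sub_self _
  · intro b
    obtain ⟨y, hy⟩ := Hol.exists_eq_add_sum sum_proj_smul_single b
    exact ⟨_, y, hy⟩
  · rintro i (j | j)
    · change derivZeta p i (_ - _) = 0
      rw [map_sub, Derivation.map_algebraMap, sub_zero, derivZeta,
        Hol.deriv_mk_of_affine (c := 0), map_zero]
      intro x s; simp [phaseCoord]
    · change derivZeta p i (_ - _) = 0
      rw [map_sub, Derivation.map_algebraMap, sub_zero, derivZeta,
        Hol.deriv_mk_of_affine (c := 0), map_zero]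
      intro x s; simp [phaseCoord]
  · rintro i (j | j)
    · change derivZeta q i (_ - _) = 0
      rw [map_sub, Derivation.map_algebraMap, sub_zero, derivZeta,
        Hol.deriv_comap_eq_zero _ _ (fun y s => by simp)]
    · change derivZeta q i (_ - _) = 0
      rw [map_sub, Derivation.map_algebraMap, sub_zero, derivZeta,
        Hol.deriv_mk_of_affine (c := 0), map_zero]
      intro x s; simp [phaseCoord]
  · rintro (j | j)
    · change substHom hΦ hJ hq (_ - _) = inclHom q (_ - _)
      rw [map_sub, map_sub, AlgHom.commutes, AlgHom.commutes]
      rfl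
    · change substHom hΦ hJ hq (_ - _) = inclHom q (_ - _)
      rw [map_sub, map_sub, AlgHom.commutes, AlgHom.commutes]
      rfl
  · rintro (j | j)
    · change Hol.eval q (_ - _) = 0
      rw [map_sub, AlgHom.commutes]
      exact sub_self _
    · change Hol.eval q (_ - _) = 0
      rw [map_sub, AlgHom.commutes]
      exact sub_self _
  · intro i
    rw [RingHom.mem_ker, map_sub, AlgHom.commutes, eval_lin]
    exact sub_self _
  · intro f
    obtain ⟨y, hy⟩ := Hol.exists_eq_add_sum sum_phaseCoord_smul f
    refine ⟨Hol.eval _ f, fun s => match s with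
      | .inl j => y (.inl j)
      | .inr _ => y (.inr (.inr ())), fun i => y (.inr (.inl i)), hy.trans ?_⟩
    rw [add_assoc]
    congr 1
    rw [Fintype.sum_sum_type, Fintype.sum_sum_type, Fintype.sum_sum_type, add_assoc]
    congr 1
    rw [add_comm]
    rfl

/-- The pull-back is multiplicative, at every point where the symbols are analytic. -/
theorem circ_pullback (hΦ : IsBiholomorphic Φ) (hJ : IsJStar Φ J) (hq : q.1 ∈ Φ.source)
    {P Q : FormalSeries n} (hP : AnalyticSeriesAt P (imagePoint Φ J q))
    (hQ : AnalyticSeriesAt Q (imagePoint Φ J q)) :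
    AnalyticSeriesAt (circ (pullback Φ J Q) (pullback Φ J P)) q ∧
      AnalyticSeriesAt (pullback Φ J (circ Q P)) q ∧
      ∀ ν, circ (pullback Φ J Q) (pullback Φ J P) ν q.1 q.2.1 q.2.2 =
        pullback Φ J (circ Q P) ν q.1 q.2.1 q.2.2 := by
  obtain ⟨h1, e1⟩ := exists_germ_pullback hΦ hJ hq hP
  obtain ⟨h2, e2⟩ := exists_germ_pullback hΦ hJ hq hQ
  obtain ⟨h3, e3⟩ := exists_germ_circ hP hQ
  obtain ⟨h4, e4⟩ := exists_germ_circ h1 h2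
  obtain ⟨h5, e5⟩ := exists_germ_pullback hΦ hJ hq h3
  refine ⟨h4, h5, fun ν => ?_⟩
  rw [← eval_coeff_germ h4, ← eval_coeff_germ h5, e4, e5, e1, e2, e3, pull_germStar]

/-- The matrix `J` restricts to the Jacobian matrix of `Φ⁻¹` on the diagonal. -/
theorem jacobianSymm_eq (hΦ : IsBiholomorphic Φ) (hJ : IsJStar Φ J) {w : E n}
    (hw : w ∈ Φ.source) : jacobianSymm Φ (Φ w) = J (Φ w) (Φ w) := by
  set q : Phase n := (w, 0, 0)
  have hq : q.1 ∈ Φ.source := hw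
  ext k i
  have h := congrArg (Hol.eval q) ((pullbackModel hΦ hJ hq).proj_grad k i)
  have h1 : Hol.eval q ((pullbackModel hΦ hJ hq).restr ((pullbackModel hΦ hJ hq).jac k i)) =
      J (Φ w) (Φ w) k i := by
    refine (Hol.eval_comap _ (analyticAt_zero_section q) rfl (jacGerm hΦ hJ hq k i)).trans ?_
    rw [jacGerm, Hol.eval_comap, Hol.eval_mk]
  have h2 : Hol.eval q ((pullbackModel hΦ hJ hq).proj ((pullbackModel hΦ hJ hq).grad k i)) =
      fderiv ℂ (fun z => Φ.symm z k) (Φ w) (Pi.single i 1) := rfl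
  rw [← h1, ← h, h2, jacobianSymm, Matrix.of_apply]
  have h3 := (hasFDerivAt_pi'.1 (hΦ.2 _ (Φ.map_source hw)).differentiableAt.hasFDerivAt k).fderiv
  rw [h3]
  rfl

end PullbackGerm

/-! ### Partial sums and the derivative in η -/

section Operations

variable {n : ℕ}

/-- The partial sums `∑_{ν < m} P_ν` of a formal series. -/
def partialSum (P : FormalSeries n) : FormalSeries n :=
  fun m z ζ η => ∑ ν ∈ Finset.range m, P ν z ζ η

theorem AnalyticSeriesAt.partialSum {P : FormalSeries n} {x : Phase n} (h : AnalyticSeriesAt P x) :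
    AnalyticSeriesAt (partialSum P) x := fun _ => Finset.analyticAt_fun_sum _ fun ν _ => h ν

/-- The sum of index m stops before m, so the series starts with 0 and satisfies S = X(P + S). This
equation determines S (`eq_of_eq_X_mul_add`) and is preserved by X-linear maps, so taking partial
sums commutes with the product. -/
theorem germ_partialSum {P : FormalSeries n} {x : Phase n} (h : AnalyticSeriesAt P x) :
    germ h.partialSum = X * (germ h + germ h.partialSum) := by
  ext ν
  rw [coeff_germ]
  cases ν with
  | zero =>
    rw [coeff_zero_X_mul]
    refine (Hol.mk_eq_mk (g := fun _ => 0) (hg := analyticAt_const)).2 ?_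
    exact Eventually.of_forall fun y => rfl
  | succ ν =>
    rw [coeff_succ_X_mul, map_add, coeff_germ, coeff_germ, Hol.mk_add, Hol.mk_eq_mk]
    refine Eventually.of_forall fun y => ?_
    exact (Finset.sum_range_succ _ _).trans (add_comm _ _)

theorem eq_of_eq_X_mul_add {R : Type*} [CommRing R] {Y G Z : R⟦X⟧} (hY : Y = X * (Z + Y))
    (hG : G = X * (Z + G)) : Y = G := by
  ext ν
  induction ν with
  | zero => rw [hY, hG, coeff_zero_X_mul, coeff_zero_X_mul]
  | succ ν ih => rw [hY, hG, coeff_succ_X_mul, coeff_succ_X_mul, map_add, map_add, ih]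

theorem IsXLinear.eq_X_mul_add {R R' : Type*} [CommRing R] [CommRing R'] {f : R⟦X⟧ → R'⟦X⟧}
    (hf : IsXLinear f) {P S : R⟦X⟧} (h : S = X * (P + S)) : f S = X * (f P + f S) := by
  rw [← hf.map_add, ← hf.map_X_mul, ← h]

theorem circ_partialSum_right {P Q : FormalSeries n} {x : Phase n} (hP : AnalyticSeriesAt P x)
    (hQ : AnalyticSeriesAt Q x) (ν : ℕ) :
    circ Q (partialSum P) ν x.1 x.2.1 x.2.2 = partialSum (circ Q P) ν x.1 x.2.1 x.2.2 := by
  obtain ⟨h1, e1⟩ := exists_germ_circ hP hQ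
  obtain ⟨h2, e2⟩ := exists_germ_circ hP.partialSum hQ
  rw [← eval_coeff_germ h2, ← eval_coeff_germ h1.partialSum]
  refine congrArg (fun F => Hol.eval x (coeff ν F)) ?_
  refine eq_of_eq_X_mul_add (Z := germ h1) ?_ (germ_partialSum h1)
  rw [e2, e1]
  exact (isXLinear_star_right _ _ _).eq_X_mul_add (germ_partialSum hP)

theorem circ_partialSum_left {P Q : FormalSeries n} {x : Phase n} (hP : AnalyticSeriesAt P x)
    (hQ : AnalyticSeriesAt Q x) (ν : ℕ) :
    circ (partialSum Q) P ν x.1 x.2.1 x.2.2 = partialSum (circ Q P) ν x.1 x.2.1 x.2.2 := by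
  obtain ⟨h1, e1⟩ := exists_germ_circ hP hQ
  obtain ⟨h2, e2⟩ := exists_germ_circ hP hQ.partialSum
  rw [← eval_coeff_germ h2, ← eval_coeff_germ h1.partialSum]
  refine congrArg (fun F => Hol.eval x (coeff ν F)) ?_
  refine eq_of_eq_X_mul_add (Z := germ h1) ?_ (germ_partialSum h1)
  rw [e2, e1]
  exact (isXLinear_star_left _ _ _).eq_X_mul_add (germ_partialSum hQ)

theorem exists_germ_etaDeriv {P : FormalSeries n} {x : Phase n} (h : AnalyticSeriesAt P x) :
    ∃ h' : AnalyticSeriesAt (etaDeriv P) x,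
      germ h' = coeffMap (Hol.deriv x (0, 0, 1)).toLinearMap (germ h) := by
  have he : ∀ ν, (fun y => fderiv ℂ (fun y : Phase n => P ν y.1 y.2.1 y.2.2) y (0, 0, 1)) =ᶠ[𝓝 x]
      fun y => etaDeriv P ν y.1 y.2.1 y.2.2 := by
    intro ν
    filter_upwards [(h ν).eventually_analyticAt] with y hy
    have h1 : HasDerivAt (fun s : ℂ => (y.1, y.2.1, s)) ((0 : E n), (0 : E n), (1 : ℂ)) y.2.2 :=
      (hasDerivAt_const _ _).prodMk ((hasDerivAt_const _ _).prodMk (hasDerivAt_id _))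
    exact (hy.differentiableAt.hasFDerivAt.comp_hasDerivAt_of_eq _ h1 rfl).deriv.symm
  have h' : AnalyticSeriesAt (etaDeriv P) x := fun ν =>
    (Hol.analyticAt_fderiv_apply (h ν) _).congr (he ν)
  refine ⟨h', PowerSeries.ext fun ν => ?_⟩
  rw [coeff_germ, coeff_coeffMap, coeff_germ]
  exact Eq.symm (Hol.mk_eq_mk.2 (he ν))

/-- The Leibniz rule for the derivation `∂_η`. -/
theorem etaDeriv_circ {P Q : FormalSeries n} {x : Phase n} (hP : AnalyticSeriesAt P x)
    (hQ : AnalyticSeriesAt Q x) (ν : ℕ) :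
    etaDeriv (circ Q P) ν x.1 x.2.1 x.2.2 =
      circ (etaDeriv Q) P ν x.1 x.2.1 x.2.2 + circ Q (etaDeriv P) ν x.1 x.2.1 x.2.2 := by
  obtain ⟨h1, e1⟩ := exists_germ_circ hP hQ
  obtain ⟨h2, e2⟩ := exists_germ_etaDeriv hP
  obtain ⟨h3, e3⟩ := exists_germ_etaDeriv hQ
  obtain ⟨h4, e4⟩ := exists_germ_etaDeriv h1
  obtain ⟨h5, e5⟩ := exists_germ_circ hP h3
  obtain ⟨h6, e6⟩ := exists_germ_circ h2 hQ
  rw [← eval_coeff_germ h4, ← eval_coeff_germ h5, ← eval_coeff_germ h6, ← map_add, ← map_add,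
    e4, e5, e6, e1, e2, e3]
  refine congrArg (fun F => Hol.eval x (coeff ν F)) ?_
  exact coeffMap_star (derivZeta x) (derivZ x) (fun i f => Hol.deriv_comm _ _ f)
    (fun i f => Hol.deriv_comm _ _ f) _ _

end Operations

/-! ### Cauchy estimates for the exponential operator -/

section Cauchy

variable {n : ℕ}

theorem pderiv_add_smul_single (i : Fin n) (f : E n → ℂ) (x : E n) (s : ℂ) :
    pderiv i f (x + s • Pi.single i 1) = deriv (fun t : ℂ => f (x + t • Pi.single i 1)) s := by
  have h := deriv_comp_const_add (fun t : ℂ => f (x + t • Pi.single i 1)) s 0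
  rw [add_zero] at h
  rw [← h]
  simp only [pderiv, lineDeriv, add_smul, add_assoc]

theorem iterate_pderiv_add_smul_single (i : Fin n) (k : ℕ) (f : E n → ℂ) (x : E n) (s : ℂ) :
    (pderiv i)^[k] f (x + s • Pi.single i 1) =
      iteratedDeriv k (fun t : ℂ => f (x + t • Pi.single i 1)) s := by
  induction k generalizing s with
  | zero => simp
  | succ k ih =>
    rw [Function.iterate_succ_apply', pderiv_add_smul_single, iteratedDeriv_succ]
    simp only [ih]

/-- The one-variable Cauchy estimate is applied to one coordinate at a time; the hypothesis only
concerns points that differ from x in the coordinates listed in L, which makes the induction on L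
close. -/
theorem norm_foldr_pderiv_le {U : Set (E n)} (hU : IsOpen U) {f : E n → ℂ}
    (hf : AnalyticOnNhd ℂ f U) (α : Fin n → ℕ) {s M : ℝ} (hs : 0 < s) (L : List (Fin n))
    (hL : L.Nodup) (x : E n)
    (hx : ∀ y : E n, (∀ i ∈ L, ‖y i - x i‖ ≤ s) → (∀ i ∉ L, y i = x i) → y ∈ U ∧ ‖f y‖ ≤ M) :
    ‖L.foldr (fun i g => (pderiv i)^[α i] g) f x‖ ≤
      (L.map fun i => ((α i).factorial : ℝ) / s ^ α i).prod * M := by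
  induction L generalizing x with
  | nil => simpa using (hx x (by simp) (by simp)).2
  | cons i L ih =>
    obtain ⟨hi, hL'⟩ := List.nodup_cons.1 hL
    obtain ⟨ha, he⟩ := foldr_pderiv_eq (j := id) (v := fun i => Pi.single i 1) (g := f) hU hf
      (fun _ _ _ => rfl) (fun _ _ => rfl) α L
    set h := L.foldr (fun i g => (pderiv i)^[α i] g) f with hh
    set h' := L.foldr (fun i g => (dirDeriv (Pi.single i 1))^[α i] g) f
    -- After moving the coordinate i by t, the remaining coordinates of L may still vary by s, and i
    -- is not among them.
    have hmem : ∀ t ∈ Metric.closedBall (0 : ℂ) s, ∀ y : E n,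
        (∀ k ∈ L, ‖y k - (x + t • (Pi.single i 1 : E n)) k‖ ≤ s) →
        (∀ k ∉ L, y k = (x + t • (Pi.single i 1 : E n)) k) → y ∈ U ∧ ‖f y‖ ≤ M := by
      intro t ht y h1 h2
      refine hx y ?_ ?_
      · intro k hk
        rcases List.mem_cons.1 hk with rfl | hk
        · rw [h2 k hi]
          simpa using ht
        · have hne : k ≠ i := fun e => hi (e ▸ hk)
          simpa [hne] using h1 k hk
      · intro k hk
        rw [List.mem_cons, not_or] at hk
        simpa [hk.1] using h2 k hk.2
    have hUt : ∀ t ∈ Metric.closedBall (0 : ℂ) s, x + t • (Pi.single i 1 : E n) ∈ U := fun t ht =>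
      (hmem t ht _ (fun k _ => by simpa using hs.le) (fun _ _ => rfl)).1
    have hd : DifferentiableOn ℂ (fun t : ℂ => h (x + t • (Pi.single i 1 : E n)))
        (Metric.closedBall 0 s) := by
      refine DifferentiableOn.congr (f := fun t : ℂ => h' (x + t • (Pi.single i 1 : E n))) ?_
        fun t ht => he _ (hUt t ht)
      intro t ht
      refine DifferentiableAt.differentiableWithinAt ?_
      exact (ha _ (hUt t ht)).differentiableAt.comp t (by fun_prop)
    have hb := Complex.norm_iteratedDeriv_le_of_forall_mem_sphere_norm_le (α i) hs
      (hd.diffContOnCl_ball subset_rfl) (C := (L.map fun i => ((α i).factorial : ℝ) / s ^ α i).prod * M)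
      fun t ht => ih hL' _ (hmem t (Metric.sphere_subset_closedBall ht))
    rw [← iterate_pderiv_add_smul_single, zero_smul, add_zero] at hb
    rw [List.foldr_cons, List.map_cons, List.prod_cons]
    refine hb.trans (le_of_eq ?_)
    ring

/-- Cauchy's estimate on a polydisc. -/
theorem norm_mderiv_le {U : Set (E n)} (hU : IsOpen U) {f : E n → ℂ}
    (hf : AnalyticOnNhd ℂ f U) (α : Fin n → ℕ) {s M : ℝ} (hs : 0 < s) (x : E n)
    (hx : ∀ y ∈ Metric.closedBall x s, y ∈ U ∧ ‖f y‖ ≤ M) :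
    ‖mderiv α f x‖ ≤ (multiFactorial α : ℝ) / s ^ (∑ i, α i) * M := by
  refine (norm_foldr_pderiv_le hU hf α hs (List.finRange n) (List.nodup_finRange n) x
    fun y hy _ => hx y ?_).trans (le_of_eq ?_)
  · rw [Metric.mem_closedBall, dist_eq_norm, pi_norm_le_iff_of_nonneg hs.le]
    exact fun i => hy i (List.mem_finRange i)
  · rw [← List.ofFn_eq_map, List.prod_ofFn, Finset.prod_div_distrib, Finset.prod_pow_eq_pow_sum,
      multiFactorial, Nat.cast_prod]

theorem norm_mderiv_mderiv_le {U : Set (E n × E n)} (hU : IsOpen U) {F : E n × E n → ℂ}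
    (hF : AnalyticOnNhd ℂ F U) (α : Fin n → ℕ) {s t M : ℝ} (hs : 0 < s) (ht : 0 < t) (z ζ : E n)
    (hx : ∀ x ∈ Metric.closedBall z s, ∀ y ∈ Metric.closedBall ζ t,
      (x, y) ∈ U ∧ ‖F (x, y)‖ ≤ M) :
    ‖mderiv α (fun y : E n => mderiv α (fun x : E n => F (x, y)) z) ζ‖ ≤
      (multiFactorial α : ℝ) ^ 2 / (s * t) ^ (∑ i, α i) * M := by
  have hz : z ∈ Metric.closedBall z s := Metric.mem_closedBall_self hs.le
  have he : ∀ y, (z, y) ∈ U → mderiv α (fun x : E n => F (x, y)) z =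
      multiDeriv (fun i => (Pi.single i 1, 0)) α F (z, y) := fun y hy =>
    mderiv_eq_multiDeriv (j := fun x => (x, y)) hU hF (fun i x c => by simp)
      (fun _ _ => rfl) α z hy
  have hU' : IsOpen {y : E n | (z, y) ∈ U} := hU.preimage (by fun_prop)
  have hc : ∀ y : E n, AnalyticAt ℂ (fun y : E n => (z, y)) y := fun y => by fun_prop
  have hU2 : ∀ y : E n, IsOpen {x : E n | (x, y) ∈ U} := fun y => hU.preimage (by fun_prop)
  refine (norm_mderiv_le hU' (M := (multiFactorial α : ℝ) / s ^ (∑ i, α i) * M) ?_ α ht ζ ?_).trans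
    (le_of_eq (by rw [mul_pow]; ring))
  · intro y hy
    refine ((analyticOnNhd_multiDeriv hF (fun i => (Pi.single i 1, 0)) α (z, y) hy).comp (hc y)).congr ?_
    filter_upwards [hU'.mem_nhds hy] with y' hy' using (he y' hy').symm
  · intro y hy
    refine ⟨(hx z hz y hy).1, norm_mderiv_le (hU2 y) ?_ α hs z fun x hxs => hx x hxs y hy⟩
    intro x hxy
    exact (hF (x, y) hxy).comp (f := fun x : E n => (x, y)) (by fun_prop)

theorem card_piAntidiag_le (l : ℕ) :
    (Finset.piAntidiag (Finset.univ : Finset (Fin n)) l).card ≤ (2 ^ n) ^ l := by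
  have h : Finset.piAntidiag (Finset.univ : Finset (Fin n)) l ⊆
      Fintype.piFinset fun _ => Finset.range (l + 1) := by
    intro α hα
    rw [Finset.mem_piAntidiag] at hα
    rw [Fintype.mem_piFinset]
    intro i
    rw [Finset.mem_range, Nat.lt_succ_iff, ← hα.1]
    exact Finset.single_le_sum (fun _ _ => Nat.zero_le _) (Finset.mem_univ i)
  refine (Finset.card_le_card h).trans ?_
  rw [Fintype.card_piFinset_const, Finset.card_range, ← pow_mul, mul_comm n l, pow_mul]
  simpa using Nat.pow_le_pow_left (Nat.lt_two_pow_self (n := l)) n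

theorem multiFactorial_le (α : Fin n → ℕ) : multiFactorial α ≤ (∑ i, α i).factorial :=
  Nat.le_of_dvd (Nat.factorial_pos _) (Nat.prod_factorial_dvd_factorial_sum _ _)

theorem multiFactorial_pos (α : Fin n → ℕ) : 0 < multiFactorial α :=
  Finset.prod_pos fun _ _ => Nat.factorial_pos _

/-- The two Cauchy estimates give (α!)², of which 1/α! in the operator leaves α! ≤ |α|!; the number
of multi-indices of length l is at most (l + 1)^n ≤ (2^n)^l. -/
theorem norm_expOp_le {F : ℕ → E n → E n → ℂ} {s t : ℝ} (hs : 0 < s) (ht : 0 < t) (z ζ : E n)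
    {M : ℕ → ℝ} (hF : ∀ m, ∀ x ∈ Metric.closedBall z s, ∀ y ∈ Metric.closedBall ζ t,
      AnalyticAt ℂ (fun p : E n × E n => F m p.1 p.2) (x, y) ∧ ‖F m x y‖ ≤ M m) (ν : ℕ) :
    ‖expOp F ν z ζ‖ ≤ ∑ p ∈ Finset.HasAntidiagonal.antidiagonal ν,
      (p.2.factorial : ℝ) * (2 ^ n / (s * t)) ^ p.2 * M p.1 := by
  refine norm_sum_le_of_le _ fun p _ => ?_
  have hM : 0 ≤ M p.1 := (norm_nonneg _).trans
    (hF p.1 z (Metric.mem_closedBall_self hs.le) ζ (Metric.mem_closedBall_self ht.le)).2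
  have hα : ∀ α ∈ Finset.piAntidiag (Finset.univ : Finset (Fin n)) p.2,
      ‖((multiFactorial α : ℂ))⁻¹ *
        mderiv α (fun y : E n => mderiv α (fun x : E n => F p.1 x y) z) ζ‖ ≤
      (p.2.factorial : ℝ) / (s * t) ^ p.2 * M p.1 := by
    intro α hα
    rw [Finset.mem_piAntidiag] at hα
    have h := norm_mderiv_mderiv_le (isOpen_analyticAt ℂ fun p' : E n × E n => F p.1 p'.1 p'.2)
      (fun _ hp => hp) α hs ht z ζ (hF p.1)
    have hpos : (0 : ℝ) < multiFactorial α := by exact_mod_cast multiFactorial_pos α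
    have hle : (multiFactorial α : ℝ) ≤ p.2.factorial := by
      rw [← hα.1]; exact_mod_cast multiFactorial_le α
    rw [norm_mul, norm_inv, Complex.norm_natCast, inv_mul_le_iff₀ hpos]
    refine h.trans ?_
    rw [hα.1, ← mul_assoc]
    refine mul_le_mul_of_nonneg_right ?_ hM
    rw [sq, mul_div_assoc]
    gcongr
  refine (norm_sum_le_of_le _ hα).trans ?_
  rw [Finset.sum_const, nsmul_eq_mul]
  have hc : ((Finset.piAntidiag (Finset.univ : Finset (Fin n)) p.2).card : ℝ) ≤ (2 ^ n) ^ p.2 := by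
    exact_mod_cast card_piAntidiag_le p.2
  refine (mul_le_mul_of_nonneg_right hc (by positivity)).trans (le_of_eq ?_)
  rw [div_pow]
  ring

end Cauchy

/-! ### Shrinking the domains -/

section Regions

variable {n : ℕ} {Ω : Set (E n × E n)} {S : Set ℂ} {d ρ d₁ ρ₁ : ℝ}

theorem thicken_mono (h : ρ ≤ ρ₁) : thicken Ω ρ ⊆ thicken Ω ρ₁ := by
  refine closure_mono ?_
  rintro x ⟨z, ζ, z', ζ', h1, h2, h3, rfl⟩
  exact ⟨z, ζ, z', ζ', h1, h2.trans h, h3.trans (by gcongr), rfl⟩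

theorem region_subset (h : ρ ≤ ρ₁) (hd : d₁ * (1 - ρ₁) ≤ d * (1 - ρ)) :
    region Ω d ρ ⊆ region Ω d₁ ρ₁ := fun _ hx => ⟨thicken_mono h hx.1, hd.trans hx.2⟩

theorem HolOn.mono {P : FormalSeries n} (hP : HolOn Ω S d₁ ρ₁ P)
    (h : region Ω d ρ ⊆ region Ω d₁ ρ₁) : HolOn Ω S d ρ P :=
  fun ν => (hP ν).mono fun _ hx => ⟨h hx.1, hx.2⟩

theorem exists_region_subset {d₂ ρ₂ : ℝ} (h1 : 0 < d₁) (h2 : 0 < ρ₁) (h3 : ρ₁ < 1)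
    (h5 : 0 < ρ₂) (h6 : ρ₂ < 1) :
    ∃ d ρ : ℝ, 0 < d ∧ 0 < ρ ∧ ρ < 1 ∧ region Ω d ρ ⊆ region Ω d₁ ρ₁ ∧
      region Ω d ρ ⊆ region Ω d₂ ρ₂ := by
  have hd : 0 < max d₁ d₂ := lt_max_of_lt_left h1
  refine ⟨max d₁ d₂, min ρ₁ ρ₂, hd, lt_min h2 h5, min_lt_of_left_lt h3,
    region_subset (min_le_left _ _) ?_, region_subset (min_le_right _ _) ?_⟩
  · exact mul_le_mul (le_max_left _ _) (by linarith [min_le_left ρ₁ ρ₂]) (by linarith) hd.le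
  · exact mul_le_mul (le_max_right _ _) (by linarith [min_le_right ρ₁ ρ₂]) (by linarith) hd.le

/-- Near (z, ζ) there are points (y + y', ξ + ξ') of the unclosed thickening with ‖ζ‖ ≤ 4‖ξ‖. Hence
the extra shift ρ/8 · ‖ζ‖ is at most ρ/2 · ‖ξ‖, which with ‖ξ'‖ ≤ ρ/2 · ‖ξ‖ stays within ρ‖ξ‖. -/
theorem add_mem_thicken (hρ : 0 < ρ) (hρ' : ρ < 1) {z ζ z' ζ' : E n}
    (h : (z, ζ) ∈ thicken Ω (ρ / 2)) (hζ : ζ ≠ 0) (hz' : ‖z'‖ ≤ ρ / 8) (hζ' : ‖ζ'‖ ≤ ρ / 8 * ‖ζ‖) :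
    (z + z', ζ + ζ') ∈ thicken Ω ρ := by
  have hf := mem_closure_iff_frequently.1 h
  have hev : ∀ᶠ x : E n × E n in 𝓝 (z, ζ), ‖ζ‖ < 2 * ‖x.2‖ := by
    have hc : ContinuousAt (fun x : E n × E n => 2 * ‖x.2‖) (z, ζ) := by fun_prop
    refine hc.eventually (lt_mem_nhds ?_)
    have := norm_pos_iff.2 hζ
    show ‖ζ‖ < 2 * ‖ζ‖
    linarith
  have ht : Tendsto (fun x : E n × E n => (x.1 + z', x.2 + ζ')) (𝓝 (z, ζ)) (𝓝 (z + z', ζ + ζ')) :=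
    Continuous.tendsto (f := fun x : E n × E n => (x.1 + z', x.2 + ζ')) (by fun_prop) (z, ζ)
  refine mem_closure_iff_frequently.2 (ht.frequently ((hf.and_eventually hev).mono ?_))
  rintro x ⟨⟨y, ξ, y', ξ', h1, h2, h3, rfl⟩, hx⟩
  refine ⟨y, ξ, y' + z', ξ' + ζ', h1, ?_, ?_, by simp [add_assoc]⟩
  · exact (norm_add_le _ _).trans (by linarith)
  · have h4 := norm_add_le ξ ξ'
    have h5 : ‖ζ‖ ≤ 4 * ‖ξ‖ := by
      have : ρ / 2 * ‖ξ‖ ≤ 1 * ‖ξ‖ := by gcongr; linarith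
      simp only at hx
      linarith
    have h6 : ρ / 8 * ‖ζ‖ ≤ ρ / 8 * (4 * ‖ξ‖) := by gcongr
    exact (norm_add_le _ _).trans (by linarith)

theorem norm_pos_of_mem_region (hd : 0 < d) (hρ' : ρ < 1) {z ζ : E n} (h : (z, ζ) ∈ region Ω d ρ) :
    0 < ‖ζ‖ := lt_of_lt_of_le (mul_pos hd (by linarith)) h.2

theorem add_mem_region (hd : 0 < d) (hρ : 0 < ρ) (hρ' : ρ < 1) {z ζ z' ζ' : E n}
    (h : (z, ζ) ∈ region Ω (2 * d) (ρ / 2)) (hz' : ‖z'‖ ≤ ρ / 8) (hζ' : ‖ζ'‖ ≤ ρ / 8 * ‖ζ‖) :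
    (z + z', ζ + ζ') ∈ region Ω d ρ := by
  have h0 := norm_pos_of_mem_region (by positivity) (by linarith) h
  refine ⟨add_mem_thicken hρ hρ' h.1 (norm_pos_iff.1 h0) hz' hζ', ?_⟩
  have h1 := norm_sub_le_norm_add ζ ζ'
  have h2 : 2 * d * (1 - ρ / 2) ≤ ‖ζ‖ := h.2
  show d * (1 - ρ) ≤ ‖ζ + ζ'‖
  nlinarith [mul_pos hd hρ]

theorem region_half_subset (hd : 0 < d) (hρ : 0 < ρ) :
    region Ω (2 * d) (ρ / 2) ⊆ region Ω d ρ :=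
  region_subset (by linarith) (by nlinarith [mul_pos hd hρ])

end Regions

/-! ### Growth estimates -/

section Bounds

variable {n : ℕ} {Ω : Set (E n × E n)} {S : Set ℂ} {d ρ d₁ ρ₁ : ℝ}

/-- The growth condition for the coefficients of a formal symbol. -/
def SymbolBound (Ω : Set (E n × E n)) (S : Set ℂ) (d ρ A : ℝ) (P : FormalSeries n) : Prop :=
  ∀ Z : Set ℂ, IsCompact Z → Z ⊆ S → ∀ h : ℝ, 0 < h →
    ∃ C : ℝ, 0 < C ∧ ∀ ν : ℕ, ∀ z ζ : E n, (z, ζ) ∈ region Ω d ρ → ∀ η ∈ Z,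
      ‖P ν z ζ η‖ ≤ C * (ν.factorial : ℝ) * A ^ ν * Real.exp (h * ‖ζ‖) / ‖η • ζ‖ ^ ν

/-- Formal series with holomorphic coefficients which satisfy the growth condition of symbols. -/
def IsFormalSymbol (Ω : Set (E n × E n)) (S : Set ℂ) (P : FormalSeries n) : Prop :=
  ∃ d ρ : ℝ, 0 < d ∧ 0 < ρ ∧ ρ < 1 ∧ HolOn Ω S d ρ P ∧ ∃ A : ℝ, 0 < A ∧ SymbolBound Ω S d ρ A P

theorem isSymbol_iff {P : FormalSeries n} :
    IsSymbol Ω S P ↔ IsFormalSymbol Ω S P ∧ IsNullSymbol Ω S (etaDeriv P) := Iff.rfl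

theorem SymbolBound.mono {P : FormalSeries n} {A A₁ : ℝ} (hP : SymbolBound Ω S d₁ ρ₁ A₁ P)
    (h : region Ω d ρ ⊆ region Ω d₁ ρ₁) (hA₁ : 0 < A₁) (hA : A₁ ≤ A) : SymbolBound Ω S d ρ A P := by
  intro Z hZ hZS h' hh'
  obtain ⟨C, hC, hb⟩ := hP Z hZ hZS h' hh'
  exact ⟨C, hC, fun ν z ζ hz η hη => (hb ν z ζ (h hz) η hη).trans (by gcongr)⟩

/-- The null condition is the symbol bound for the series of partial sums, so all estimates on
null-symbols follow from those for formal symbols. -/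
theorem isNullSymbol_iff {P : FormalSeries n} :
    IsNullSymbol Ω S P ↔ IsFormalSymbol Ω S (partialSum P) := by
  constructor
  · rintro ⟨d, ρ, hd, hρ, hρ', hH, A, hA, hb⟩
    refine ⟨d, ρ, hd, hρ, hρ', fun ν x hx => AnalyticSeriesAt.partialSum (fun ν => hH ν x hx) ν,
      A, hA, ?_⟩
    intro Z hZ hZS h hh
    obtain ⟨C, hC, hb⟩ := hb Z hZ hZS h hh
    refine ⟨C, hC, fun ν z ζ hz η hη => ?_⟩
    -- The index 0, which the null condition omits, is an empty sum.
    rcases Nat.eq_zero_or_pos ν with rfl | hν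
    · simp only [partialSum, Finset.range_zero, Finset.sum_empty, norm_zero]
      positivity
    · exact hb ν hν z ζ hz η hη
  · rintro ⟨d, ρ, hd, hρ, hρ', hH, A, hA, hb⟩
    refine ⟨d, ρ, hd, hρ, hρ', fun ν x hx => ?_, A, hA, ?_⟩
    · refine ((hH (ν + 1) x hx).sub (hH ν x hx)).congr (Eventually.of_forall fun y => ?_)
      simp [partialSum, Finset.sum_range_succ]
    · intro Z hZ hZS h hh
      obtain ⟨C, hC, hb⟩ := hb Z hZ hZS h hh
      exact ⟨C, hC, fun ν _ => hb ν⟩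

theorem IsFormalSymbol.congr {P Q : FormalSeries n} (hP : IsFormalSymbol Ω S P)
    (hQ : ∃ d ρ : ℝ, 0 < d ∧ 0 < ρ ∧ ρ < 1 ∧ HolOn Ω S d ρ Q ∧
      ∀ ν : ℕ, ∀ z ζ : E n, (z, ζ) ∈ region Ω d ρ → ∀ η ∈ S, Q ν z ζ η = P ν z ζ η) :
    IsFormalSymbol Ω S Q := by
  obtain ⟨d₁, ρ₁, hd₁, hρ₁, hρ₁', hH₁, A, hA, hb⟩ := hP
  obtain ⟨d₂, ρ₂, hd₂, hρ₂, hρ₂', hH₂, he⟩ := hQ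
  obtain ⟨d, ρ, hd, hρ, hρ', hs₁, hs₂⟩ := exists_region_subset (Ω := Ω) hd₁ hρ₁ hρ₁' hρ₂ hρ₂'
  refine ⟨d, ρ, hd, hρ, hρ', hH₂.mono hs₂, A, hA, ?_⟩
  intro Z hZ hZS h hh
  obtain ⟨C, hC, hb⟩ := hb.mono hs₁ hA le_rfl Z hZ hZS h hh
  exact ⟨C, hC, fun ν z ζ hz η hη => by rw [he ν z ζ (hs₂ hz) η (hZS hη)]; exact hb ν z ζ hz η hη⟩

theorem IsFormalSymbol.exists_common {P Q : FormalSeries n} (hP : IsFormalSymbol Ω S P)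
    (hQ : IsFormalSymbol Ω S Q) : ∃ d ρ A : ℝ, 0 < d ∧ 0 < ρ ∧ ρ < 1 ∧ 0 < A ∧
      HolOn Ω S d ρ P ∧ HolOn Ω S d ρ Q ∧ SymbolBound Ω S d ρ A P ∧ SymbolBound Ω S d ρ A Q := by
  obtain ⟨d₁, ρ₁, hd₁, hρ₁, hρ₁', hH₁, A₁, hA₁, hb₁⟩ := hP
  obtain ⟨d₂, ρ₂, hd₂, hρ₂, hρ₂', hH₂, A₂, hA₂, hb₂⟩ := hQ
  obtain ⟨d, ρ, hd, hρ, hρ', hs₁, hs₂⟩ := exists_region_subset (Ω := Ω) hd₁ hρ₁ hρ₁' hρ₂ hρ₂'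
  exact ⟨d, ρ, max A₁ A₂, hd, hρ, hρ', lt_max_of_lt_left hA₁, hH₁.mono hs₁, hH₂.mono hs₂,
    hb₁.mono hs₁ hA₁ (le_max_left _ _), hb₂.mono hs₂ hA₂ (le_max_right _ _)⟩

theorem IsFormalSymbol.add {P Q : FormalSeries n} (hP : IsFormalSymbol Ω S P)
    (hQ : IsFormalSymbol Ω S Q) : IsFormalSymbol Ω S (fun ν z ζ η => P ν z ζ η + Q ν z ζ η) := by
  obtain ⟨d, ρ, A, hd, hρ, hρ', hA, hH₁, hH₂, hb₁, hb₂⟩ := hP.exists_common hQ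
  refine ⟨d, ρ, hd, hρ, hρ', fun ν x hx => (hH₁ ν x hx).add (hH₂ ν x hx), A, hA, ?_⟩
  intro Z hZ hZS h hh
  obtain ⟨C₁, hC₁, h₁⟩ := hb₁ Z hZ hZS h hh
  obtain ⟨C₂, hC₂, h₂⟩ := hb₂ Z hZ hZS h hh
  refine ⟨C₁ + C₂, by positivity, fun ν z ζ hz η hη => ?_⟩
  refine (norm_add_le_of_le (h₁ ν z ζ hz η hη) (h₂ ν z ζ hz η hη)).trans (le_of_eq ?_)
  ring

theorem factorial_mul_factorial_le {ν : ℕ} {p : ℕ × ℕ}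
    (hp : p ∈ Finset.HasAntidiagonal.antidiagonal ν) :
    (p.1.factorial : ℝ) * p.2.factorial ≤ ν.factorial := by
  rw [Finset.HasAntidiagonal.mem_antidiagonal] at hp
  rw [← hp]
  exact_mod_cast Nat.le_of_dvd (Nat.factorial_pos _) (Nat.factorial_mul_factorial_dvd_factorial_add _ _)

/-- The Cauchy product of two sequences of Gevrey order one. -/
theorem sum_antidiagonal_factorial_le {ν : ℕ} {f : ℕ × ℕ → ℝ} {C a N : ℝ} (hC : 0 ≤ C) (ha : 0 ≤ a)
    (hN : 0 ≤ N) (hf : ∀ p ∈ Finset.HasAntidiagonal.antidiagonal ν, f p ≤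
      C * ((p.1.factorial : ℝ) * p.2.factorial) * (a ^ p.1 * a ^ p.2) / (N ^ p.1 * N ^ p.2)) :
    ∑ p ∈ Finset.HasAntidiagonal.antidiagonal ν, f p ≤ C * ν.factorial * (2 * a) ^ ν / N ^ ν := by
  have h : ∀ p ∈ Finset.HasAntidiagonal.antidiagonal ν, f p ≤
      C * ν.factorial * a ^ ν / N ^ ν := by
    intro p hp
    refine (hf p hp).trans ?_
    have := factorial_mul_factorial_le hp
    rw [Finset.HasAntidiagonal.mem_antidiagonal] at hp
    rw [← pow_add, ← pow_add, hp]
    gcongr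
  refine (Finset.sum_le_card_nsmul _ _ _ h).trans ?_
  rw [Finset.Nat.card_antidiagonal, nsmul_eq_mul, mul_pow]
  -- The number ν + 1 of terms is absorbed into the geometric constant.
  have h2 : ((ν + 1 : ℕ) : ℝ) ≤ 2 ^ ν := by exact_mod_cast Nat.lt_two_pow_self (n := ν)
  refine (mul_le_mul_of_nonneg_right h2 (by positivity)).trans (le_of_eq ?_)
  ring

theorem HolOn.circ {P Q : FormalSeries n} (hP : HolOn Ω S d ρ P) (hQ : HolOn Ω S d ρ Q) :
    HolOn Ω S d ρ (circ Q P) := fun ν x hx =>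
  (exists_germ_circ (fun ν => hP ν x hx) fun ν => hQ ν x hx).choose ν

/-- With Cauchy radii ε in z' and ε‖ζ‖ in ζ', a pair of derivatives costs a constant times
1/(ε²‖ζ‖). This is at most the same constant over ε²‖ηζ‖ because |η| ≤ 1, so it is one more factor
of Gevrey type. -/
theorem IsFormalSymbol.circ (hS : ∀ η ∈ S, 0 < ‖η‖ ∧ ‖η‖ ≤ 1) {P Q : FormalSeries n}
    (hP : IsFormalSymbol Ω S P) (hQ : IsFormalSymbol Ω S Q) : IsFormalSymbol Ω S (circ Q P) := by
  obtain ⟨d, ρ, A, hd, hρ, hρ', hA, hH₁, hH₂, hb₁, hb₂⟩ := hP.exists_common hQ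
  have hsub := region_half_subset (Ω := Ω) hd hρ
  set ε := ρ / 8 with hε
  have hε0 : 0 < ε := by positivity
  -- In 4A one factor 2 comes from ‖ζ + ζ'‖ ≥ ‖ζ‖/2 and the other from the number of terms in the
  -- Cauchy product of Q and P; the second summand is the cost of the derivatives.
  set B := 4 * A + 2 ^ n / (ε * ε) with hB
  have hB1 : 2 * (2 * A) ≤ B := by rw [hB]; linarith [show 0 < 2 ^ n / (ε * ε) by positivity]
  have hB2 : 2 ^ n / (ε * ε) ≤ B := by rw [hB]; linarith
  have hB0 : 0 < B := by positivity
  refine ⟨2 * d, ρ / 2, by positivity, by positivity, by linarith,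
    (hH₁.circ hH₂).mono hsub, 2 * B, by positivity, ?_⟩
  intro Z hZ hZS h hh
  -- As ‖ζ + ζ'‖ ≤ 2‖ζ‖, the exponent h/4 becomes at most h/2 for each factor, and the two
  -- exponentials multiply to e^{h‖ζ‖}.
  obtain ⟨C₁, hC₁, h₁⟩ := hb₁ Z hZ hZS (h / 4) (by positivity)
  obtain ⟨C₂, hC₂, h₂⟩ := hb₂ Z hZ hZS (h / 4) (by positivity)
  refine ⟨C₁ * C₂, by positivity, fun ν z ζ hz η hη => ?_⟩
  have hζ := norm_pos_of_mem_region (by positivity) (by linarith) hz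
  obtain ⟨hη0, hη1⟩ := hS η (hZS hη)
  have hN : ‖η • ζ‖ = ‖η‖ * ‖ζ‖ := norm_smul _ _
  have hN0 : 0 < ‖η • ζ‖ := by rw [hN]; positivity
  have hNle : ‖η • ζ‖ ≤ ‖ζ‖ := by rw [hN]; exact mul_le_of_le_one_left hζ.le hη1
  set N := ‖η • ζ‖
  have hF : ∀ m, ∀ x ∈ Metric.closedBall (0 : E n) ε, ∀ y ∈ Metric.closedBall (0 : E n) (ε * ‖ζ‖),
      AnalyticAt ℂ (fun p : E n × E n => ∑ q ∈ Finset.HasAntidiagonal.antidiagonal m,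
        Q q.1 z (ζ + p.2) η * P q.2 (z + p.1) ζ η) (x, y) ∧
      ‖∑ q ∈ Finset.HasAntidiagonal.antidiagonal m, Q q.1 z (ζ + y) η * P q.2 (z + x) ζ η‖ ≤
        C₁ * C₂ * Real.exp (h * ‖ζ‖) * m.factorial * (2 * (2 * A)) ^ m / N ^ m := by
    intro m x hx y hy
    rw [mem_closedBall_zero_iff] at hx hy
    have hzy : (z, ζ + y) ∈ region Ω d ρ := by
      simpa using add_mem_region hd hρ hρ' hz (z' := 0) (by simpa using hε0.le) hy
    have hzx : (z + x, ζ) ∈ region Ω d ρ := by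
      simpa using add_mem_region hd hρ hρ' hz (ζ' := 0) hx (by simpa using mul_nonneg hε0.le hζ.le)
    constructor
    · refine Finset.analyticAt_fun_sum _ fun q _ => ?_
      refine AnalyticAt.mul ?_ ?_
      · exact (hH₂ q.1 (z, ζ + y, η) ⟨hzy, hZS hη⟩).comp_of_eq
          (f := fun p : E n × E n => (z, ζ + p.2, η)) (analyticAt_of_contDiff (by fun_prop)) rfl
      · exact (hH₁ q.2 (z + x, ζ, η) ⟨hzx, hZS hη⟩).comp_of_eq
          (f := fun p : E n × E n => (z + p.1, ζ, η)) (analyticAt_of_contDiff (by fun_prop)) rfl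
    · refine (norm_sum_le _ _).trans (sum_antidiagonal_factorial_le (by positivity) (by positivity)
        hN0.le fun q _ => ?_)
      rw [norm_mul]
      have hε1 : ε * ‖ζ‖ ≤ ‖ζ‖ / 2 := by nlinarith
      have hy1 : ‖ζ‖ / 2 ≤ ‖ζ + y‖ := by linarith [norm_sub_le_norm_add ζ y]
      have hy2 : ‖ζ + y‖ ≤ 2 * ‖ζ‖ := by linarith [norm_add_le ζ y]
      have hy3 : N / 2 ≤ ‖η • (ζ + y)‖ := by
        rw [hN, norm_smul, mul_div_assoc]; gcongr
      have e2 : ‖Q q.1 z (ζ + y) η‖ ≤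
          C₂ * (q.1.factorial : ℝ) * A ^ q.1 * Real.exp (h / 2 * ‖ζ‖) / (N / 2) ^ q.1 := by
        refine (h₂ q.1 z _ hzy η hη).trans ?_
        gcongr C₂ * _ * _ * Real.exp ?_ / ?_ ^ _
        nlinarith
      have e1 : ‖P q.2 (z + x) ζ η‖ ≤
          C₁ * (q.2.factorial : ℝ) * (2 * A) ^ q.2 * Real.exp (h / 2 * ‖ζ‖) / N ^ q.2 := by
        refine (h₁ q.2 _ ζ hzx η hη).trans ?_
        gcongr C₁ * _ * ?_ ^ _ * Real.exp ?_ / _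
        · linarith
        · nlinarith
      refine (mul_le_mul e2 e1 (norm_nonneg _) (by positivity)).trans (le_of_eq ?_)
      have e3 : Real.exp (h * ‖ζ‖) = Real.exp (h / 2 * ‖ζ‖) * Real.exp (h / 2 * ‖ζ‖) := by
        rw [← Real.exp_add]; congr 1; ring
      rw [e3, div_pow, mul_pow 2 A q.1]
      field_simp
  refine (norm_expOp_le hε0 (mul_pos hε0 hζ) 0 0 hF ν).trans ?_
  have key := sum_antidiagonal_factorial_le (ν := ν) (C := C₁ * C₂ * Real.exp (h * ‖ζ‖)) (a := B)
    (N := N) (f := fun p => (p.2.factorial : ℝ) * (2 ^ n / (ε * (ε * ‖ζ‖))) ^ p.2 *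
      (C₁ * C₂ * Real.exp (h * ‖ζ‖) * p.1.factorial * (2 * (2 * A)) ^ p.1 / N ^ p.1))
    (by positivity) hB0.le hN0.le ?_
  · exact key.trans (le_of_eq (by ring))
  · intro p _
    have e : 2 ^ n / (ε * (ε * ‖ζ‖)) ≤ B / N := by
      rw [← mul_assoc, ← div_div]
      gcongr
    calc (p.2.factorial : ℝ) * (2 ^ n / (ε * (ε * ‖ζ‖))) ^ p.2 *
        (C₁ * C₂ * Real.exp (h * ‖ζ‖) * p.1.factorial * (2 * (2 * A)) ^ p.1 / N ^ p.1) ≤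
        (p.2.factorial : ℝ) * (B / N) ^ p.2 *
        (C₁ * C₂ * Real.exp (h * ‖ζ‖) * p.1.factorial * B ^ p.1 / N ^ p.1) := by gcongr
      _ = _ := by rw [div_pow]; field_simp

end Bounds

/-! ### Symbols and null-symbols under the product -/

section Algebra

variable {n : ℕ} {Ω : Set (E n × E n)} {S : Set ℂ}

theorem IsFormalSymbol.exists_holOn {P Q : FormalSeries n} (hP : IsFormalSymbol Ω S P)
    (hQ : IsFormalSymbol Ω S Q) : ∃ d ρ : ℝ, 0 < d ∧ 0 < ρ ∧ ρ < 1 ∧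
      HolOn Ω S d ρ P ∧ HolOn Ω S d ρ Q := by
  obtain ⟨d, ρ, A, hd, hρ, hρ', hA, hH₁, hH₂, -, -⟩ := hP.exists_common hQ
  exact ⟨d, ρ, hd, hρ, hρ', hH₁, hH₂⟩

theorem IsNullSymbol.exists_holOn {P Q : FormalSeries n} (hP : IsNullSymbol Ω S P)
    (hQ : IsFormalSymbol Ω S Q) : ∃ d ρ : ℝ, 0 < d ∧ 0 < ρ ∧ ρ < 1 ∧
      HolOn Ω S d ρ P ∧ HolOn Ω S d ρ Q := by
  obtain ⟨d₁, ρ₁, hd₁, hρ₁, hρ₁', hH₁, -⟩ := hP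
  obtain ⟨d₂, ρ₂, hd₂, hρ₂, hρ₂', hH₂, -⟩ := hQ
  obtain ⟨d, ρ, hd, hρ, hρ', hs₁, hs₂⟩ := exists_region_subset (Ω := Ω) hd₁ hρ₁ hρ₁' hρ₂ hρ₂'
  exact ⟨d, ρ, hd, hρ, hρ', hH₁.mono hs₁, hH₂.mono hs₂⟩

theorem HolOn.partialSum {d ρ : ℝ} {P : FormalSeries n} (hP : HolOn Ω S d ρ P) :
    HolOn Ω S d ρ (partialSum P) :=
  fun ν x hx => AnalyticSeriesAt.partialSum (fun ν => hP ν x hx) ν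

theorem HolOn.etaDeriv {d ρ : ℝ} {P : FormalSeries n} (hP : HolOn Ω S d ρ P) :
    HolOn Ω S d ρ (etaDeriv P) :=
  fun ν x hx => (exists_germ_etaDeriv fun ν => hP ν x hx).choose ν

theorem IsNullSymbol.circ_right (hS : ∀ η ∈ S, 0 < ‖η‖ ∧ ‖η‖ ≤ 1) {P Q : FormalSeries n}
    (hP : IsNullSymbol Ω S P) (hQ : IsFormalSymbol Ω S Q) : IsNullSymbol Ω S (circ Q P) := by
  obtain ⟨d, ρ, hd, hρ, hρ', hH₁, hH₂⟩ := hP.exists_holOn hQ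
  refine isNullSymbol_iff.2 (((isNullSymbol_iff.1 hP).circ hS hQ).congr
    ⟨d, ρ, hd, hρ, hρ', (hH₁.circ hH₂).partialSum, fun ν z ζ hz η hη => ?_⟩)
  exact (circ_partialSum_right (x := (z, ζ, η)) (fun ν => hH₁ ν _ ⟨hz, hη⟩)
    (fun ν => hH₂ ν _ ⟨hz, hη⟩) ν).symm

theorem IsNullSymbol.circ_left (hS : ∀ η ∈ S, 0 < ‖η‖ ∧ ‖η‖ ≤ 1) {P Q : FormalSeries n}
    (hP : IsFormalSymbol Ω S P) (hQ : IsNullSymbol Ω S Q) : IsNullSymbol Ω S (circ Q P) := by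
  obtain ⟨d, ρ, hd, hρ, hρ', hH₂, hH₁⟩ := hQ.exists_holOn hP
  refine isNullSymbol_iff.2 ((hP.circ hS (isNullSymbol_iff.1 hQ)).congr
    ⟨d, ρ, hd, hρ, hρ', (hH₁.circ hH₂).partialSum, fun ν z ζ hz η hη => ?_⟩)
  exact (circ_partialSum_left (x := (z, ζ, η)) (fun ν => hH₁ ν _ ⟨hz, hη⟩)
    (fun ν => hH₂ ν _ ⟨hz, hη⟩) ν).symm

/-- By the Leibniz rule ∂_η(Q ∘ P) is a sum of two products, each with one factor a null-symbol. -/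
theorem IsSymbol.circ (hS : ∀ η ∈ S, 0 < ‖η‖ ∧ ‖η‖ ≤ 1) {P Q : FormalSeries n}
    (hP : IsSymbol Ω S P) (hQ : IsSymbol Ω S Q) : IsSymbol Ω S (circ Q P) := by
  rw [isSymbol_iff] at hP hQ ⊢
  refine ⟨hP.1.circ hS hQ.1, isNullSymbol_iff.2 ?_⟩
  obtain ⟨d, ρ, hd, hρ, hρ', hH₁, hH₂⟩ := hP.1.exists_holOn hQ.1
  refine ((isNullSymbol_iff.1 (IsNullSymbol.circ_left hS hP.1 hQ.2)).add
    (isNullSymbol_iff.1 (hP.2.circ_right hS hQ.1))).congr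
    ⟨d, ρ, hd, hρ, hρ', (hH₁.circ hH₂).etaDeriv.partialSum, fun ν z ζ hz η hη => ?_⟩
  refine Eq.trans (Finset.sum_congr rfl fun k _ => ?_) Finset.sum_add_distrib
  exact etaDeriv_circ (x := (z, ζ, η)) (fun ν => hH₁ ν _ ⟨hz, hη⟩) (fun ν => hH₂ ν _ ⟨hz, hη⟩) k

end Algebra

/-! ### The two forms of the product -/

section Translation

variable {n : ℕ}

theorem pderiv_comp_const_add (i : Fin n) (g : E n → ℂ) (a : E n) :
    pderiv i (fun x => g (a + x)) = fun x => pderiv i g (a + x) := by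
  funext x
  simp only [pderiv, lineDeriv, add_assoc]

theorem mderiv_comp_const_add (α : Fin n → ℕ) (g : E n → ℂ) (a : E n) :
    mderiv α (fun x => g (a + x)) = fun x => mderiv α g (a + x) := by
  unfold mderiv
  induction List.finRange n with
  | nil => rfl
  | cons i L ih =>
    rw [List.foldr_cons, List.foldr_cons, ih]
    generalize L.foldr (fun i g => (pderiv i)^[α i] g) g = h
    induction α i with
    | zero => rfl
    | succ k ihk => rw [Function.iterate_succ_apply', Function.iterate_succ_apply', ihk,
        pderiv_comp_const_add]

theorem expOp_comp_const_add (F : ℕ → E n → E n → ℂ) (ν : ℕ) (a b z ζ : E n) :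
    expOp (fun m x y => F m (a + x) (b + y)) ν z ζ = expOp F ν (a + z) (b + ζ) := by
  refine Finset.sum_congr rfl fun p _ => Finset.sum_congr rfl fun α _ => congrArg _ ?_
  have h : ∀ y, mderiv α (fun x => F p.1 (a + x) (b + y)) z =
      mderiv α (fun x => F p.1 x (b + y)) (a + z) := fun y =>
    congrFun (mderiv_comp_const_add α (fun x => F p.1 x (b + y)) a) z
  simp only [h]
  exact congrFun (mderiv_comp_const_add α (fun y => mderiv α (fun x => F p.1 x y) (a + z)) b) ζ

/-- The two expressions for the product agree. -/
theorem circ_eq_expOp (Q P : FormalSeries n) (ν : ℕ) (z ζ : E n) (η : ℂ) :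
    circ Q P ν z ζ η = expOp (fun m z' ζ' =>
      ∑ q ∈ Finset.HasAntidiagonal.antidiagonal m, Q q.1 z ζ' η * P q.2 z' ζ η) ν z ζ := by
  have h := expOp_comp_const_add (fun m z' ζ' =>
    ∑ q ∈ Finset.HasAntidiagonal.antidiagonal m, Q q.1 z ζ' η * P q.2 z' ζ η) ν z ζ 0 0
  rw [add_zero, add_zero] at h
  exact h

end Translation

/-! ### Thickenings under a change of coordinates -/

section Geometry

variable {n : ℕ}

/-- Transposition of endomorphisms of `ℂⁿ`. -/
noncomputable def transposeMap (n : ℕ) : (E n →L[ℂ] E n) →ₗ[ℂ] (E n →L[ℂ] E n) :=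
  (LinearMap.toContinuousLinearMap : (E n →ₗ[ℂ] E n) ≃ₗ[ℂ] (E n →L[ℂ] E n)).toLinearMap ∘ₗ
    Matrix.toLin'.toLinearMap ∘ₗ (Matrix.transposeLinearEquiv (Fin n) (Fin n) ℂ ℂ).toLinearMap ∘ₗ
      LinearMap.toMatrix'.toLinearMap ∘ₗ ContinuousLinearMap.coeLM ℂ

theorem transposeMap_apply (L : E n →L[ℂ] E n) (v : E n) :
    transposeMap n L v = (LinearMap.toMatrix' (L : E n →ₗ[ℂ] E n)).transpose.mulVec v := rfl

theorem transposeMap_comp (L M : E n →L[ℂ] E n) (v : E n) :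
    transposeMap n M (transposeMap n L v) = transposeMap n (L.comp M) v := by
  simp only [transposeMap_apply, ContinuousLinearMap.toLinearMap_comp, LinearMap.toMatrix'_comp,
    Matrix.transpose_mul, Matrix.mulVec_mulVec]

theorem transposeMap_id (v : E n) : transposeMap n (ContinuousLinearMap.id ℂ (E n)) v = v := by
  simp [transposeMap_apply]

theorem continuous_transposeMap : Continuous (transposeMap n) :=
  LinearMap.continuous_of_finiteDimensional _

theorem jacobianSymm_transpose_mulVec (Φ : OpenPartialHomeomorph (E n) (E n)) (z v : E n) :
    (jacobianSymm Φ z).transpose.mulVec v = transposeMap n (fderiv ℂ Φ.symm z) v := by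
  rw [transposeMap_apply]
  congr 2

theorem IsBiholomorphic.fderiv_symm_comp {Φ : OpenPartialHomeomorph (E n) (E n)}
    (hΦ : IsBiholomorphic Φ) {w : E n} (hw : w ∈ Φ.source) :
    (fderiv ℂ Φ.symm (Φ w)).comp (fderiv ℂ Φ w) = ContinuousLinearMap.id ℂ (E n) := by
  have h := (hΦ.2 _ (Φ.map_source hw)).differentiableAt.hasFDerivAt.comp w
    (hΦ.1 _ hw).differentiableAt.hasFDerivAt
  refine h.unique ((hasFDerivAt_id w).congr_of_eventuallyEq ?_)
  filter_upwards [Φ.open_source.mem_nhds hw] with y hy using Φ.left_inv hy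

/-- A continuous family of linear isomorphisms over a continuous map sends small thickenings of a
set into given thickenings of its image. -/
theorem exists_region_map {s L : Set (E n)} (hs : IsOpen s) (hLc : IsCompact L) (hLs : L ⊆ s)
    {φ : E n → E n} {A B : E n → E n →L[ℂ] E n} (hφ : ∀ w ∈ s, ContinuousAt φ w)
    (hA : ∀ w ∈ s, ContinuousAt A w) (hB : ∀ w ∈ s, ContinuousAt B w)
    (hBA : ∀ w ∈ s, ∀ v, B w (A w v) = v) {Ω : Set (E n × E n)}
    (hL : ∀ w ∈ s, ∀ v, (φ w, A w v) ∈ Ω → w ∈ L)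
    {d ρ : ℝ} (hd : 0 < d) (hρ : 0 < ρ) :
    ∃ d' ρ' : ℝ, 0 < d' ∧ 0 < ρ' ∧ ρ' < 1 ∧
      ∀ w μ, (w, μ) ∈ region {x : E n × E n | x.1 ∈ s ∧ (φ x.1, A x.1 x.2) ∈ Ω} d' ρ' →
        w ∈ s ∧ (φ w, A w μ) ∈ region Ω d ρ := by
  -- A compact neighbourhood N of L inside s gives uniform bounds on A and its left inverse B, and a
  -- uniform modulus of continuity.
  obtain ⟨δ₀, hδ₀, hN⟩ := hLc.exists_cthickening_subset_open hs hLs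
  have hNc := hLc.cthickening (r := δ₀)
  have hNcl : IsClosed (Metric.cthickening δ₀ L) := Metric.isClosed_cthickening
  have hLN : ∀ w ∈ L, w ∈ Metric.cthickening δ₀ L := fun w hw => Metric.self_subset_cthickening _ hw
  have hLN' : ∀ w ∈ L, ∀ w', ‖w'‖ ≤ δ₀ → w + w' ∈ Metric.cthickening δ₀ L := fun w hw w' hw' =>
    Metric.mem_cthickening_of_dist_le _ w _ _ hw (by simpa using hw')
  generalize Metric.cthickening δ₀ L = N at *
  obtain ⟨c₁, hc₁⟩ := hNc.exists_bound_of_continuousOn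
    (fun w hw => (hA w (hN hw)).continuousWithinAt)
  obtain ⟨c₂, hc₂⟩ := hNc.exists_bound_of_continuousOn
    (fun w hw => (hB w (hN hw)).continuousWithinAt)
  obtain ⟨c, hc1, hcc₁, hcc₂⟩ : ∃ c : ℝ, 1 ≤ c ∧ c₁ ≤ c ∧ c₂ ≤ c :=
    ⟨max 1 (max c₁ c₂), le_max_left _ _, (le_max_left _ _).trans (le_max_right _ _),
      (le_max_right _ _).trans (le_max_right _ _)⟩
  have hAc : ∀ w ∈ N, ∀ v, ‖A w v‖ ≤ c * ‖v‖ := fun w hw v => (A w).le_of_opNorm_le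
    ((hc₁ w hw).trans hcc₁) v
  have hAinv : ∀ w ∈ N, ∀ v, ‖v‖ ≤ c * ‖A w v‖ := by
    intro w hw v
    have h := (B w).le_of_opNorm_le ((hc₂ w hw).trans hcc₂) (A w v)
    rwa [hBA w (hN hw)] at h
  have huc := hNc.uniformContinuousOn_of_continuous (f := fun w => (φ w, A w))
    fun w hw => ((hφ w (hN hw)).prodMk (hA w (hN hw))).continuousWithinAt
  -- The image of a shift has two errors in ζ, relative to ‖A w μ‖: 2εc from the variation of A, and
  -- ρ'c² from the shift of μ. Each is made at most ρ/2.
  set ε := ρ / (4 * c) with hε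
  have hε0 : 0 < ε := by positivity
  have hεc : ε * c = ρ / 4 := by rw [hε]; field_simp
  have hερ : ε ≤ ρ := by nlinarith
  obtain ⟨δ, hδ, huc⟩ := Metric.uniformContinuousOn_iff.1 huc ε hε0
  obtain ⟨ρ', hρ0, h1, h2, h3, h4⟩ : ∃ ρ' : ℝ, 0 < ρ' ∧ ρ' ≤ δ₀ ∧ ρ' ≤ δ / 2 ∧ ρ' ≤ 1 / 2 ∧
      ρ' ≤ ρ / (2 * c ^ 2) :=
    ⟨min (min δ₀ (δ / 2)) (min (1 / 2) (ρ / (2 * c ^ 2))),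
      lt_min (lt_min hδ₀ (by positivity)) (lt_min (by norm_num) (by positivity)),
      (min_le_left _ _).trans (min_le_left _ _), (min_le_left _ _).trans (min_le_right _ _),
      (min_le_right _ _).trans (min_le_left _ _), (min_le_right _ _).trans (min_le_right _ _)⟩
  have h4' : ρ' * c ^ 2 ≤ ρ / 2 := by
    rw [le_div_iff₀ (by positivity)] at h4
    linarith
  have hT : ∀ x : E n × E n, (∃ w μ w' μ' : E n,
      (w, μ) ∈ {x : E n × E n | x.1 ∈ s ∧ (φ x.1, A x.1 x.2) ∈ Ω} ∧
      ‖w'‖ ≤ ρ' ∧ ‖μ'‖ ≤ ρ' * ‖μ‖ ∧ x = (w + w', μ + μ')) →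
      x.1 ∈ N ∧ (φ x.1, A x.1 x.2) ∈ {x | ∃ z ζ z' ζ' : E n, (z, ζ) ∈ Ω ∧ ‖z'‖ ≤ ρ ∧
        ‖ζ'‖ ≤ ρ * ‖ζ‖ ∧ x = (z + z', ζ + ζ')} := by
    rintro _ ⟨w, μ, w', μ', ⟨hw, hwμ⟩, hw', hμ', rfl⟩
    simp only at hw hwμ
    have hwN : w ∈ N := hLN w (hL w hw μ hwμ)
    have hwN' : w + w' ∈ N := hLN' w (hL w hw μ hwμ) w' (by linarith)
    have hdist : dist (w + w') w < δ := by simpa using show ‖w'‖ < δ by linarith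
    refine ⟨hwN', φ w, A w μ, φ (w + w') - φ w, A (w + w') (μ + μ') - A w μ, hwμ, ?_, ?_, by simp⟩
    · have := huc _ hwN' _ hwN hdist
      rw [Prod.dist_eq, max_lt_iff, dist_eq_norm] at this
      exact this.1.le.trans hερ
    · have h5 := huc _ hwN' _ hwN hdist
      rw [Prod.dist_eq, max_lt_iff] at h5
      have h6 := (A (w + w') - A w).le_of_opNorm_le ((dist_eq_norm _ _).symm.trans_le h5.2.le) (μ + μ')
      have h7 := hAc w hwN μ'
      have h8 : A (w + w') (μ + μ') - A w μ = (A (w + w') - A w) (μ + μ') + A w μ' := by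
        rw [sub_apply, map_add (A w)]
        abel
      have h9 := hAinv w hwN μ
      have h10 := norm_add_le μ μ'
      have h11 : ρ' * ‖μ‖ ≤ 1 * ‖μ‖ := by gcongr; linarith
      rw [h8]
      refine (norm_add_le _ _).trans ?_
      calc ‖(A (w + w') - A w) (μ + μ')‖ + ‖A w μ'‖ ≤ ε * (2 * ‖μ‖) + c * (ρ' * ‖μ‖) := by
            refine add_le_add (h6.trans ?_) (h7.trans ?_)
            · gcongr; linarith
            · gcongr
        _ = (2 * ε + c * ρ') * ‖μ‖ := by ring
        _ ≤ (2 * ε + c * ρ') * (c * ‖A w μ‖) := by gcongr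
        _ = (2 * (ε * c) + ρ' * c ^ 2) * ‖A w μ‖ := by ring
        _ ≤ ρ * ‖A w μ‖ := by gcongr; linarith
  -- Since ρ' ≤ 1/2, the bound on ‖μ‖ is at least cd, and c‖A w μ‖ ≥ ‖μ‖ returns ‖A w μ‖ ≥ d.
  -- Membership in the closure follows from `hT`, as N is closed and the map is continuous there.
  refine ⟨2 * c * d, ρ', by positivity, hρ0, by linarith, fun w μ hwμ => ?_⟩
  obtain ⟨hcl, hnorm⟩ := hwμ
  have hwN : w ∈ N := by
    have hN' : IsClosed {x : E n × E n | x.1 ∈ N} := hNcl.preimage continuous_fst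
    exact closure_minimal (fun x hx => (hT x hx).1) hN' hcl
  refine ⟨hN hwN, ?_, ?_⟩
  · have ht : ContinuousAt (fun x : E n × E n => (φ x.1, A x.1 x.2)) (w, μ) := by
      refine ContinuousAt.prodMk ((hφ w (hN hwN)).comp_of_eq continuousAt_fst rfl) ?_
      exact ((hA w (hN hwN)).comp_of_eq (g := A) continuousAt_fst rfl).clm_apply continuousAt_snd
    exact mem_closure_iff_frequently.2
      (ht.tendsto.frequently ((mem_closure_iff_frequently.1 hcl).mono fun x hx => (hT x hx).2))
  · have h5 := hAinv w hwN μ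
    have h6 : 2 * c * d * (1 - ρ') ≤ ‖μ‖ := hnorm
    have h7 : c * d ≤ 2 * c * d * (1 - ρ') := by
      have : 0 < c * d := by positivity
      nlinarith
    have h8 : c * d ≤ c * ‖A w μ‖ := by linarith
    have h9 := le_of_mul_le_mul_left h8 (by positivity)
    show d * (1 - ρ) ≤ ‖A w μ‖
    nlinarith

theorem exists_region_pullback {Φ : OpenPartialHomeomorph (E n) (E n)} (hΦ : IsBiholomorphic Φ)
    {Ω : Set (E n × E n)} (hΩ : ConicSubset Ω Set.univ) (hL : closure (Prod.fst '' Ω) ⊆ Φ.target)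
    {d ρ : ℝ} (hd : 0 < d) (hρ : 0 < ρ) :
    ∃ d' ρ' : ℝ, 0 < d' ∧ 0 < ρ' ∧ ρ' < 1 ∧ ∀ w μ, (w, μ) ∈ region (pullbackSet Φ Ω) d' ρ' →
      w ∈ Φ.source ∧ (Φ w, (jacobianSymm Φ (Φ w)).transpose.mulVec μ) ∈ region Ω d ρ := by
  simp only [pullbackSet, jacobianSymm_transpose_mulVec]
  obtain ⟨K, hK, -, hKΩ⟩ := hΩ
  have hLc : IsCompact (closure (Prod.fst '' Ω)) := by
    refine (hK.image continuous_fst).of_isClosed_subset isClosed_closure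
      (closure_minimal ?_ (hK.image continuous_fst).isClosed)
    rintro _ ⟨⟨z, ζ⟩, h, rfl⟩
    obtain ⟨c, -, ζ₀, h0, -⟩ := hKΩ z ζ h
    exact ⟨(z, ζ₀), h0, rfl⟩
  -- The closed projection of Ω is compact because Ω lies in the cone over a compact set. Here A is
  -- the transposed Jacobian of Φ⁻¹ and B that of Φ.
  refine exists_region_map (L := Φ.symm '' closure (Prod.fst '' Ω)) Φ.open_source
    (hLc.image_of_continuousOn (Φ.continuousOn_symm.mono hL)) ?_
    (A := fun w => transposeMap n (fderiv ℂ Φ.symm (Φ w)))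
    (B := fun w => transposeMap n (fderiv ℂ Φ w)) (fun w hw => Φ.continuousAt hw)
    (fun w hw => continuous_transposeMap.continuousAt.comp
      ((hΦ.2 _ (Φ.map_source hw)).fderiv.continuousAt.comp (Φ.continuousAt hw)))
    (fun w hw => continuous_transposeMap.continuousAt.comp (hΦ.1 _ hw).fderiv.continuousAt)
    (fun w hw v => by rw [transposeMap_comp, hΦ.fderiv_symm_comp hw, transposeMap_id])
    (fun w hw v h => ⟨Φ w, subset_closure ⟨_, h, rfl⟩, Φ.left_inv hw⟩) hd hρ
  rintro _ ⟨z, hz, rfl⟩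
  exact Φ.map_target (hL hz)

end Geometry

end ApparentSymbol

theorem theoremS (n : ℕ) (Ω : Set (E n × E n)) (hΩ_open : IsOpen Ω) (hΩ_conic : IsConic Ω)
    (hΩ : ConicSubset Ω Set.univ)
    (r θ : ℝ) (hr : 0 < r) (hr' : r < 1 / 2) (hθ : 0 < θ) (hθ' : θ < 1 / 2) :
    -- the two expressions for the product agree
    (∀ P Q : FormalSeries n, IsSymbol Ω (sector r θ) P → IsSymbol Ω (sector r θ) Q →
      ∀ (ν : ℕ) (z ζ : E n) (η : ℂ),
        circ Q P ν z ζ η =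
          expOp (fun m z' ζ' =>
            ∑ q ∈ Finset.HasAntidiagonal.antidiagonal m, Q q.1 z ζ' η * P q.2 z' ζ η) ν z ζ) ∧
    -- (1)
    (∀ P Q : FormalSeries n, IsSymbol Ω (sector r θ) P → IsSymbol Ω (sector r θ) Q →
      IsSymbol Ω (sector r θ) (circ Q P)) ∧
    (∀ P Q : FormalSeries n, IsNullSymbol Ω (sector r θ) P → IsSymbol Ω (sector r θ) Q →
      IsNullSymbol Ω (sector r θ) (circ Q P)) ∧
    (∀ P Q : FormalSeries n, IsSymbol Ω (sector r θ) P → IsNullSymbol Ω (sector r θ) Q →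
      IsNullSymbol Ω (sector r θ) (circ Q P)) ∧
    -- (2)
    (∀ P Q R : FormalSeries n, IsSymbol Ω (sector r θ) P → IsSymbol Ω (sector r θ) Q →
      IsSymbol Ω (sector r θ) R →
      SymbolEq Ω (sector r θ)
        (circ R (circ Q P))
        (circ (circ R Q) P)) ∧
    -- (3)
    (∀ (Φ : OpenPartialHomeomorph (E n) (E n)), IsBiholomorphic Φ →
      closure (Prod.fst '' Ω) ⊆ Φ.target →
      ∀ J : E n → E n → Matrix (Fin n) (Fin n) ℂ, IsJStar Φ J →
      ∀ P Q : FormalSeries n, IsSymbol Ω (sector r θ) P → IsSymbol Ω (sector r θ) Q →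
        SymbolEq (pullbackSet Φ Ω) (sector r θ)
          (circ (pullback Φ J Q) (pullback Φ J P))
          (pullback Φ J (circ Q P))) := by
  have hS : ∀ η ∈ sector r θ, 0 < ‖η‖ ∧ ‖η‖ ≤ 1 := fun η hη => ⟨hη.1, by linarith [hη.2.1]⟩
  refine ⟨fun P Q _ _ ν z ζ η => circ_eq_expOp Q P ν z ζ η, fun P Q hP hQ => hP.circ hS hQ,
    fun P Q hP hQ => hP.circ_right hS hQ.1, fun P Q hP hQ => IsNullSymbol.circ_left hS hP.1 hQ,
    fun P Q R hP hQ hR => ?_, fun Φ hΦ hL J hJ P Q hP hQ => ?_⟩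
  · obtain ⟨d, ρ, hd, hρ, hρ', hPQR⟩ : ∃ d ρ : ℝ, 0 < d ∧ 0 < ρ ∧ ρ < 1 ∧
        HolOn Ω (sector r θ) d ρ P ∧ HolOn Ω (sector r θ) d ρ Q ∧ HolOn Ω (sector r θ) d ρ R := by
      obtain ⟨d₁, ρ₁, hd₁, hρ₁, hρ₁', hP₁, hQ₁⟩ :=
        IsFormalSymbol.exists_holOn (isSymbol_iff.1 hP).1 (isSymbol_iff.1 hQ).1
      obtain ⟨d₂, ρ₂, hd₂, hρ₂, hρ₂', hR₂, -⟩ := hR.1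
      obtain ⟨d, ρ, hd, hρ, hρ', hs₁, hs₂⟩ := exists_region_subset (Ω := Ω) hd₁ hρ₁ hρ₁' hρ₂ hρ₂'
      exact ⟨d, ρ, hd, hρ, hρ', hP₁.mono hs₁, hQ₁.mono hs₁, hR₂.mono hs₂⟩
    have key := fun (x : Phase n) (hx : (x.1, x.2.1) ∈ region Ω d ρ ∧ x.2.2 ∈ sector r θ) =>
      circ_assoc (x := x) (fun ν => hPQR.1 ν x hx) (fun ν => hPQR.2.1 ν x hx)
        (fun ν => hPQR.2.2 ν x hx)
    exact ⟨d, ρ, hd, hρ, hρ', fun ν x hx => (key x hx).1 ν, fun ν x hx => (key x hx).2.1 ν,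
      fun ν z ζ hz η hη => (key (z, ζ, η) ⟨hz, hη⟩).2.2 ν⟩
  · obtain ⟨d₁, ρ₁, hd₁, hρ₁, hρ₁', hP₁, hQ₁⟩ :=
      IsFormalSymbol.exists_holOn (isSymbol_iff.1 hP).1 (isSymbol_iff.1 hQ).1
    obtain ⟨d, ρ, hd, hρ, hρ', hreg⟩ := exists_region_pullback hΦ hΩ hL hd₁ hρ₁
    have key : ∀ x : Phase n, (x.1, x.2.1) ∈ region (pullbackSet Φ Ω) d ρ ∧ x.2.2 ∈ sector r θ →
        AnalyticSeriesAt (circ (pullback Φ J Q) (pullback Φ J P)) x ∧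
        AnalyticSeriesAt (pullback Φ J (circ Q P)) x ∧
        ∀ ν, circ (pullback Φ J Q) (pullback Φ J P) ν x.1 x.2.1 x.2.2 =
          pullback Φ J (circ Q P) ν x.1 x.2.1 x.2.2 := by
      intro x hx
      obtain ⟨hw, hmem⟩ := hreg _ _ hx.1
      -- The region is described with the Jacobian of Φ⁻¹, whereas the pull-back evaluates symbols
      -- at ᵗJ(Φ(w), Φ(w))λ; on the diagonal the two matrices agree.
      rw [jacobianSymm_eq hΦ hJ hw] at hmem
      exact circ_pullback hΦ hJ hw (fun ν => hP₁ ν _ ⟨hmem, hx.2⟩) fun ν => hQ₁ ν _ ⟨hmem, hx.2⟩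
    exact ⟨d, ρ, hd, hρ, hρ', fun ν x hx => (key x hx).1 ν, fun ν x hx => (key x hx).2.1 ν,
      fun ν z ζ hz η hη => (key (z, ζ, η) ⟨hz, hη⟩).2.2 ν⟩
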